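/- \textbf{Setting.} Let $N=\bigoplus_\gamma M_{n_\gamma}(\mathbb C)$ be a finite-dimensional von Neumann algebra with matrix units $e^\gamma_{ij}$; for linear maps $s,r$ on $N$ put $e_{s,r}=\sum_\gamma\sum_{i,j}\frac1{n_\gamma}s(e^\gamma_{ij})\otimes r(e^\gamma_{ji})$. Let $I$ be a multiplicative partial isometry on $H\otimes H$ ($H$ a finite-dimensional Hilbert space) with base $(N,\alpha,\beta,\hat\beta)$: $\alpha$ is a faithful unital $*$-representation and $\beta,\hat\beta$ are faithful unital $*$-antirepresentations of $N$ on $H$ that commute pairwise and satisfy $\mathrm{tr}\circ\alpha=\mathrm{tr}\circ\beta=\mathrm{tr}\circ\hat\beta$; $I^*I=e_{\hat\beta,\alpha}$ and $II^*=e_{\alpha,\beta}$; $I$ commutes with $\beta(N)\otimes\hat\beta(N)$; $I(\alpha(n)\otimes\beta(n'))=(\hat\beta(n')\otimes\alpha(n))I$; and $I_{12}I_{13}I_{23}=I_{23}I_{12}$. Let $S=\{(\omega\otimes i)(I)\}$ and $\hat S=\{(i\otimes\omega)(I)\}$, $\omega$ running through the linear forms on $\mathcal L(H)$. Assume that $I$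 is regular, i.e. $S$ and $\hat S$ are von Neumann subalgebras of $\mathcal L(H)$. They carry the quantum groupoid structures $$\Gamma(s)=I(s\otimes1)I^*,\quad \kappa((\omega\otimes i)(I))=(\omega\otimes i)(I^*),\quad S_t=\beta(N),$$ $$\hat\Gamma(\hat s)=I^*(1\otimes\hat s)I,\quad \hat\kappa((i\otimes\omega)(I))=(i\otimes\omega)(I^*),\quad \hat S_t=\alpha(N).$$ A normalized Haar measure of $(S,\Gamma,\kappa)$ is a faithful positive linear form $\varphi$ on $S$ with $\varphi\circ\kappa=\varphi$, $(i\otimes\varphi)(\Gamma(1))=1$ and $(i\otimes\varphi)((1\otimes y)\Gamma(x))=\kappa\big((i\otimes\varphi)(\Gamma(y)(1\otimes x))\big)$; similarly for $\hat S$. Assume that $I$ is in irreducible form: there are vectors $e,\hat e\in H$ such that $e$ is cyclic and separating for $S$, fixed ($I(e\otimes\eta)=II^*(e\otimes\eta)$ for all $\eta$) and $\langle e,\cdot\, e\rangle$ is the normalized Haar measure of $S$; $\hat e$ is cyclic and separating for $\hat S$, cofixed ($I(\eta\otimes\hat e)=II^*(\eta\otimes\hat e)$ for all $\eta$) and $\langle\hat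 e,\cdot\,\hat e\rangle$ is the normalized Haar measure of $\hat S$; and $\hat e$ lies in the natural positive cone $\{xJxe: x\in S\}$, where $J$ is the modular conjugation of $(S,e)$. Let $\hat J$ be the modular conjugation of $(\hat S,\hat e)$, $U=J\hat J$, $\Sigma$ the flip of $H\otimes H$ and $\tilde I=\Sigma(1\otimes U)I(1\otimes U)\Sigma$. Denote by $S'$ the commutant of $S$ in $\mathcal L(H)$. A right action of $(S,\Gamma,\kappa)$ on $(A,b)$, where $A$ is a von Neumann algebra (a $\sigma$-weakly closed $*$-algebra of operators on a Hilbert space $K$, whose unit may differ from $1_K$) and $b:S_t\to A$ is a faithful unital $*$-antirepresentation, is an injective normal (not necessarily unital) $*$-homomorphism $\delta:A\to A\otimes S$ such that $(\delta\otimes i)\delta=(i\otimes\Gamma)\delta$ and $\delta(b(x))=e_{b,i}(1\otimes\kappa(x))$ for $x\in S_t$; here $e_{b,i}$ is the projection $\sum_\gamma\sum_{i,j}\frac1{n_\gamma}b(f^\gamma_{ij})\otimes f^\gamma_{ji}$ for matrix units $f^\gamma_{ij}$ of $S_t$. A coaction of $(S,\Gamma,\kappa)$ is a right action of $(\hat S,\hat\Gamma,\hat\kappa)$.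 The crossed product $A\rtimes_\delta S$ is the von Neumann algebra generated by $\delta(A)$ and $e_{b,i}(1\otimes\hat S)$; for a coaction $\hat\delta$ on $(B,\hat b)$, the crossed product $B\hat\rtimes_{\hat\delta}\hat S$ is the von Neumann algebra generated by $\hat\delta(B)$ and $e_{\hat b,\hat i}(1\otimes S')$. \textbf{Proposition.} Let $\delta$ be a right action of $(S,\Gamma,\kappa)$ on $(A,b)$. Then the formulas $$\hat b(\alpha(n))=e_{b,i}(1\otimes\hat\beta(n))\quad(n\in N),\qquad \hat\delta(x)=\tilde I_{23}(x\otimes1)\tilde I_{23}^*\quad(x\in A\rtimes_\delta S)$$ define a faithful unital $*$-antirepresentation $\hat b:\hat S_t\to A\rtimes_\delta S$ and a (right) coaction $\hat\delta$ of $(S,\Gamma,\kappa)$ on $(A\rtimes_\delta S,\hat b)$. Moreover, with $\hat SS'$ the linear span of the products $\hat s s'$ ($\hat s\in\hat S$, $s'\in S'$), one has $\delta(1)(1\otimes\hat SS')=\delta(1)(1\otimes\beta(N)')$, and the double crossed product $(A\rtimes_\delta S)\hat\rtimes_{\hat\delta}\hat S$ is $*$-isomorphic to the von Neumann subalgebra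 of $\delta(1)(A\otimes\mathcal L(H))\delta(1)$ generated by $\delta(A)$ and $\delta(1)(1\otimes\beta(N)')$. -/

import Mathlib

open scoped TensorProduct ComplexOrder InnerProductSpace Topology
open MulOpposite TensorProduct ContinuousLinearMap

noncomputable section

namespace FiniteQG

universe u v w

/-! ### Hilbert space preliminaries -/

/-- The bounded operators on `K`. -/
abbrev Op (K : Type u) [NormedAddCommGroup K] [InnerProductSpace ℂ K] : Type u := K →L[ℂ] K

/-- The Hilbert space `K ⊗ H`, for `H` finite-dimensional. -/
abbrev Ten (K : Type u) [NormedAddCommGroup K] [InnerProductSpace ℂ K]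
    (H : Type v) [NormedAddCommGroup H] [InnerProductSpace ℂ H] : Type (max u v) := K ⊗[ℂ] H

section Hilbert

variable {K : Type u} [NormedAddCommGroup K] [InnerProductSpace ℂ K]
variable {H : Type v} [NormedAddCommGroup H] [InnerProductSpace ℂ H]

/-- `ket η : K → K ⊗ H`, `k ↦ k ⊗ η`. -/
def ket (K : Type u) [NormedAddCommGroup K] [InnerProductSpace ℂ K] (η : H) :
    K →L[ℂ] Ten K H :=
  (mkL ℂ K H).flip η

/-- The coordinate map `k ⊗ h ↦ ⟪η, h⟫ k`. -/
def bra (K : Type u) [NormedAddCommGroup K] [InnerProductSpace ℂ K] (η : H) :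
    Ten K H →L[ℂ] K :=
  (ridIsometry ℂ K).toContinuousLinearEquiv.toContinuousLinearMap ∘L
    mapL (ContinuousLinearMap.id ℂ K) (innerSL ℂ η)

@[simp] theorem ket_apply (η : H) (k : K) : ket K η k = k ⊗ₜ[ℂ] η := rfl

@[simp] theorem bra_tmul (η h : H) (k : K) : bra K η (k ⊗ₜ[ℂ] h) = ⟪η, h⟫_ℂ • k := by
  simp [bra]

/-- `K ⊗ H` is a Hilbert space when `K` is one and `H` is finite-dimensional. -/
instance completeSpace_tensor [CompleteSpace K] [FiniteDimensional ℂ H] :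
    CompleteSpace (Ten K H) := by
  classical
  let b := stdOrthonormalBasis ℂ H
  let Φ : (Fin (Module.finrank ℂ H) → K) →L[ℂ] Ten K H :=
    ∑ i, ket K (b i) ∘L ContinuousLinearMap.proj i
  let Ψ : Ten K H →L[ℂ] (Fin (Module.finrank ℂ H) → K) :=
    ContinuousLinearMap.pi fun i => bra K (b i)
  have h1 : Function.LeftInverse Ψ Φ := by
    intro v
    funext j
    simp [Φ, Ψ, orthonormal_iff_ite.mp b.orthonormal]
  have h2 : Function.RightInverse Ψ Φ := by
    intro x
    induction x using TensorProduct.induction_on with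
    | zero => simp
    | tmul k h =>
      simp only [Φ, Ψ, sum_apply, ContinuousLinearMap.comp_apply,
        ContinuousLinearMap.proj_apply, ContinuousLinearMap.coe_pi', bra_tmul, ket_apply,
        TensorProduct.smul_tmul]
      rw [← TensorProduct.tmul_sum, b.sum_repr']
    | add x y hx hy => rw [map_add, map_add, hx, hy]
  let e : (Fin (Module.finrank ℂ H) → K) ≃L[ℂ] Ten K H :=
    ContinuousLinearEquiv.equivOfInverse Φ Ψ h1 h2
  exact (completeSpace_congr (e := e.toEquiv) e.isUniformEmbedding).mp inferInstance

/-- The operator `x ⊗ y` on `K ⊗ H`. -/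
def tens (x : Op K) (y : Op H) : Op (Ten K H) := mapL x y

@[simp] theorem tens_tmul (x : Op K) (y : Op H) (k : K) (h : H) :
    tens x y (k ⊗ₜ[ℂ] h) = x k ⊗ₜ[ℂ] y h := rfl

/-- `y ↦ x ⊗ y` as a linear map. -/
def tensRight (x : Op K) : Op H →ₗ[ℂ] Op (Ten K H) where
  toFun := tens x
  map_add' := mapL_add_right x
  map_smul' r y := mapL_smul_right r x y

/-- `x ↦ x ⊗ y` as a linear map. -/
def tensLeft (y : Op H) : Op K →ₗ[ℂ] Op (Ten K H) where
  toFun x := tens x y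
  map_add' x x' := mapL_add_left x x' y
  map_smul' r x := mapL_smul_left r x y

/-- The flip `Σ` of `H ⊗ H`. -/
def flip (H : Type v) [NormedAddCommGroup H] [InnerProductSpace ℂ H] :
    Op (Ten H H) :=
  (commIsometry ℂ H H).toContinuousLinearEquiv.toContinuousLinearMap

/-- Rebracketing: an operator on `K ⊗ (H ⊗ H)` seen on `(K ⊗ H) ⊗ H`. -/
def rebracket (T : Op (Ten K (Ten H H))) :
    Op (Ten (Ten K H) H) :=
  (assocIsometry ℂ K H H).symm.toContinuousLinearEquiv.toContinuousLinearMap ∘L T ∘L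
    (assocIsometry ℂ K H H).toContinuousLinearEquiv.toContinuousLinearMap

/-- `T₂₃ = 1 ⊗ T` on `(K ⊗ H) ⊗ H`. -/
def leg23 (K : Type u) [NormedAddCommGroup K] [InnerProductSpace ℂ K]
    (T : Op (Ten H H)) : Op (Ten (Ten K H) H) :=
  rebracket (tens (1 : Op K) T)

/-- `T₁₂ = T ⊗ 1` on `(K ⊗ H) ⊗ H`. -/
def leg12 (T : Op (Ten K H)) : Op (Ten (Ten K H) H) :=
  tens T (1 : Op H)

/-- `T₁₃ = Σ₂₃ T₁₂ Σ₂₃` on `(K ⊗ H) ⊗ H`. -/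
def leg13 (T : Op (Ten K H)) : Op (Ten (Ten K H) H) :=
  leg23 K (flip H) * leg12 T * leg23 K (flip H)

end Hilbert

/-! ### Slice maps and maps acting on one leg

Below, `H` is finite-dimensional, `(e_i)` is the orthonormal basis `stdOrthonormalBasis ℂ H`, and an
operator `X` on `K ⊗ H` is written `X = ∑ X_{ij} ⊗ |e_i⟩⟨e_j|` with entries `X_{ij}` acting on `K`.
The lemmas on elementary tensors show that the maps defined here do not depend on the basis. -/

section Slices

variable {K : Type u} [NormedAddCommGroup K] [InnerProductSpace ℂ K]
variable {K' : Type w} [NormedAddCommGroup K'] [InnerProductSpace ℂ K']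
variable {H : Type v} [NormedAddCommGroup H] [InnerProductSpace ℂ H] [FiniteDimensional ℂ H]

/-- The entry `X_{ij}` of `X`. -/
def entry (i j : Fin (Module.finrank ℂ H)) (X : Op (Ten K H)) : Op K :=
  bra K (stdOrthonormalBasis ℂ H i) ∘L X ∘L ket K (stdOrthonormalBasis ℂ H j)

/-- The matrix unit `|e_i⟩⟨e_j|` of `L(H)`. -/
def ketbra (i j : Fin (Module.finrank ℂ H)) : Op H :=
  InnerProductSpace.rankOne ℂ (stdOrthonormalBasis ℂ H i) (stdOrthonormalBasis ℂ H j)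

/-- The slice `(i ⊗ ω)(X)` by a linear form `ω` on `L(H)`. -/
def sliceRight (ω : Module.Dual ℂ (Op H)) (X : Op (Ten K H)) : Op K :=
  ∑ i, ∑ j, ω (ketbra i j) • entry i j X

/-- The slice `(ω ⊗ i)(X)` by a linear form `ω` on `L(H)`. -/
def sliceLeft (ω : Module.Dual ℂ (Op H)) (X : Op (Ten H H)) : Op H :=
  sliceRight ω (flip H * X * flip H)

/-- `(i ⊗ F)(X)` for a linear map `F` from `L(H)` to `L(K')`. -/
def idTensor (F : Op H → Op K') (X : Op (Ten K H)) :
    Op (Ten K K') :=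
  ∑ i, ∑ j, tens (entry i j X) (F (ketbra i j))

/-- `(δ ⊗ i)(X)` for a linear map `δ : A → L(K')` on a subspace `A` of `L(K)` and `X ∈ A ⊗ L(H)`
(then all the entries of `X` belong to `A`; outside of `A` the map `δ` is extended by `0`). -/
def tensorId {p : Op K → Prop} (δ : {x // p x} → Op K') (X : Op (Ten K H)) :
    Op (Ten K' H) :=
  ∑ i, ∑ j, tens (Function.extend Subtype.val δ 0 (entry i j X)) (ketbra i j)

theorem entry_tens (i j : Fin (Module.finrank ℂ H)) (x : Op K) (y : Op H) :
    entry i j (tens x y) =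
      ⟪stdOrthonormalBasis ℂ H i, y (stdOrthonormalBasis ℂ H j)⟫_ℂ • x := by
  ext k
  simp [entry]

theorem sum_ketbra (y : Op H) :
    ∑ i, ∑ j, ⟪stdOrthonormalBasis ℂ H i, y (stdOrthonormalBasis ℂ H j)⟫_ℂ • ketbra i j = y := by
  ext h
  rw [Finset.sum_comm]
  simp only [sum_apply, smul_apply, ketbra,
    InnerProductSpace.rankOne_apply]
  conv_rhs => rw [← (stdOrthonormalBasis ℂ H).sum_repr' h, map_sum]
  refine Finset.sum_congr rfl fun j _ => ?_
  rw [map_smul]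
  conv_rhs => rw [← (stdOrthonormalBasis ℂ H).sum_repr' (y (stdOrthonormalBasis ℂ H j))]
  rw [Finset.smul_sum]
  exact Finset.sum_congr rfl fun i _ => smul_comm _ _ _

theorem sliceRight_tens (ω : Module.Dual ℂ (Op H)) (x : Op K) (y : Op H) :
    sliceRight ω (tens x y) = ω y • x := by
  conv_rhs => rw [← sum_ketbra y]
  simp only [sliceRight, entry_tens, map_sum, map_smul, Finset.sum_smul, smul_smul, smul_eq_mul,
    mul_comm]

theorem idTensor_tens (F : Op H →ₗ[ℂ] Op K') (x : Op K) (y : Op H) :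
    idTensor F (tens x y) = tens x (F y) := by
  change _ = tensRight x (F y)
  conv_rhs => rw [← sum_ketbra y]
  simp only [idTensor, entry_tens, map_sum, map_smul]
  exact Finset.sum_congr rfl fun i _ => Finset.sum_congr rfl fun j _ =>
    (tensLeft (F (ketbra i j))).map_smul _ x

theorem tensorId_tens {A : Submodule ℂ (Op K)} (δ : A →ₗ[ℂ] Op K') (x : A) (y : Op H) :
    tensorId (fun a : A => δ a) (tens (x : Op K) y) = tens (δ x) y := by
  change _ = tensRight (δ x) y
  conv_rhs => rw [← sum_ketbra y]
  simp only [tensorId, entry_tens, map_sum, map_smul]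
  refine Finset.sum_congr rfl fun i _ => Finset.sum_congr rfl fun j _ => ?_
  have h : ∀ c : ℂ, Function.extend Subtype.val (fun a : A => δ a) 0 (c • (x : Op K))
      = c • δ x := fun c => by
    rw [← map_smul]
    exact Subtype.val_injective.extend_apply (fun a : A => δ a) 0 (c • x)
  exact (congrArg (fun z => tens z (ketbra i j)) (h _)).trans
    ((tensLeft (ketbra i j)).map_smul _ _)

end Slices

/-! ### Von Neumann algebras -/

section VonNeumann

variable {K : Type u} [NormedAddCommGroup K] [InnerProductSpace ℂ K]
variable {H : Type v} [NormedAddCommGroup H] [InnerProductSpace ℂ H]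
variable {K' : Type w} [NormedAddCommGroup K'] [InnerProductSpace ℂ K']

/-- The `σ`-weak topology of `L(K)`: the coarsest topology for which every functional
`x ↦ ∑ₙ ⟪ξₙ, x ηₙ⟫`, with square-summable sequences `ξ` and `η`, is continuous. -/
@[reducible] def sigmaWeak (K : Type u) [NormedAddCommGroup K] [InnerProductSpace ℂ K] :
    TopologicalSpace (Op K) :=
  TopologicalSpace.induced
    (fun x (p : lp (fun _ : ℕ => K) 2 × lp (fun _ : ℕ => K) 2) => ∑' n, ⟪p.1 n, x (p.2 n)⟫_ℂ)
    Pi.topologicalSpace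

/-- A (possibly degenerate) von Neumann algebra acting on `K`: a `σ`-weakly closed `*`-subalgebra
of `L(K)`. It has a unit element, a projection that may differ from the identity of `K`. -/
def IsVonNeumann [CompleteSpace K] (A : NonUnitalStarSubalgebra ℂ (Op K)) : Prop :=
  IsClosed[sigmaWeak K] (A : Set (Op K))

/-- The von Neumann algebra generated by a set of operators: the smallest `σ`-weakly closed
`*`-subalgebra that contains it. -/
def vnGen [CompleteSpace K] (X : Set (Op K)) : NonUnitalStarSubalgebra ℂ (Op K) :=
  sInf {M | IsVonNeumann M ∧ X ⊆ M}

/-- A map from `A` to `L(K')` is normal if it is `σ`-weakly continuous. -/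
def IsNormalMap [CompleteSpace K] {A : NonUnitalStarSubalgebra ℂ (Op K)}
    (π : A → Op K') : Prop :=
  Continuous[(sigmaWeak K).induced Subtype.val, sigmaWeak K'] π

/-- `A ⊗ S` for a von Neumann algebra `A` and a finite-dimensional `S`, as operators on `K ⊗ H`.
As `S` is finite-dimensional, the linear span of the elementary tensors is `σ`-weakly closed. -/
def vnTensor [CompleteSpace K] (A : NonUnitalStarSubalgebra ℂ (Op K))
    (S : Submodule ℂ (Op H)) : Submodule ℂ (Op (Ten K H)) :=
  Submodule.span ℂ {T | ∃ a ∈ A, ∃ s ∈ S, T = tens a s}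

theorem isVonNeumann_vnGen [CompleteSpace K] (X : Set (Op K)) : IsVonNeumann (vnGen X) := by
  let _ := sigmaWeak K
  unfold IsVonNeumann vnGen
  rw [NonUnitalStarAlgebra.coe_sInf]
  exact isClosed_biInter fun M hM => hM.1

end VonNeumann

/-! ### The base algebra -/

variable {G : Type w} [Fintype G]

/-- The finite-dimensional von Neumann algebra `N = ⨁_γ M_{n_γ}(ℂ)`. -/
abbrev Base (n : G → ℕ) : Type w := ∀ γ, Matrix (Fin (n γ)) (Fin (n γ)) ℂ

/-- The matrix unit `e^γ_{ij}` of `N`. -/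
def unit (n : G → ℕ) (γ : G) (i j : Fin (n γ)) : Base n :=
  letI := Classical.decEq G
  Pi.single γ (Matrix.single i j 1)

/-- `∑_γ ∑_{ij} (1 / n_γ) s(e^γ_{ij}) ⊗ r(e^γ_{ji})`, from the families `s(e^γ_{ij})` and
`r(e^γ_{ij})`. -/
def eProj {n : G → ℕ} {K : Type u} [NormedAddCommGroup K] [InnerProductSpace ℂ K]
    {H : Type v} [NormedAddCommGroup H] [InnerProductSpace ℂ H]
    (s : ∀ γ, Fin (n γ) → Fin (n γ) → Op K)
    (r : ∀ γ, Fin (n γ) → Fin (n γ) → Op H) : Op (Ten K H) :=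
  ∑ γ, ∑ i, ∑ j, ((n γ : ℂ)⁻¹) • tens (s γ i j) (r γ j i)

/-! ### Concrete quantum groupoids and their right actions -/

section Actions

variable {H : Type v} [NormedAddCommGroup H] [InnerProductSpace ℂ H]
  [FiniteDimensional ℂ H] [CompleteSpace H]

/-- The data of a quantum groupoid `(S, Γ, κ)` realized on `H` that enter the definition of an
action: the space `S`, the target Cartan subalgebra `S_t` with matrix units (those of `N` or of its
opposite), the coproduct and the antipode. -/
structure QGroupoid (n : G → ℕ) (H : Type v) [NormedAddCommGroup H] [InnerProductSpace ℂ H]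
    [CompleteSpace H] where
  /-- `S` -/
  alg : Submodule ℂ (Op H)
  /-- `S_t` -/
  tgt : StarSubalgebra ℂ (Op H)
  /-- matrix units of `S_t` -/
  tgtUnit : ∀ γ, Fin (n γ) → Fin (n γ) → tgt
  /-- `Γ` -/
  comul : Op H → (Op (Ten H H))
  /-- `κ` -/
  antipode : Op H → Op H

variable {n : G → ℕ} {K : Type u} [NormedAddCommGroup K] [InnerProductSpace ℂ K] [CompleteSpace K]

/-- The projection `e_{b,i}`, where `i` is the inclusion of `S_t`. -/
def eAct (D : QGroupoid n H) {A : NonUnitalStarSubalgebra ℂ (Op K)}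
    (b : (D.tgt)ᵐᵒᵖ →⋆ₙₐ[ℂ] A) : Op (Ten K H) :=
  eProj (n := n) (fun γ i j => (b (op (D.tgtUnit γ i j)) : Op K))
    (fun γ i j => (D.tgtUnit γ i j : Op H))

/-- `δ` is a right action of `(S, Γ, κ)` on `(A, b)`, where `b` is an antirepresentation of `S_t`
in the von Neumann algebra `A`. -/
structure IsRightAction (D : QGroupoid n H) (A : NonUnitalStarSubalgebra ℂ (Op K))
    (b : (D.tgt)ᵐᵒᵖ →⋆ₙₐ[ℂ] A) (δ : A →⋆ₙₐ[ℂ] (Op (Ten K H))) : Prop where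
  vonNeumann : IsVonNeumann A
  /-- `b` is unital: `b(1)` is the unit element of `A`. -/
  b_unital : ∀ a : A, b 1 * a = a ∧ a * b 1 = a
  b_faithful : Function.Injective b
  /-- `δ` takes its values in `A ⊗ S`. -/
  mem_tensor : ∀ a, δ a ∈ vnTensor A D.alg
  injective : Function.Injective δ
  normal : IsNormalMap δ
  /-- `(δ ⊗ i)δ = (i ⊗ Γ)δ` -/
  coassoc : ∀ a, tensorId (fun a => δ a) (δ a) = rebracket (idTensor D.comul (δ a))
  /-- `δ(b(x)) = e_{b,i} (1 ⊗ κ(x))` -/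
  map_b : ∀ x : D.tgt, δ (b (op x)) = eAct D b * tens 1 (D.antipode x)

/-- The von Neumann algebra generated by `δ(A)` and `e_{b,i} (1 ⊗ R)`. -/
def crossed (D : QGroupoid n H) {A : NonUnitalStarSubalgebra ℂ (Op K)}
    (b : (D.tgt)ᵐᵒᵖ →⋆ₙₐ[ℂ] A) (δ : A →⋆ₙₐ[ℂ] (Op (Ten K H)))
    (R : Set (Op H)) :
    NonUnitalStarSubalgebra ℂ (Op (Ten K H)) :=
  vnGen (Set.range δ ∪ {T | ∃ r ∈ R, T = eAct D b * tens 1 r})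

/-- `φ` restricts to a normalized Haar measure of `(S, Γ, κ)`: a faithful positive form with
`φ ∘ κ = φ`, `(i ⊗ φ)(Γ(1)) = 1` and
`(i ⊗ φ)((1 ⊗ y) Γ(x)) = κ((i ⊗ φ)(Γ(y) (1 ⊗ x)))`. -/
structure IsHaar (D : QGroupoid n H) (φ : Module.Dual ℂ (Op H)) : Prop where
  faithful_pos : ∀ x ∈ D.alg, x ≠ 0 → 0 < φ (star x * x)
  map_antipode : ∀ x ∈ D.alg, φ (D.antipode x) = φ x
  normalized : sliceRight φ (D.comul 1) = 1
  invariant : ∀ x ∈ D.alg, ∀ y ∈ D.alg,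
    sliceRight φ (tens 1 y * D.comul x) = D.antipode (sliceRight φ (D.comul y * tens 1 x))

end Actions

/-! ### Multiplicative partial isometries -/

section Mpi

/-- A multiplicative partial isometry with base `(N, α, β, β̂)` on `H`. The antirepresentations `β`
and `β̂` of `N` are given as representations of the opposite algebra. -/
structure Mpi (n : G → ℕ) (H : Type v) [NormedAddCommGroup H] [InnerProductSpace ℂ H]
    [FiniteDimensional ℂ H] [CompleteSpace H] where
  α : Base n →⋆ₐ[ℂ] Op H
  β : (Base n)ᵐᵒᵖ →⋆ₐ[ℂ] Op H
  βh : (Base n)ᵐᵒᵖ →⋆ₐ[ℂ] Op H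
  α_injective : Function.Injective α
  β_injective : Function.Injective β
  βh_injective : Function.Injective βh
  commute_α_β : ∀ x y, Commute (α x) (β y)
  commute_α_βh : ∀ x y, Commute (α x) (βh y)
  commute_β_βh : ∀ x y, Commute (β x) (βh y)
  trace_α_β : ∀ x, LinearMap.trace ℂ H (α x).toLinearMap = LinearMap.trace ℂ H (β (op x)).toLinearMap
  trace_α_βh : ∀ x,
    LinearMap.trace ℂ H (α x).toLinearMap = LinearMap.trace ℂ H (βh (op x)).toLinearMap
  /-- the operator `I` -/
  I : Op (Ten H H)
  /-- the initial support is `e_{β̂,α}` -/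
  initial : star I * I =
    eProj (n := n) (fun γ i j => βh (op (unit n γ i j))) (fun γ i j => α (unit n γ i j))
  /-- the final support is `e_{α,β}` -/
  final : I * star I =
    eProj (n := n) (fun γ i j => α (unit n γ i j)) (fun γ i j => β (op (unit n γ i j)))
  commute_I : ∀ x y, Commute I (tens (β x) (βh y))
  intertwine : ∀ x y, I * tens (α x) (β y) = tens (βh y) (α x) * I
  pentagon : leg12 I * leg13 I * leg23 H I = leg23 H I * leg12 I

namespace Mpi

variable {n : G → ℕ} {H : Type v} [NormedAddCommGroup H] [InnerProductSpace ℂ H]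
  [FiniteDimensional ℂ H] [CompleteSpace H] (V : Mpi n H)

/-- `S`, the set of all `(ω ⊗ i)(I)`. -/
def S : Submodule ℂ (Op H) :=
  Submodule.span ℂ (Set.range fun ω : Module.Dual ℂ (Op H) => sliceLeft ω V.I)

/-- `Ŝ`, the set of all `(i ⊗ ω)(I)`. -/
def Sh : Submodule ℂ (Op H) :=
  Submodule.span ℂ (Set.range fun ω : Module.Dual ℂ (Op H) => sliceRight ω V.I)

/-- `I` is regular: `S` and `Ŝ` are von Neumann subalgebras of `L(H)`. -/
def IsRegular : Prop :=
  (∃ M : VonNeumannAlgebra H, (M : Set (Op H)) = V.S) ∧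
    ∃ M : VonNeumannAlgebra H, (M : Set (Op H)) = V.Sh

open Classical in
/-- The antipode of `S`, `κ((ω ⊗ i)(I)) = (ω ⊗ i)(I*)` (and `0` outside of `S`). -/
def antipode (x : Op H) : Op H :=
  if h : ∃ ω : Module.Dual ℂ (Op H), sliceLeft ω V.I = x
  then sliceLeft h.choose (star V.I) else 0

open Classical in
/-- The antipode of `Ŝ`, `κ̂((i ⊗ ω)(I)) = (i ⊗ ω)(I*)` (and `0` outside of `Ŝ`). -/
def antipodeHat (x : Op H) : Op H :=
  if h : ∃ ω : Module.Dual ℂ (Op H), sliceRight ω V.I = x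
  then sliceRight h.choose (star V.I) else 0

/-- The quantum groupoid `(S, Γ, κ)` with `Γ(s) = I (s ⊗ 1) I*` and `S_t = β(N)`. -/
def qg : QGroupoid n H where
  alg := V.S
  tgt := V.β.range
  tgtUnit γ i j := ⟨V.β (op (unit n γ j i)), _, rfl⟩
  comul s := V.I * tens s 1 * star V.I
  antipode := V.antipode

/-- The dual quantum groupoid `(Ŝ, Γ̂, κ̂)` with `Γ̂(ŝ) = I* (1 ⊗ ŝ) I` and `Ŝ_t = α(N)`. -/
def qgHat : QGroupoid n H where
  alg := V.Sh
  tgt := V.α.range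
  tgtUnit γ i j := ⟨V.α (unit n γ i j), _, rfl⟩
  comul s := star V.I * tens 1 s * V.I
  antipode := V.antipodeHat

end Mpi

/-! ### Tomita theory and irreducible forms -/

variable {H : Type v} [NormedAddCommGroup H] [InnerProductSpace ℂ H]
  [FiniteDimensional ℂ H] [CompleteSpace H]

/-- The vector functional `ω_e(x) = ⟪e, x e⟫`. -/
def vecForm (e : H) : Module.Dual ℂ (Op H) where
  toFun x := ⟪e, x e⟫_ℂ
  map_add' x y := by simp
  map_smul' c x := by simp

/-- `e` is cyclic and separating for `M`. -/
def IsCyclicSeparating (M : Submodule ℂ (Op H)) (e : H) : Prop :=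
  (∀ η : H, ∃ x ∈ M, x e = η) ∧ ∀ x ∈ M, x e = 0 → x = 0

/-- `J` is the modular conjugation of `(M, e)`: the antiunitary part of the polar decomposition
`J Δ^{1/2}` of the antilinear operator `x e ↦ x* e`, `x ∈ M`. -/
def IsModularConj (M : Submodule ℂ (Op H)) (e : H) (J : H ≃ₗᵢ⋆[ℂ] H) : Prop :=
  ∃ D : Op H, D.IsPositive ∧ ∀ x ∈ M, (star x) e = J (D (x e))

namespace Mpi

variable {n : G → ℕ} (V : Mpi n H)

/-- `I` is in irreducible form, with canonical vectors `e` and `ê` and modular conjugations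
`J` and `Ĵ`: the vector `e` is fixed, cyclic and separating for `S`, and implements the normalized
Haar measure of `S`; the vector `ê` is cofixed, cyclic and separating for `Ŝ`, and implements the
normalized Haar measure of `Ŝ`; the relative phase of the two vectors is normalized by the
requirement that `ê` belongs to the natural positive cone `{x J x e | x ∈ S}` of `(S, e)`. -/
structure IsIrreducible (e eh : H) (J Jh : H ≃ₗᵢ⋆[ℂ] H) : Prop where
  fixed : ∀ η : H, V.I (e ⊗ₜ[ℂ] η) = (V.I * star V.I) (e ⊗ₜ[ℂ] η)
  cofixed : ∀ η : H, V.I (η ⊗ₜ[ℂ] eh) = (V.I * star V.I) (η ⊗ₜ[ℂ] eh)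
  standard : IsCyclicSeparating V.S e
  standardHat : IsCyclicSeparating V.Sh eh
  haar : IsHaar V.qg (vecForm e)
  haarHat : IsHaar V.qgHat (vecForm eh)
  modular : IsModularConj V.S e J
  modularHat : IsModularConj V.Sh eh Jh
  cone : ∃ x ∈ V.S, eh = x (J (x e))

/-- `Ĩ = Σ (1 ⊗ U) I (1 ⊗ U) Σ` with `U = J Ĵ`. -/
def tilde (J Jh : H ≃ₗᵢ⋆[ℂ] H) : Op (Ten H H) :=
  let U : Op H := (Jh.trans J).toContinuousLinearEquiv.toContinuousLinearMap
  flip H * tens 1 U * V.I * tens 1 U * flip H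

end Mpi

end Mpi

end FiniteQG

end

noncomputable section

namespace FiniteQG

universe u v w

/-! ### Calculus of operators on tensor products -/

section TensorCalculus

variable {K : Type u} [NormedAddCommGroup K] [InnerProductSpace ℂ K]
variable {H : Type v} [NormedAddCommGroup H] [InnerProductSpace ℂ H]

/-! The proof works with coefficients. Slicing the pentagon equation by vector forms shows that the
coefficients of `I` form a matrix corepresentation: with I_{ab} = (i ⊗ ω_{ab})(I), one has
Γ̂(I_{ab}) = ∑_m I_{am} ⊗ I_{mb} (`comulHat_sl`), and the same holds for `Γ` on the other leg
(`comul_lsl`).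

Two properties of `Ĩ` produce the dual coaction: `Ĩ` commutes with S ⊗ 1 (`tilde_comm`), and Ĩ(y ⊗
1) = Γ̂(y)Ĩ for y in Ŝ, with ĨĨ* = I*I (`tilde_mul_tens`, `tilde_mul_star`). Since the second leg of
δ(a) lies in S, conjugation by Ĩ₂₃ sends δ(a)(1 ⊗ y) to (δ(a) ⊗ 1)(1 ⊗ Γ̂(y)) (`tilde_conj_delta`).
This formula gives the values in the tensor product, coassociativity and the value on the base.

The properties of `Ĩ` come from Tomita theory. As e is fixed and ê cofixed, `I` implements `Γ` on Se
and `I*` implements `Γ̂` on Ŝê. The two Tomita operators therefore exchange slices of `I`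
(`conj_sl`, `conj_lsl`). Hence Δ^{1/2} ⊗ Δ̂^{1/2} commutes with `I` and (J ⊗ Ĵ)I(J ⊗ Ĵ) = I*
(`commute_D_I`, `inner_I_J`), so that J preserves Ŝ and Ĵ preserves S. The cone condition gives Jê =
ê, whence J and Ĵ commute and U is a self-adjoint unitary. By J S J ⊆ S', the slices of `Ĩ` on its
second leg lie in S'.

The crossed product is exactly the linear span of the products δ(a)(1 ⊗ y). Slicing the action
identity (δ ⊗ i)δ(a) I₂₃ = I₂₃(δ(a) ⊗ 1) shows that this span is an algebra (`tens_mul_delta_mem`).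
It is σ-weakly closed because an Ŝ-linear map θ from L(H) to Ŝ characterizes it by an equation
between continuous maps (`exists_theta`, `mem_crossedSpan_iff`).

The double crossed product is reached by T ↦ I₂₃*(δ ⊗ i)(T)I₂₃ (`dualHom`). It sends δ(a)(1 ⊗ y) to
its image under the dual coaction when y is in Ŝ, and δ(1)(1 ⊗ r) to e(1 ⊗ r) when r is in S', with
e the projection of the dual coaction. Since Ŝ S' spans β(N)' (`span_mul_commutant`), the generators
correspond. A counit provides a σ-weakly continuous left inverse, so the range is closed and equals
the double crossed product. -/

theorem op_mul_apply {E : Type*} [NormedAddCommGroup E] [InnerProductSpace ℂ E] (x y : Op E)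
    (v : E) : (x * y) v = x (y v) := rfl

theorem op_smul_mul {E : Type*} [NormedAddCommGroup E] [InnerProductSpace ℂ E] (c : ℂ)
    (x y : Op E) : (c • x) * y = c • (x * y) := rfl

theorem op_mul_smul {E : Type*} [NormedAddCommGroup E] [InnerProductSpace ℂ E] (c : ℂ)
    (x y : Op E) : x * (c • y) = c • (x * y) := by
  ext v
  exact map_smul x c (y v)

theorem op_sum_smul {E : Type*} [NormedAddCommGroup E] [InnerProductSpace ℂ E] {ι : Type*}
    (s : Finset ι) (c : ι → ℂ) (x : Op E) : (∑ i ∈ s, c i) • x = ∑ i ∈ s, c i • x :=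
  Finset.sum_smul

theorem op_ext {X Y : Op (Ten K H)} (h : ∀ k l, X (k ⊗ₜ[ℂ] l) = Y (k ⊗ₜ[ℂ] l)) : X = Y := by
  ext t
  induction t using TensorProduct.induction_on with
  | zero => simp
  | tmul k l => exact h k l
  | add x y hx hy => rw [map_add, map_add, hx, hy]

theorem tens_mul (x x' : Op K) (y y' : Op H) :
    tens x y * tens x' y' = tens (x * x') (y * y') := op_ext fun _ _ => rfl

@[simp] theorem tens_one : tens (1 : Op K) (1 : Op H) = 1 := op_ext fun _ _ => rfl

theorem tens_add_left (x x' : Op K) (y : Op H) : tens (x + x') y = tens x y + tens x' y :=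
  (tensLeft y).map_add x x'

theorem tens_add_right (x : Op K) (y y' : Op H) : tens x (y + y') = tens x y + tens x y' :=
  (tensRight x).map_add y y'

theorem tens_smul_left (c : ℂ) (x : Op K) (y : Op H) : tens (c • x) y = c • tens x y :=
  (tensLeft y).map_smul c x

theorem tens_smul_right (c : ℂ) (x : Op K) (y : Op H) : tens x (c • y) = c • tens x y :=
  (tensRight x).map_smul c y

@[simp] theorem tens_zero_left (y : Op H) : tens (0 : Op K) y = 0 := (tensLeft y).map_zero

@[simp] theorem tens_zero_right (x : Op K) : tens x (0 : Op H) = 0 := (tensRight x).map_zero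

theorem tens_sum_left {ι : Type*} (s : Finset ι) (x : ι → Op K) (y : Op H) :
    tens (∑ i ∈ s, x i) y = ∑ i ∈ s, tens (x i) y := map_sum (tensLeft y) x s

theorem tens_sum_right {ι : Type*} (s : Finset ι) (x : Op K) (y : ι → Op H) :
    tens x (∑ i ∈ s, y i) = ∑ i ∈ s, tens x (y i) := map_sum (tensRight x) y s

theorem star_tens [CompleteSpace K] [CompleteSpace H] [CompleteSpace (Ten K H)]
    (x : Op K) (y : Op H) : star (tens x y) = tens (star x) (star y) :=
  adjoint_mapL x y

theorem op_ext_inner {X Y : Op (Ten K H)}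
    (h : ∀ k l k' l', ⟪k ⊗ₜ[ℂ] l, X (k' ⊗ₜ[ℂ] l')⟫_ℂ = ⟪k ⊗ₜ[ℂ] l, Y (k' ⊗ₜ[ℂ] l')⟫_ℂ) : X = Y :=
  op_ext fun k' l' => TensorProduct.ext_iff_inner_left.mpr fun k l => h k l k' l'

theorem inner_star_left {E : Type*} [NormedAddCommGroup E] [InnerProductSpace ℂ E] [CompleteSpace E]
    (X : Op E) (x y : E) : ⟪star X x, y⟫_ℂ = ⟪x, X y⟫_ℂ := adjoint_inner_left X y x

theorem inner_star_right {E : Type*} [NormedAddCommGroup E] [InnerProductSpace ℂ E]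
    [CompleteSpace E] (X : Op E) (x y : E) : ⟪x, star X y⟫_ℂ = ⟪X x, y⟫_ℂ :=
  adjoint_inner_right X x y

@[simp] theorem flip_tmul (k l : H) : flip H (k ⊗ₜ[ℂ] l) = l ⊗ₜ[ℂ] k := by
  simp [flip]

@[simp] theorem flip_mul_flip : flip H * flip H = 1 := op_ext fun _ _ => by simp

theorem flip_mul_tens (x y : Op H) : flip H * tens x y = tens y x * flip H :=
  op_ext fun _ _ => by simp

theorem flip_tens_flip (x y : Op H) : flip H * tens x y * flip H = tens y x := by
  rw [flip_mul_tens, mul_assoc, flip_mul_flip, mul_one]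

theorem star_flip [CompleteSpace (Ten H H)] : star (flip H) = flip H :=
  op_ext_inner fun k l k' l' => by
    rw [inner_star_right, flip_tmul, flip_tmul, inner_tmul, inner_tmul, mul_comm]

theorem flip_conj_mul (X Y : Op (Ten H H)) :
    flip H * (X * Y) * flip H = flip H * X * flip H * (flip H * Y * flip H) := by
  have : flip H * X * flip H * (flip H * Y * flip H) =
    flip H * X * (flip H * flip H) * Y * flip H := by simp only [mul_assoc]
  rw [this, flip_mul_flip, mul_one]; simp only [mul_assoc]

theorem star_flip_conj [CompleteSpace (Ten H H)] (X : Op (Ten H H)) :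
    star (flip H * X * flip H) = flip H * star X * flip H := by
  simp only [star_mul, star_flip, mul_assoc]

/-! #### Slices by vectors -/

/-- The slice `(i ⊗ ω_{ξ,η})(X)`, with `ω_{ξ,η}(y) = ⟪ξ, y η⟫`. -/
def sl (ξ η : H) : Op (Ten K H) →ₗ[ℂ] Op K where
  toFun X := bra K ξ ∘L X ∘L ket K η
  map_add' X Y := by ext; simp
  map_smul' c X := by ext; simp

theorem sl_apply (ξ η : H) (X : Op (Ten K H)) (k : K) :
    sl ξ η X k = bra K ξ (X (k ⊗ₜ[ℂ] η)) := rfl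

theorem inner_bra (ξ : H) (k : K) (t : Ten K H) : ⟪k, bra K ξ t⟫_ℂ = ⟪k ⊗ₜ[ℂ] ξ, t⟫_ℂ := by
  induction t using TensorProduct.induction_on with
  | zero => simp
  | tmul k' l => rw [bra_tmul, inner_smul_right, inner_tmul, mul_comm]
  | add x y hx hy => rw [map_add, inner_add_right, inner_add_right, hx, hy]

theorem inner_sl (ξ η : H) (X : Op (Ten K H)) (k k' : K) :
    ⟪k, sl ξ η X k'⟫_ℂ = ⟪k ⊗ₜ[ℂ] ξ, X (k' ⊗ₜ[ℂ] η)⟫_ℂ := by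
  rw [sl_apply, inner_bra]

theorem op_eq_of_inner {E : Type*} [NormedAddCommGroup E] [InnerProductSpace ℂ E]
    {X Y : Op E} (h : ∀ a b, ⟪a, X b⟫_ℂ = ⟪a, Y b⟫_ℂ) : X = Y := by
  ext b
  exact ext_inner_left ℂ fun a => h a b

theorem op_ext_sl {X Y : Op (Ten K H)} (h : ∀ ξ η, sl ξ η X = sl ξ η Y) : X = Y :=
  op_ext_inner fun k l k' l' => by rw [← inner_sl, ← inner_sl, h]

theorem sl_tens (ξ η : H) (x : Op K) (y : Op H) : sl ξ η (tens x y) = ⟪ξ, y η⟫_ℂ • x := by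
  ext k
  simp [sl_apply]

theorem star_sl [CompleteSpace K] [CompleteSpace (Ten K H)] (ξ η : H)
    (X : Op (Ten K H)) : star (sl ξ η X) = sl η ξ (star X) :=
  op_eq_of_inner fun a b => by
    rw [inner_star_right, inner_sl, inner_star_right, ← inner_conj_symm, inner_sl]
    exact inner_conj_symm (X (a ⊗ₜ[ℂ] η)) (b ⊗ₜ[ℂ] ξ)

theorem sum_ket_bra {ι : Type*} [Fintype ι] (f : OrthonormalBasis ι ℂ H) :
    ∑ i, ket K (f i) ∘L bra K (f i) = ContinuousLinearMap.id ℂ (Ten K H) := by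
  refine op_ext fun k l => ?_
  simp only [sum_apply, ContinuousLinearMap.comp_apply, bra_tmul, ket_apply, TensorProduct.smul_tmul]
  rw [← TensorProduct.tmul_sum, f.sum_repr']
  rfl

theorem sl_mul {ι : Type*} [Fintype ι] (f : OrthonormalBasis ι ℂ H) (ξ η : H)
    (X Y : Op (Ten K H)) : sl ξ η (X * Y) = ∑ m, sl ξ (f m) X * sl (f m) η Y := by
  ext k
  have h : Y (k ⊗ₜ[ℂ] η) = ∑ m, ket K (f m) (bra K (f m) (Y (k ⊗ₜ[ℂ] η))) := by
    conv_lhs => rw [← ContinuousLinearMap.id_apply (R₁ := ℂ) (Y (k ⊗ₜ[ℂ] η)), ← sum_ket_bra f]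
    simp only [sum_apply, ContinuousLinearMap.comp_apply]
  simp only [sl_apply, op_mul_apply, sum_apply]
  conv_lhs => rw [h, map_sum, map_sum]
  rfl

theorem sl_tens_mul_tens [CompleteSpace H] (ξ η : H) (a b : Op K) (c d : Op H)
    (X : Op (Ten K H)) :
    sl ξ η (tens a c * X * tens b d) = a * sl (star c ξ) (d η) X * b := by
  have h : ∀ t : Ten K H, bra K ξ (tens a c t) = a (bra K (star c ξ) t) := fun t => by
    induction t using TensorProduct.induction_on with
    | zero => simp
    | tmul k' l => simp [inner_star_left]
    | add x y hx hy => simp only [map_add, hx, hy]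
  ext k
  simp only [sl_apply, op_mul_apply, h, tens_tmul]

theorem sl_tens_left (ξ η : H) [CompleteSpace H] (a : Op K) (c : Op H) (X : Op (Ten K H)) :
    sl ξ η (tens a c * X) = a * sl (star c ξ) η X := by
  have := sl_tens_mul_tens ξ η a 1 c 1 X
  simpa using this

theorem sl_tens_right (ξ η : H) [CompleteSpace H] (b : Op K) (d : Op H) (X : Op (Ten K H)) :
    sl ξ η (X * tens b d) = sl ξ (d η) X * b := by
  have := sl_tens_mul_tens ξ η 1 b 1 d X
  simpa using this

/-- The slice `(ω_{ξ,η} ⊗ i)(X)`. -/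
def lsl (ξ η : H) : Op (Ten H H) →ₗ[ℂ] Op H where
  toFun X := sl ξ η (flip H * X * flip H)
  map_add' X Y := by rw [mul_add, add_mul, map_add]
  map_smul' c X := by rw [op_mul_smul, op_smul_mul, map_smul]; rfl

theorem lsl_def (ξ η : H) (X : Op (Ten H H)) : lsl ξ η X = sl ξ η (flip H * X * flip H) := rfl

theorem inner_lsl [CompleteSpace (Ten H H)] (ξ η : H) (X : Op (Ten H H)) (k k' : H) :
    ⟪k, lsl ξ η X k'⟫_ℂ = ⟪ξ ⊗ₜ[ℂ] k, X (η ⊗ₜ[ℂ] k')⟫_ℂ := by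
  rw [lsl_def, inner_sl, op_mul_apply, op_mul_apply, flip_tmul, ← inner_star_left, star_flip, flip_tmul]

theorem lsl_tens (ξ η : H) (x y : Op H) : lsl ξ η (tens x y) = ⟪ξ, x η⟫_ℂ • y := by
  rw [lsl_def, flip_tens_flip, sl_tens]

theorem star_lsl [CompleteSpace H] [CompleteSpace (Ten H H)] (ξ η : H)
    (X : Op (Ten H H)) : star (lsl ξ η X) = lsl η ξ (star X) := by
  rw [lsl_def, star_sl, star_flip_conj, lsl_def]

theorem lsl_tens_left (ξ η : H) [CompleteSpace H] (a : Op H) (c : Op H) (X : Op (Ten H H)) :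
    lsl ξ η (tens c a * X) = a * lsl (star c ξ) η X := by
  rw [lsl_def, flip_conj_mul, flip_tens_flip, sl_tens_left, lsl_def]

theorem lsl_tens_right (ξ η : H) [CompleteSpace H] (b : Op H) (d : Op H) (X : Op (Ten H H)) :
    lsl ξ η (X * tens d b) = lsl ξ (d η) X * b := by
  rw [lsl_def, flip_conj_mul, flip_tens_flip, sl_tens_right, lsl_def]

variable [FiniteDimensional ℂ H]

local notation "𝓫" => stdOrthonormalBasis ℂ H

theorem entry_eq_sl (i j : Fin (Module.finrank ℂ H)) (X : Op (Ten K H)) :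
    entry i j X = sl (𝓫 i) (𝓫 j) X := rfl

theorem inner_ketbra (i j : Fin (Module.finrank ℂ H)) (ξ η : H) :
    ⟪ξ, ketbra i j η⟫_ℂ = ⟪𝓫 j, η⟫_ℂ * ⟪ξ, 𝓫 i⟫_ℂ := by
  simp [ketbra]

theorem sum_entry_ketbra (X : Op (Ten K H)) :
    ∑ i, ∑ j, tens (entry i j X) (ketbra i j) = X := by
  refine op_ext fun k l => ?_
  have hl : X (k ⊗ₜ[ℂ] l) = ∑ j, ⟪𝓫 j, l⟫_ℂ • X (k ⊗ₜ[ℂ] 𝓫 j) := by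
    conv_lhs => rw [← (𝓫).sum_repr' l, TensorProduct.tmul_sum, map_sum]
    exact Finset.sum_congr rfl fun j _ => by rw [TensorProduct.tmul_smul, map_smul]
  rw [hl, Finset.sum_comm]
  simp only [sum_apply, tens_tmul]
  refine Finset.sum_congr rfl fun j _ => ?_
  have h2 := congrArg (fun T : Op (Ten K H) => T (X (k ⊗ₜ[ℂ] 𝓫 j))) (sum_ket_bra (K := K) 𝓫)
  simp only [sum_apply, ContinuousLinearMap.comp_apply, ContinuousLinearMap.id_apply] at h2
  rw [← h2, Finset.smul_sum]
  refine Finset.sum_congr rfl fun i _ => ?_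
  rw [entry_eq_sl, sl_apply, ket_apply]
  simp [ketbra]

/-- Every operator on `K ⊗ H` is a sum of elementary tensors. -/
theorem tens_induction {p : Op (Ten K H) → Prop} (X : Op (Ten K H))
    (tens : ∀ a y, p (tens a y)) (add : ∀ X Y, p X → p Y → p (X + Y)) : p X := by
  have h0 : p 0 := by simpa using tens 0 0
  rw [← sum_entry_ketbra X]
  refine Finset.sum_induction _ p add h0 fun i _ => ?_
  exact Finset.sum_induction _ p add h0 fun j _ => tens _ _

theorem entry_ext {X Y : Op (Ten K H)} (h : ∀ i j, entry i j X = entry i j Y) : X = Y := by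
  rw [← sum_entry_ketbra X, ← sum_entry_ketbra Y]
  simp only [h]

theorem sl_eq_sum_entry (ξ η : H) (X : Op (Ten K H)) :
    sl ξ η X = ∑ i, ∑ j, (⟪ξ, 𝓫 i⟫_ℂ * ⟪𝓫 j, η⟫_ℂ) • entry i j X := by
  conv_lhs => rw [← sum_entry_ketbra X]
  simp only [map_sum, sl_tens, inner_ketbra]
  exact Finset.sum_congr rfl fun i _ => Finset.sum_congr rfl fun j _ => by rw [mul_comm]

theorem entry_mul (i j : Fin (Module.finrank ℂ H)) (X Y : Op (Ten K H)) :
    entry i j (X * Y) = ∑ m, entry i m X * entry m j Y :=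
  sl_mul 𝓫 _ _ X Y

theorem star_entry [CompleteSpace K] [CompleteSpace H] (i j : Fin (Module.finrank ℂ H))
    (X : Op (Ten K H)) : star (entry i j X) = entry j i (star X) := star_sl _ _ _

/-- The slice `(i ⊗ ω)(X)`, as a linear map of `X`. -/
def sliceRightₗ (ω : Module.Dual ℂ (Op H)) : Op (Ten K H) →ₗ[ℂ] Op K :=
  ∑ i, ∑ j, ω (ketbra i j) • sl (𝓫 i) (𝓫 j)

theorem sliceRightₗ_apply (ω : Module.Dual ℂ (Op H)) (X : Op (Ten K H)) :
    sliceRightₗ ω X = sliceRight ω X := by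
  simp [sliceRightₗ, sliceRight, entry_eq_sl, LinearMap.sum_apply]

/-- The linear form `ω_{ξ,η}`. -/
def vf (ξ η : H) : Module.Dual ℂ (Op H) where
  toFun x := ⟪ξ, x η⟫_ℂ
  map_add' x y := by simp
  map_smul' c x := by simp

theorem sliceRight_vf (ξ η : H) (X : Op (Ten K H)) : sliceRight (vf ξ η) X = sl ξ η X := by
  rw [sl_eq_sum_entry, sliceRight]
  refine Finset.sum_congr rfl fun i _ => Finset.sum_congr rfl fun j _ => ?_
  simp [vf, inner_ketbra, mul_comm]

theorem entry_tens_ketbra (i j k l : Fin (Module.finrank ℂ H)) (x : Op K) :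
    entry i j (tens x (ketbra k l)) = if i = k ∧ j = l then x else 0 := by
  rw [entry_tens, inner_ketbra, orthonormal_iff_ite.mp (𝓫).orthonormal,
    orthonormal_iff_ite.mp (𝓫).orthonormal]
  by_cases h1 : i = k <;> by_cases h2 : j = l
  · subst h1 h2; simp
  · simp [h2, Ne.symm h2]
  · simp [h1]
  · simp [h1]

theorem entry_sum_tens (i j : Fin (Module.finrank ℂ H))
    (x : Fin (Module.finrank ℂ H) → Fin (Module.finrank ℂ H) → Op K) :
    entry i j (∑ k, ∑ l, tens (x k l) (ketbra k l : Op H)) = x i j := by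
  have : entry i j (∑ k, ∑ l, tens (x k l) (ketbra k l : Op H)) =
      ∑ k, ∑ l, entry i j (tens (x k l) (ketbra k l : Op H)) := by
    simp only [entry_eq_sl, map_sum]
  rw [this]
  simp only [entry_tens_ketbra]
  rw [Finset.sum_eq_single i, Finset.sum_eq_single j]
  · simp
  · intro b _ hb; simp [hb.symm]
  · simp
  · intro b _ hb; simp [hb.symm]
  · simp

end TensorCalculus

/-! #### Legs -/

section Legs

variable {K : Type u} [NormedAddCommGroup K] [InnerProductSpace ℂ K]
variable {H : Type v} [NormedAddCommGroup H] [InnerProductSpace ℂ H]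

@[simp] theorem rebracket_tmul (T : Op (Ten K (Ten H H))) (k : K) (l m : H) :
    rebracket T ((k ⊗ₜ[ℂ] l) ⊗ₜ[ℂ] m) = (assocIsometry ℂ K H H).symm (T (k ⊗ₜ[ℂ] (l ⊗ₜ[ℂ] m))) := rfl

theorem rebracket_tens (x : Op K) (y z : Op H) :
    rebracket (tens x (tens y z)) = tens (tens x y) z := by
  refine op_ext fun t m => ?_
  induction t using TensorProduct.induction_on with
  | zero => simp
  | tmul k l => simp
  | add a b ha hb => rw [add_tmul, map_add, map_add, ha, hb]

theorem rebracket_mul (X Y : Op (Ten K (Ten H H))) :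
    rebracket (X * Y) = rebracket X * rebracket Y := by
  ext t
  simp only [rebracket, op_mul_apply, ContinuousLinearMap.comp_apply]
  congr 2
  exact ((assocIsometry ℂ K H H).apply_symm_apply _).symm

/-- `rebracket` as a linear map. -/
def rebracketₗ : Op (Ten K (Ten H H)) →ₗ[ℂ] Op (Ten (Ten K H) H) where
  toFun := rebracket
  map_add' X Y := by
    ext t
    exact map_add (assocIsometry ℂ K H H).symm _ _
  map_smul' c X := by
    ext t
    exact map_smul (assocIsometry ℂ K H H).symm c _

/-- `leg23 K` as a linear map. -/
def leg23ₗ (K : Type u) [NormedAddCommGroup K] [InnerProductSpace ℂ K] :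
    Op (Ten H H) →ₗ[ℂ] Op (Ten (Ten K H) H) := rebracketₗ ∘ₗ tensRight 1

theorem leg23_mul (X Y : Op (Ten H H)) : leg23 K (X * Y) = leg23 K X * leg23 K Y := by
  rw [leg23, leg23, leg23, ← rebracket_mul, tens_mul, one_mul]

@[simp] theorem leg23_one : leg23 K (1 : Op (Ten H H)) = 1 := by
  rw [leg23, tens_one]
  ext t
  exact (assocIsometry ℂ K H H).symm_apply_apply t

theorem leg23_add (X Y : Op (Ten H H)) : leg23 K (X + Y) = leg23 K X + leg23 K Y :=
  map_add (leg23ₗ K) X Y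

theorem leg23_sum {ι : Type*} (s : Finset ι) (X : ι → Op (Ten H H)) :
    leg23 K (∑ i ∈ s, X i) = ∑ i ∈ s, leg23 K (X i) := map_sum (leg23ₗ K) X s

theorem leg23_smul (c : ℂ) (X : Op (Ten H H)) : leg23 K (c • X) = c • leg23 K X :=
  map_smul (leg23ₗ K) c X

theorem leg23_tens (y z : Op H) : leg23 K (tens y z) = tens (tens 1 y) z := rebracket_tens 1 y z

theorem leg12_mul (X Y : Op (Ten K H)) : leg12 (X * Y) = leg12 X * leg12 Y := by
  rw [leg12, leg12, leg12, tens_mul, one_mul]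

theorem leg12_add (X Y : Op (Ten K H)) : leg12 (X + Y) = leg12 X + leg12 Y := tens_add_left _ _ _

theorem leg13_tens (x : Op K) (z : Op H) : leg13 (tens x z) = tens (tens x 1) z := by
  refine op_ext fun t m => ?_
  induction t using TensorProduct.induction_on with
  | zero => simp
  | tmul k l => simp [leg13, leg12, leg23]
  | add a b ha hb => rw [add_tmul, map_add, map_add, ha, hb]

theorem leg13_add (X Y : Op (Ten K H)) : leg13 (X + Y) = leg13 X + leg13 Y := by
  simp only [leg13, leg12_add, mul_add, add_mul]

variable [FiniteDimensional ℂ H]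

theorem star_leg23 [CompleteSpace K] [CompleteSpace H] (X : Op (Ten H H)) :
    star (leg23 K X) = leg23 K (star X) := by
  induction X using tens_induction with
  | tens a y => rw [leg23_tens, star_tens, star_tens, star_tens, leg23_tens, star_one]
  | add X Y hX hY => rw [leg23_add, star_add, star_add, leg23_add, hX, hY]

omit [FiniteDimensional ℂ H] in
theorem leg13_mul (X Y : Op (Ten K H)) : leg13 (X * Y) = leg13 X * leg13 Y := by
  have h : leg23 K (flip H) * leg23 K (flip H) = 1 := by rw [← leg23_mul, flip_mul_flip, leg23_one]
  have : leg13 X * leg13 Y = leg23 K (flip H) * leg12 X *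
    (leg23 K (flip H) * leg23 K (flip H)) * leg12 Y * leg23 K (flip H) := by
    simp only [leg13, mul_assoc]
  rw [this, h, leg13, leg12_mul, mul_one]; simp only [mul_assoc]

theorem sl_leg23 (ξ η : H) (X : Op (Ten H H)) : sl ξ η (leg23 K X) = tens 1 (sl ξ η X) := by
  induction X using tens_induction with
  | tens a y => rw [leg23_tens, sl_tens, sl_tens, tens_smul_right]
  | add X Y hX hY => rw [leg23_add, map_add, map_add, hX, hY, tens_add_right]

theorem sl_leg13 (ξ η : H) (X : Op (Ten K H)) : sl ξ η (leg13 X) = tens (sl ξ η X) 1 := by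
  induction X using tens_induction with
  | tens a y => rw [leg13_tens, sl_tens, sl_tens, tens_smul_left]
  | add X Y hX hY => rw [leg13_add, map_add, map_add, hX, hY, tens_add_left]

/-- The slice `(ω_{ξ,η} ⊗ i ⊗ i)(X)`, where the first leg of `X` acts on a Hilbert space `K`. -/
def sl3 (ξ η : K) : Op (Ten (Ten K H) H) →ₗ[ℂ] Op (Ten H H) where
  toFun X := mapL ((lidIsometry ℂ H).toContinuousLinearEquiv.toContinuousLinearMap ∘L
    mapL (innerSL ℂ ξ) (ContinuousLinearMap.id ℂ H)) (ContinuousLinearMap.id ℂ H) ∘L X ∘L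
      mapL (mkL ℂ K H η) (ContinuousLinearMap.id ℂ H)
  map_add' X Y := by ext; simp
  map_smul' c X := by ext; simp

omit [FiniteDimensional ℂ H] in
theorem sl3_tens (ξ η : K) (x : Op K) (y z : Op H) :
    sl3 ξ η (tens (tens x y) z) = ⟪ξ, x η⟫_ℂ • tens y z :=
  op_ext fun k l => by
    simp [sl3, TensorProduct.smul_tmul']

theorem sl3_leg23_mul (ξ η : K) (T : Op (Ten H H)) (X : Op (Ten (Ten K H) H)) :
    sl3 ξ η (leg23 K T * X) = T * sl3 ξ η X := by
  induction T using tens_induction with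
  | add T T' h h' => rw [leg23_add, add_mul, map_add, h, h', add_mul]
  | tens a b =>
    induction X using tens_induction with
    | add T T' h h' => rw [mul_add, map_add, h, h', map_add, mul_add]
    | tens X z =>
      induction X using tens_induction with
      | add T T' h h' => rw [tens_add_left, mul_add, map_add, h, h', map_add, mul_add]
      | tens x y => rw [leg23_tens, tens_mul, tens_mul, one_mul, sl3_tens, sl3_tens,
          op_mul_smul, tens_mul]

theorem sl3_mul_leg23 (ξ η : K) (T : Op (Ten H H)) (X : Op (Ten (Ten K H) H)) :
    sl3 ξ η (X * leg23 K T) = sl3 ξ η X * T := by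
  induction T using tens_induction with
  | add T T' h h' => rw [leg23_add, mul_add, map_add, h, h', mul_add]
  | tens a b =>
    induction X using tens_induction with
    | add T T' h h' => rw [add_mul, map_add, h, h', map_add, add_mul]
    | tens X z =>
      induction X using tens_induction with
      | add T T' h h' => rw [tens_add_left, add_mul, map_add, h, h', map_add, add_mul]
      | tens x y => rw [leg23_tens, tens_mul, tens_mul, mul_one, sl3_tens, sl3_tens,
          op_smul_mul, tens_mul]

theorem sl3_leg12 (ξ η : H) (X : Op (Ten H H)) :
    sl3 ξ η (leg12 X) = tens (lsl ξ η X) 1 := by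
  induction X using tens_induction with
  | tens a y => rw [leg12, sl3_tens, lsl_tens, tens_smul_left]
  | add X Y hX hY => rw [leg12_add, map_add, map_add, hX, hY, tens_add_left]

/-- Matrix multiplication on the first leg: the resolution of the identity by `f` is inserted
between `X` and `Y`. -/
theorem sl3_leg12_leg13 {ι : Type*} [Fintype ι] (f : OrthonormalBasis ι ℂ H) (ξ η : H)
    (X Y : Op (Ten H H)) :
    sl3 ξ η (leg12 X * leg13 Y) = ∑ m, tens (lsl ξ (f m) X) (lsl (f m) η Y) := by
  induction X using tens_induction with
  | add X X' h h' =>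
    simp only [leg12_add, add_mul, map_add, h, h', tens_add_left, Finset.sum_add_distrib]
  | tens a b =>
    induction Y using tens_induction with
    | add X X' h h' =>
      simp only [leg13_add, mul_add, map_add, h, h', tens_add_right, Finset.sum_add_distrib]
    | tens c d =>
      rw [leg13_tens, leg12, tens_mul, tens_mul, sl3_tens]
      simp only [lsl_tens, tens_smul_left, tens_smul_right, smul_smul, mul_one, one_mul]
      have : ⟪ξ, a (c η)⟫_ℂ = ∑ m, ⟪ξ, a (f m)⟫_ℂ * ⟪f m, c η⟫_ℂ := by
        conv_lhs => rw [← f.sum_repr' (c η), map_sum, inner_sum]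
        simp [inner_smul_right, mul_comm]
      rw [op_mul_apply, this, op_sum_smul]
      exact Finset.sum_congr rfl fun m _ => by rw [mul_comm]

end Legs

section Shortcuts

variable {K : Type u} [NormedAddCommGroup K] [InnerProductSpace ℂ K] [CompleteSpace K]

/-- A shortcut for instance search. -/
@[reducible] def subalgSemiring (A : NonUnitalStarSubalgebra ℂ (Op K)) :
    NonUnitalNonAssocSemiring A := inferInstance

/-- A shortcut for instance search. -/
@[reducible] def subalgAddCommMonoid (A : NonUnitalStarSubalgebra ℂ (Op K)) :
    AddCommMonoid A := inferInstance

/-- A shortcut for instance search. -/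
@[reducible] def subalgAction (A : NonUnitalStarSubalgebra ℂ (Op K)) :
    DistribMulAction ℂ A := inferInstance

/-- A shortcut for instance search. -/
@[reducible] def oppositeAction (B : StarSubalgebra ℂ (Op K)) :
    DistribMulAction ℂ (B)ᵐᵒᵖ := inferInstance

end Shortcuts

attribute [local instance] subalgSemiring subalgAddCommMonoid subalgAction oppositeAction

/-! ### The `σ`-weak topology -/

section SigmaWeak

variable {K : Type u} [NormedAddCommGroup K] [InnerProductSpace ℂ K]
variable {K' : Type w} [NormedAddCommGroup K'] [InnerProductSpace ℂ K']
variable {H : Type v} [NormedAddCommGroup H] [InnerProductSpace ℂ H]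

/-- The sequence `B ξₙ`. -/
def lpMap (B : K →L[ℂ] K') (ξ : lp (fun _ : ℕ => K) 2) : lp (fun _ : ℕ => K') 2 :=
  ⟨fun n => B (ξ n), by
    have h : Memℓp (fun n : ℕ => ‖B‖ * ‖ξ n‖) 2 := (lp.memℓp ξ).norm.const_mul ‖B‖
    exact h.mono fun n => B.le_opNorm _⟩

@[simp] theorem lpMap_apply (B : K →L[ℂ] K') (ξ : lp (fun _ : ℕ => K) 2) (n : ℕ) :
    lpMap B ξ n = B (ξ n) := rfl

theorem summable_sigmaWeak (x : Op K) (ξ η : lp (fun _ : ℕ => K) 2) :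
    Summable fun n => ⟪ξ n, x (η n)⟫_ℂ := lp.summable_inner ξ (lpMap x η)

theorem continuous_sw_iff {Z : Type*} [t : TopologicalSpace Z] {f : Z → Op K} :
    Continuous[t, sigmaWeak K] f ↔
      ∀ ξ η : lp (fun _ : ℕ => K) 2, Continuous fun z => ∑' n, ⟪ξ n, f z (η n)⟫_ℂ := by
  rw [continuous_induced_rng, continuous_pi_iff]
  exact ⟨fun h ξ η => h (ξ, η), fun h p => h p.1 p.2⟩

theorem continuous_sw_tsum (ξ η : lp (fun _ : ℕ => K) 2) :
    Continuous[sigmaWeak K, _] fun x : Op K => ∑' n, ⟪ξ n, x (η n)⟫_ℂ :=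
  (@continuous_sw_iff K _ _ (Op K) (sigmaWeak K) id).mp (@continuous_id _ (sigmaWeak K)) ξ η

theorem continuous_sw_comp [CompleteSpace K] [CompleteSpace K'] (B : K →L[ℂ] K') (C : K' →L[ℂ] K) :
    Continuous[sigmaWeak K, sigmaWeak K'] fun x : Op K => B ∘L x ∘L C := by
  refine (@continuous_sw_iff K' _ _ (Op K) (sigmaWeak K) _).mpr fun ξ η => ?_
  have := continuous_sw_tsum (lpMap (adjoint B) ξ) (lpMap C η)
  simp only [lpMap_apply, adjoint_inner_left] at this
  exact this

theorem continuous_sw_add {Z : Type*} [t : TopologicalSpace Z] {f g : Z → Op K}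
    (hf : Continuous[t, sigmaWeak K] f) (hg : Continuous[t, sigmaWeak K] g) :
    Continuous[t, sigmaWeak K] fun z => f z + g z := by
  rw [continuous_sw_iff] at hf hg ⊢
  intro ξ η
  refine ((hf ξ η).add (hg ξ η)).congr fun z => ?_
  refine ((summable_sigmaWeak (f z) ξ η).tsum_add (summable_sigmaWeak (g z) ξ η)).symm.trans ?_
  simp

theorem continuous_sw_zero {Z : Type*} [t : TopologicalSpace Z] :
    Continuous[t, sigmaWeak K] fun _ => (0 : Op K) := @continuous_const _ _ t (sigmaWeak K) 0

theorem continuous_sw_sum {Z ι : Type*} [t : TopologicalSpace Z] (s : Finset ι) {f : ι → Z → Op K}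
    (hf : ∀ i ∈ s, Continuous[t, sigmaWeak K] (f i)) :
    Continuous[t, sigmaWeak K] fun z => ∑ i ∈ s, f i z := by
  classical
  induction s using Finset.induction_on with
  | empty => simpa using continuous_sw_zero
  | insert a s ha ih =>
    simp only [Finset.sum_insert ha]
    exact continuous_sw_add (hf a (by simp)) (ih fun i hi => hf i (by simp [hi]))

theorem continuous_sw_smul (c : ℂ) : Continuous[sigmaWeak K, sigmaWeak K] fun x : Op K => c • x := by
  refine (@continuous_sw_iff K _ _ (Op K) (sigmaWeak K) _).mpr fun ξ η => ?_
  simp only [smul_apply, inner_smul_right, tsum_mul_left]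
  exact @Continuous.comp _ _ _ (sigmaWeak K) _ _ _ _ (continuous_const_mul c)
    (continuous_sw_tsum ξ η)

theorem continuous_sw_inner (ξ η : K) :
    Continuous[sigmaWeak K, _] fun x : Op K => ⟪ξ, x η⟫_ℂ := by
  -- A matrix coefficient is the functional attached to sequences concentrated at the index 0.
  let s : K → lp (fun _ : ℕ => K) 2 := fun k => lp.single 2 0 k
  have hs : ∀ (k : K) n, n ≠ 0 → s k n = 0 := fun k n hn => lp.single_apply_ne _ _ _ hn
  have hs0 : ∀ k : K, s k 0 = k := fun k => lp.single_apply_self _ _ _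
  have h := continuous_sw_tsum (s ξ) (s η)
  have h2 : (fun x : Op K => ⟪ξ, x η⟫_ℂ) = fun x => ∑' n, ⟪s ξ n, x (s η n)⟫_ℂ := by
    funext x
    rw [tsum_eq_single 0 fun n hn => by rw [hs ξ n hn, inner_zero_left], hs0, hs0]
  rwa [h2]

/-- Two operators agree iff all their matrix coefficients do, and each coefficient is σ-weakly
continuous. The equalizer is thus an intersection of closed sets. -/
theorem isClosed_sw_eq {Z : Type*} [t : TopologicalSpace Z] {f g : Z → Op K}
    (hf : Continuous[t, sigmaWeak K] f) (hg : Continuous[t, sigmaWeak K] g) :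
    IsClosed {z | f z = g z} := by
  have : {z | f z = g z} = ⋂ (ξ : K) (η : K), {z | ⟪ξ, f z η⟫_ℂ = ⟪ξ, g z η⟫_ℂ} := by
    ext z
    simp only [Set.mem_ofPred_eq, Set.mem_iInter]
    exact ⟨fun h ξ η => by rw [h], op_eq_of_inner⟩
  rw [this]
  refine isClosed_iInter fun ξ => isClosed_iInter fun η => isClosed_eq ?_ ?_
  · exact @Continuous.comp _ _ _ t (sigmaWeak K) _ _ _ (continuous_sw_inner ξ η) hf
  · exact @Continuous.comp _ _ _ t (sigmaWeak K) _ _ _ (continuous_sw_inner ξ η) hg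

theorem continuous_sw_mul [CompleteSpace K] (X Y : Op K) :
    Continuous[sigmaWeak K, sigmaWeak K] fun x : Op K => X * x * Y := continuous_sw_comp X Y

theorem continuous_sw_sl [CompleteSpace K] [CompleteSpace (Ten K H)] (ξ η : H) :
    Continuous[sigmaWeak (Ten K H), sigmaWeak K] fun x : Op (Ten K H) => sl ξ η x :=
  continuous_sw_comp _ _

theorem continuous_sw_tens [CompleteSpace K] [FiniteDimensional ℂ H] (y : Op H) :
    Continuous[sigmaWeak K, sigmaWeak (Ten K H)] fun x : Op K => tens x y := by
  let f := stdOrthonormalBasis ℂ H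
  -- As `H` is finite-dimensional, x ⊗ y is a finite sum of compressions of x, which are covered by
  -- `continuous_sw_comp`.
  have h : (fun x : Op K => tens x y) = fun x => ∑ i, ket K (y (f i)) ∘L x ∘L bra K (f i) := by
    funext x
    refine op_ext fun k l => ?_
    conv_lhs => rw [← f.sum_repr' l, TensorProduct.tmul_sum, map_sum]
    simp only [sum_apply, ContinuousLinearMap.comp_apply, bra_tmul, ket_apply, map_smul, tens_tmul,
      TensorProduct.tmul_smul]
  rw [h]
  exact @continuous_sw_sum _ _ _ _ _ (sigmaWeak K) _ _ fun i _ => continuous_sw_comp _ _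

theorem subset_vnGen [CompleteSpace K] (X : Set (Op K)) : X ⊆ vnGen X := by
  intro x hx
  rw [SetLike.mem_coe, vnGen, NonUnitalStarAlgebra.mem_sInf]
  exact fun M hM => hM.2 hx

theorem vnGen_le [CompleteSpace K] {X : Set (Op K)} {M : NonUnitalStarSubalgebra ℂ (Op K)}
    (hM : IsVonNeumann M) (h : X ⊆ M) : vnGen X ≤ M := sInf_le ⟨hM, h⟩

end SigmaWeak

/-! ### Amplifications -/

section Amplification

variable {K : Type u} [NormedAddCommGroup K] [InnerProductSpace ℂ K] [CompleteSpace K]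
variable {K' : Type w} [NormedAddCommGroup K'] [InnerProductSpace ℂ K'] [CompleteSpace K']
variable {H : Type v} [NormedAddCommGroup H] [InnerProductSpace ℂ H]
  [FiniteDimensional ℂ H] [CompleteSpace H]

/-- The von Neumann algebra `A ⊗ L(H)`. -/
def amp (A : NonUnitalStarSubalgebra ℂ (Op K)) (H : Type v) [NormedAddCommGroup H]
    [InnerProductSpace ℂ H] [FiniteDimensional ℂ H] [CompleteSpace H] :
    NonUnitalStarSubalgebra ℂ (Op (Ten K H)) where
  carrier := {T | ∀ i j, entry i j T ∈ A}
  add_mem' hx hy i j := by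
    rw [entry_eq_sl, map_add]; exact add_mem (hx i j) (hy i j)
  zero_mem' i j := by rw [entry_eq_sl, map_zero]; exact zero_mem A
  mul_mem' hx hy i j := by
    rw [entry_mul]; exact sum_mem fun m _ => mul_mem (hx i m) (hy m j)
  smul_mem' c x hx i j := by
    rw [entry_eq_sl, map_smul]; exact SMulMemClass.smul_mem c (hx i j)
  star_mem' hx i j := by rw [← star_entry]; exact star_mem (hx j i)

variable {A : NonUnitalStarSubalgebra ℂ (Op K)}

theorem mem_amp {T : Op (Ten K H)} : T ∈ amp A H ↔ ∀ i j, entry i j T ∈ A := Iff.rfl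

theorem sl_mem_of_mem_amp {T : Op (Ten K H)} (hT : T ∈ amp A H) (ξ η : H) : sl ξ η T ∈ A := by
  rw [sl_eq_sum_entry]
  exact sum_mem fun i _ => sum_mem fun j _ => SMulMemClass.smul_mem _ (hT i j)

theorem tens_mem_amp {a : Op K} (ha : a ∈ A) (y : Op H) : tens a y ∈ amp A H := fun i j => by
  rw [entry_tens]; exact SMulMemClass.smul_mem _ ha

theorem mul_tens_mem_amp {T : Op (Ten K H)} (hT : T ∈ amp A H) (y : Op H) :
    T * tens 1 y ∈ amp A H := fun i j => by
  rw [entry_eq_sl, sl_tens_right, mul_one]; exact sl_mem_of_mem_amp hT _ _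

theorem tens_mul_mem_amp {T : Op (Ten K H)} (hT : T ∈ amp A H) (y : Op H) :
    tens 1 y * T ∈ amp A H := fun i j => by
  rw [entry_eq_sl, sl_tens_left, one_mul]; exact sl_mem_of_mem_amp hT _ _

theorem isVonNeumann_amp (hA : IsVonNeumann A) : IsVonNeumann (amp A H) := by
  have : ((amp A H : NonUnitalStarSubalgebra ℂ (Op (Ten K H))) : Set (Op (Ten K H))) =
      ⋂ i, ⋂ j, (fun T => entry i j T) ⁻¹' (A : Set (Op K)) := by
    ext T; simp [mem_amp]
  unfold IsVonNeumann
  rw [this]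
  refine @isClosed_iInter _ _ (sigmaWeak _) _ fun i => @isClosed_iInter _ _ (sigmaWeak _) _ fun j => ?_
  exact @IsClosed.preimage _ _ (sigmaWeak _) (sigmaWeak _) _ (continuous_sw_sl _ _) _ hA

/-- `δ ⊗ i : A ⊗ L(H) → L(K' ⊗ H)`. -/
def ampHom (δ : A →⋆ₙₐ[ℂ] Op K') (H : Type v) [NormedAddCommGroup H]
    [InnerProductSpace ℂ H] [FiniteDimensional ℂ H] [CompleteSpace H] :
    amp A H →⋆ₙₐ[ℂ] Op (Ten K' H) where
  toFun T := ∑ i, ∑ j, tens (δ ⟨entry i j T.1, T.2 i j⟩) (ketbra i j)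
  map_smul' c T := entry_ext fun i j => by
    have : entry i j (c • ∑ i, ∑ j, tens (δ ⟨entry i j T.1, T.2 i j⟩) (ketbra i j : Op H)) =
        c • δ ⟨entry i j T.1, T.2 i j⟩ := by
      rw [entry_eq_sl, map_smul, ← entry_eq_sl, entry_sum_tens]
    rw [entry_sum_tens]
    refine Eq.trans ?_ this.symm
    rw [← map_smul]
    exact congrArg δ (Subtype.ext (map_smul (sl _ _) c T.1))
  map_zero' := entry_ext fun i j => by
    refine (entry_sum_tens i j _).trans
      ((congrArg δ (Subtype.ext (map_zero (sl _ _)))).trans ((map_zero δ).trans ?_))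
    exact (map_zero (sl _ _)).symm
  map_add' T T' := entry_ext fun i j => by
    refine (entry_sum_tens i j _).trans
      ((congrArg δ (Subtype.ext (map_add (sl _ _) T.1 T'.1) :
        _ = (⟨entry i j T.1, T.2 i j⟩ + ⟨entry i j T'.1, T'.2 i j⟩ : A))).trans ?_)
    refine (map_add δ _ _).trans (Eq.trans ?_ (map_add (sl _ _) _ _).symm)
    rw [← entry_eq_sl, ← entry_eq_sl, entry_sum_tens, entry_sum_tens]
  map_mul' T T' := entry_ext fun i j => by
    rw [entry_sum_tens, entry_mul]
    simp only [entry_sum_tens]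
    simp only [← map_mul, ← map_sum]
    refine congrArg δ (Subtype.ext ?_)
    rw [AddSubmonoidClass.coe_finsetSum]
    exact entry_mul i j T.1 T'.1
  map_star' T := entry_ext fun i j => by
    rw [entry_sum_tens, ← star_entry, entry_sum_tens, ← map_star]
    exact congrArg δ (Subtype.ext (star_entry j i T.1).symm)

theorem entry_ampHom (δ : A →⋆ₙₐ[ℂ] Op K') (T : amp A H) (i j : Fin (Module.finrank ℂ H)) :
    entry i j (ampHom δ H T) = δ ⟨entry i j T.1, T.2 i j⟩ := entry_sum_tens i j _

/-- `δ ⊗ i` commutes with slicing by arbitrary vectors, not only by the basis used to define it.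
Identities for `ampHom` are checked on slices by means of this formula. -/
theorem sl_ampHom (δ : A →⋆ₙₐ[ℂ] Op K') (T : amp A H) (ξ η : H) :
    sl ξ η (ampHom δ H T) = δ ⟨sl ξ η T.1, sl_mem_of_mem_amp T.2 ξ η⟩ := by
  rw [sl_eq_sum_entry]
  simp only [entry_ampHom, ← map_smul, ← map_sum]
  refine congrArg δ (Subtype.ext ?_)
  simp only [AddSubmonoidClass.coe_finsetSum]
  exact (sl_eq_sum_entry ξ η T.1).symm

theorem ampHom_tens (δ : A →⋆ₙₐ[ℂ] Op K') (a : A) (y : Op H) (h : tens a.1 y ∈ amp A H) :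
    ampHom δ H ⟨tens a.1 y, h⟩ = tens (δ a) y := by
  refine op_ext_sl fun ξ η => ?_
  refine (sl_ampHom δ _ ξ η).trans ?_
  conv_rhs => rw [sl_tens, ← map_smul]
  exact congrArg δ (Subtype.ext (sl_tens _ _ _ _))

theorem ampHom_mul_tens (δ : A →⋆ₙₐ[ℂ] Op K') (T : amp A H) (y : Op H) :
    ampHom δ H ⟨T.1 * tens 1 y, mul_tens_mem_amp T.2 y⟩ = ampHom δ H T * tens 1 y := by
  refine op_ext_sl fun ξ η => ?_
  refine (sl_ampHom δ _ ξ η).trans ?_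
  conv_rhs => rw [sl_tens_right, mul_one, sl_ampHom]
  exact congrArg δ (Subtype.ext ((sl_tens_right _ _ _ _ _).trans (mul_one _)))

theorem tensorId_eq_ampHom (δ : A →⋆ₙₐ[ℂ] Op K') (T : amp A H) :
    tensorId (fun a => δ a) T.1 = ampHom δ H T := by
  refine Finset.sum_congr rfl fun i _ => Finset.sum_congr rfl fun j _ => ?_
  congr 1
  exact Subtype.val_injective.extend_apply (fun a : A => δ a) 0 (⟨entry i j T.1, T.2 i j⟩ : A)

omit [CompleteSpace K'] in
/-- Composition of a normal map with a `σ`-weakly continuous map into its domain. -/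
theorem IsNormalMap.comp {δ : A → Op K'} (hδ : IsNormalMap δ) {Z : Type*} [t : TopologicalSpace Z]
    {f : Z → Op K} (hf : Continuous[t, sigmaWeak K] f) (hA : ∀ z, f z ∈ A) :
    Continuous[t, sigmaWeak K'] fun z => δ ⟨f z, hA z⟩ := by
  refine @Continuous.comp _ _ _ t ((sigmaWeak K).induced Subtype.val) (sigmaWeak K') _ _ hδ ?_
  exact continuous_induced_rng.mpr hf

theorem ampHom_normal {δ : A →⋆ₙₐ[ℂ] Op K'} (hδ : IsNormalMap δ) :
    IsNormalMap (ampHom δ H) := by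
  let t : TopologicalSpace (amp A H) := (sigmaWeak (Ten K H)).induced Subtype.val
  change Continuous[t, sigmaWeak (Ten K' H)] fun T : amp A H =>
    ∑ i, ∑ j, tens (δ ⟨entry i j T.1, T.2 i j⟩) (ketbra i j)
  refine continuous_sw_sum (K := Ten K' H) (Z := amp A H) _ fun i _ =>
    continuous_sw_sum (K := Ten K' H) (Z := amp A H) _ fun j _ => ?_
  have h1 : Continuous[t, sigmaWeak K] fun T : amp A H => entry i j T.1 :=
    @Continuous.comp (amp A H) (Op (Ten K H)) (Op K) t (sigmaWeak _) (sigmaWeak _) _ _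
      (continuous_sw_sl (stdOrthonormalBasis ℂ H i) (stdOrthonormalBasis ℂ H j))
      continuous_induced_dom
  have h2 := IsNormalMap.comp (δ := δ) hδ h1 fun T => T.2 i j
  exact @Continuous.comp (amp A H) (Op K') (Op (Ten K' H)) t (sigmaWeak _) (sigmaWeak _) _ _
    (continuous_sw_tens (ketbra i j : Op H)) h2

end Amplification

/-! ### Tomita theory in finite dimension -/

section Positive

variable {E : Type*} [NormedAddCommGroup E] [InnerProductSpace ℂ E] [CompleteSpace E]

theorem eq_of_mul_self_eq {P Q : Op E} (hP : P.IsPositive) (hQ : Q.IsPositive)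
    (h : P * P = Q * Q) : P = Q := by
  rw [← ContinuousLinearMap.nonneg_iff_isPositive] at hP hQ
  rw [← CFC.sqrt_unique rfl hQ, ← h, CFC.sqrt_mul_self P hP]

theorem commute_of_commute_mul_self {P x : Op E} (hP : P.IsPositive) (h : Commute (P * P) x) :
    Commute P x := by
  rw [← ContinuousLinearMap.nonneg_iff_isPositive] at hP
  rw [← CFC.sqrt_mul_self P hP]
  exact h.cfcₙ_nnreal _

theorem star_eq_of_isPositive {P : Op E} (hP : P.IsPositive) : star P = P := hP.isSelfAdjoint

end Positive

section Antiunitary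

variable {H : Type v} [NormedAddCommGroup H] [InnerProductSpace ℂ H]

/-- Polarization recovers the real part from norms, which `J` preserves. The imaginary part is a
real part after multiplying `a` by the imaginary unit, where antilinearity changes the sign. -/
theorem inner_antiunitary (J : H ≃ₗᵢ⋆[ℂ] H) (a b : H) : ⟪J a, J b⟫_ℂ = ⟪b, a⟫_ℂ := by
  have hre : ∀ a b : H, (⟪J a, J b⟫_ℂ).re = (⟪a, b⟫_ℂ).re := fun a b => by
    have h1 := re_inner_eq_norm_mul_self_add_norm_mul_self_sub_norm_sub_mul_self_div_two
      (𝕜 := ℂ) (J a) (J b)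
    have h2 := re_inner_eq_norm_mul_self_add_norm_mul_self_sub_norm_sub_mul_self_div_two
      (𝕜 := ℂ) a b
    rw [← map_sub, J.norm_map, J.norm_map, J.norm_map, ← h2] at h1
    exact h1
  have him : ∀ a b : H, (⟪Complex.I • a, b⟫_ℂ).re = (⟪a, b⟫_ℂ).im := fun a b => by
    rw [inner_smul_left]; simp
  rw [← inner_conj_symm b a]
  apply Complex.ext
  · rw [hre, Complex.conj_re]
  · rw [← him, Complex.conj_im, ← him a b]
    have : Complex.I • J a = J (-(Complex.I • a)) := by
      rw [map_neg, map_smulₛₗ]; simp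
    rw [this, hre, inner_neg_left, Complex.neg_re]

theorem inner_antiunitary_left (J : H ≃ₗᵢ⋆[ℂ] H) (a b : H) : ⟪J a, b⟫_ℂ = ⟪J.symm b, a⟫_ℂ := by
  conv_lhs => rw [← J.apply_symm_apply b]
  exact inner_antiunitary J _ _

theorem inner_antiunitary_right (J : H ≃ₗᵢ⋆[ℂ] H) (a b : H) : ⟪a, J b⟫_ℂ = ⟪b, J.symm a⟫_ℂ := by
  conv_lhs => rw [← J.apply_symm_apply a]
  exact inner_antiunitary J _ _

/-- `J x J⁻¹`. -/
def cj (J : H ≃ₗᵢ⋆[ℂ] H) (x : Op H) : Op H :=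
  (J.toContinuousLinearEquiv.toContinuousLinearMap ∘SL x) ∘SL
    J.symm.toContinuousLinearEquiv.toContinuousLinearMap

theorem cj_apply (J : H ≃ₗᵢ⋆[ℂ] H) (x : Op H) (v : H) : cj J x v = J (x (J.symm v)) := rfl

theorem cj_mul (J : H ≃ₗᵢ⋆[ℂ] H) (x y : Op H) : cj J (x * y) = cj J x * cj J y := by
  ext v
  simp only [op_mul_apply, cj_apply, J.symm_apply_apply]

theorem star_cj [CompleteSpace H] (J : H ≃ₗᵢ⋆[ℂ] H) (x : Op H) : star (cj J x) = cj J (star x) :=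
  op_eq_of_inner fun a b => by
    rw [inner_star_right, cj_apply, cj_apply, inner_antiunitary_left, inner_antiunitary_right,
      inner_star_left]

theorem cj_injective (J : H ≃ₗᵢ⋆[ℂ] H) : Function.Injective (cj J) := fun x y h => by
  ext v
  have := congrArg (fun T : Op H => T (J v)) h
  simpa [cj_apply] using this

theorem isPositive_cj [CompleteSpace H] (J : H ≃ₗᵢ⋆[ℂ] H) {P : Op H} (hP : P.IsPositive) :
    (cj J P).IsPositive := by
  rw [isPositive_iff']
  refine ⟨?_, fun x => ?_⟩
  · rw [IsSelfAdjoint, star_cj, star_eq_of_isPositive hP]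
  · rw [cj_apply, inner_antiunitary_left]
    exact hP.inner_nonneg_right _

end Antiunitary

variable {H : Type v} [NormedAddCommGroup H] [InnerProductSpace ℂ H] [FiniteDimensional ℂ H]
  [CompleteSpace H]

/-- A von Neumann algebra `M` with a cyclic and separating vector `e`, its modular conjugation `J`
and `D = Δ^{1/2}`, `Di = Δ^{-1/2}`. -/
structure ModularData (M : Submodule ℂ (Op H)) (e : H) (J : H ≃ₗᵢ⋆[ℂ] H) (D Di : Op H) : Prop where
  one_mem : 1 ∈ M
  mul_mem : ∀ x ∈ M, ∀ y ∈ M, x * y ∈ M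
  star_mem : ∀ x ∈ M, star x ∈ M
  bicomm : ∀ x, (∀ y ∈ Set.centralizer (M : Set (Op H)), x * y = y * x) → x ∈ M
  cyclic : ∀ η : H, ∃ x ∈ M, x e = η
  separating : ∀ x ∈ M, x e = 0 → x = 0
  pos : D.IsPositive
  inv_left : Di * D = 1
  inv_right : D * Di = 1
  conj : ∀ x ∈ M, J (D (x e)) = star x e

/-- If D(xe) = 0 then x*e = 0, hence x = 0 because e is separating. So `D` is injective, and in
finite dimension it is invertible. -/
theorem exists_modularData {M : Submodule ℂ (Op H)} {e : H} {J : H ≃ₗᵢ⋆[ℂ] H}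
    (hM : ∃ R : VonNeumannAlgebra H, (R : Set (Op H)) = M) (hcs : IsCyclicSeparating M e)
    (hJ : IsModularConj M e J) : ∃ D Di, ModularData M e J D Di := by
  obtain ⟨R, hR⟩ := hM
  have hmem : ∀ x, x ∈ M ↔ x ∈ R := fun x => by
    rw [← SetLike.mem_coe, ← hR, SetLike.mem_coe]
  obtain ⟨D, hD, hrel⟩ := hJ
  have hstar : ∀ x ∈ M, star x ∈ M := fun x hx => by
    rw [hmem] at hx ⊢; exact star_mem hx
  have hinj : Function.Injective D.toLinearMap := by
    rw [injective_iff_map_eq_zero]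
    intro v hv
    obtain ⟨x, hx, rfl⟩ := hcs.1 v
    have h1 := hrel x hx
    have h2 : D (x e) = 0 := hv
    rw [h2, map_zero] at h1
    have h3 := hcs.2 _ (hstar x hx) h1
    rw [star_eq_zero] at h3
    simp [h3]
  let T := LinearEquiv.ofInjectiveEndo D.toLinearMap hinj
  refine ⟨D, T.symm.toLinearMap.toContinuousLinearMap, ?_, ?_, hstar, ?_, hcs.1, hcs.2, hD, ?_, ?_,
    fun x hx => (hrel x hx).symm⟩
  · rw [hmem]; exact one_mem R
  · intro x hx y hy; rw [hmem] at hx hy ⊢; exact mul_mem hx hy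
  · intro x hx
    rw [hmem, ← SetLike.mem_coe, ← R.centralizer_centralizer, hR]
    exact Set.mem_centralizer_iff.mpr fun m hm => (hx m hm).symm
  · ext v
    exact T.symm_apply_apply v
  · ext v
    exact T.apply_symm_apply v

namespace ModularData

variable {M : Submodule ℂ (Op H)} {e : H} {J : H ≃ₗᵢ⋆[ℂ] H} {D Di : Op H}
  (h : ModularData M e J D Di)

include h

omit [FiniteDimensional ℂ H] in
theorem D_Di (v : H) : D (Di v) = v := congrArg (fun T : Op H => T v) h.inv_right

omit [FiniteDimensional ℂ H] in
theorem Di_D (v : H) : Di (D v) = v := congrArg (fun T : Op H => T v) h.inv_left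

omit [FiniteDimensional ℂ H] in
theorem star_D : star D = D := star_eq_of_isPositive h.pos

omit [FiniteDimensional ℂ H] in
theorem inner_D (a b : H) : ⟪a, D b⟫_ℂ = ⟪D a, b⟫_ℂ := by
  rw [← inner_star_left, h.star_D]

omit [FiniteDimensional ℂ H] in
theorem star_Di : star Di = Di := by
  have h1 : star Di * D = 1 := by
    have := congrArg star h.inv_right
    rwa [star_mul, h.star_D, star_one] at this
  calc star Di = star Di * (D * Di) := by rw [h.inv_right, mul_one]
    _ = Di := by rw [← mul_assoc, h1, one_mul]

omit [FiniteDimensional ℂ H] in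
theorem pos_Di : Di.IsPositive := by
  rw [isPositive_iff']
  refine ⟨h.star_Di, fun x => ?_⟩
  have h1 := h.pos.inner_nonneg_right (Di x)
  rwa [h.D_Di] at h1

omit [FiniteDimensional ℂ H] in
theorem conj_conj (v : H) : J (D (J (D v))) = v := by
  obtain ⟨x, hx, rfl⟩ := h.cyclic v
  rw [h.conj x hx, h.conj _ (h.star_mem x hx), star_star]

omit [FiniteDimensional ℂ H] in
theorem J_Di (v : H) : Di (J.symm v) = J (D v) := by
  conv_lhs => rw [← h.conj_conj v, J.symm_apply_apply, h.Di_D]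

omit [FiniteDimensional ℂ H] in
/-- The modular conjugation is an involution. -/
theorem symm_eq : J.symm = J := by
  -- From JDJD = 1 one gets D = J⁻¹D⁻¹J⁻¹, and taking adjoints D = JD⁻¹J. Multiplying the two, D² =
  -- (JD⁻¹J⁻¹)², so D = JD⁻¹J⁻¹ by uniqueness of positive square roots. Comparison with D = JD⁻¹J
  -- gives J⁻¹ = J.
  have h1' : ∀ v, D v = J.symm (Di (J.symm v)) := fun v => by
    rw [h.J_Di, J.symm_apply_apply]
  have h2 : ∀ v, D v = J (Di (J v)) := fun v => by
    refine ext_inner_left ℂ fun a => ?_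
    rw [h.inner_D, h1', inner_antiunitary_left, J.symm_symm, inner_antiunitary_right,
      ← inner_star_right, h.star_Di]
  have h3 : D * D = cj J Di * cj J Di := by
    ext v
    rw [op_mul_apply, op_mul_apply, h2 (D v), h1' v, cj_apply, cj_apply, J.symm_apply_apply,
      J.apply_symm_apply]
  have h4 := eq_of_mul_self_eq h.pos (isPositive_cj J h.pos_Di) h3
  ext v
  have h5 : J (Di (J.symm v)) = J (Di (J v)) := by
    rw [← h2, ← cj_apply, ← h4]
  have h6 := congrArg D (J.injective h5)
  rwa [h.D_Di, h.D_Di] at h6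

omit [FiniteDimensional ℂ H] in
theorem J_J (v : H) : J (J v) = v := by
  have := J.symm_apply_apply v
  rwa [h.symm_eq] at this

omit [FiniteDimensional ℂ H] in
theorem cj_cj (x : Op H) : cj J (cj J x) = x := by
  ext v
  rw [cj_apply, cj_apply, h.symm_eq, h.J_J, h.J_J]

omit [FiniteDimensional ℂ H] in
theorem J_D (v : H) : J (D v) = Di (J v) := by rw [← h.J_Di, h.symm_eq]

omit [FiniteDimensional ℂ H] in
theorem D_J (v : H) : D (J v) = J (Di v) := by
  have := congrArg D (h.J_D (Di v))
  rwa [h.D_Di, h.D_Di] at this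

omit [FiniteDimensional ℂ H] in
theorem inner_J_left (a b : H) : ⟪J a, b⟫_ℂ = ⟪J b, a⟫_ℂ := by
  rw [inner_antiunitary_left, h.symm_eq]

omit [FiniteDimensional ℂ H] in
theorem inner_J_right (a b : H) : ⟪a, J b⟫_ℂ = ⟪b, J a⟫_ℂ := by
  rw [inner_antiunitary_right, h.symm_eq]

omit [FiniteDimensional ℂ H] in
theorem cj_D : cj J D = Di := by
  ext v
  rw [cj_apply, h.J_D, J.apply_symm_apply]

omit [FiniteDimensional ℂ H] in
theorem cj_Di : cj J Di = D := by rw [← h.cj_D, h.cj_cj]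

omit [FiniteDimensional ℂ H] in
theorem conj_e : J (D e) = e := by
  have := h.conj 1 h.one_mem
  simpa using this

omit [FiniteDimensional ℂ H] in
theorem D_e : D e = e := by
  -- `y' e ↦ y'^* e` is the adjoint of `x e ↦ x^* e`
  have h1 : D (J e) = e := by
    refine ext_inner_left ℂ fun a => ?_
    obtain ⟨x, hx, rfl⟩ := h.cyclic a
    rw [h.inner_D, h.inner_J_right, h.conj x hx, inner_star_right]
  have h2 : D (D e) = e := by
    have h3 : D e = J e := J.injective (by rw [h.conj_e, h.J_J])
    rw [h3, h1]
  -- The vector De − e is sent to its opposite, and a positive operator does not have −1 as an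
  -- eigenvalue.
  have h4 : D (D e - e) = -(D e - e) := by rw [map_sub, h2]; abel
  have h5 := h.pos.inner_nonneg_right (D e - e)
  rw [h4, inner_neg_right] at h5
  have h6 : (0 : ℂ) ≤ ⟪D e - e, D e - e⟫_ℂ := by
    have := (isPositive_one (E := H) (𝕜 := ℂ)).inner_nonneg_right (D e - e)
    exact this
  have h7 : ⟪D e - e, D e - e⟫_ℂ = 0 := le_antisymm (by simpa using h5) h6
  exact sub_eq_zero.mp (inner_self_eq_zero.mp h7)

omit [FiniteDimensional ℂ H] in
theorem Di_e : Di e = e := by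
  conv_lhs => rw [← h.D_e, h.Di_D]

omit [FiniteDimensional ℂ H] in
theorem J_e : J e = e := by
  have := h.conj_e
  rwa [h.D_e] at this

omit [FiniteDimensional ℂ H] in
-- With F = JD the map ye ↦ y*e, the operator FxF⁻¹ sends ye to yx*e. It is a right multiplication,
-- hence commutes with the left multiplications by `M`.
theorem cj_D_mem {x : Op H} (hx : x ∈ M) :
    cj J (D * x * Di) ∈ Set.centralizer (M : Set (Op H)) := by
  have key : ∀ y ∈ M, cj J (D * x * Di) (y e) = (y * star x) e := fun y hy => by
    rw [cj_apply, op_mul_apply, op_mul_apply, h.J_Di, h.conj y hy, ← op_mul_apply x (star y),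
      h.conj _ (h.mul_mem _ hx _ (h.star_mem _ hy)), star_mul, star_star]
  refine Set.mem_centralizer_iff.mpr fun z hz => ?_
  ext v
  obtain ⟨y, hy, rfl⟩ := h.cyclic v
  rw [op_mul_apply, op_mul_apply, key y hy, ← op_mul_apply z y, key _ (h.mul_mem _ hz _ hy)]
  simp only [op_mul_apply]

omit [FiniteDimensional ℂ H] in
theorem cj_D_e {x : Op H} (hx : x ∈ M) : cj J (D * x * Di) e = star x e := by
  rw [cj_apply, op_mul_apply, op_mul_apply, h.symm_eq, h.J_e, h.Di_e, h.conj x hx]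

omit [FiniteDimensional ℂ H] in
theorem separating_commutant {y : Op H} (hy : y ∈ Set.centralizer (M : Set (Op H)))
    (h0 : y e = 0) : y = 0 := by
  ext v
  obtain ⟨x, hx, rfl⟩ := h.cyclic v
  rw [← op_mul_apply, ← Set.mem_centralizer_iff.mp hy x hx, op_mul_apply, h0, map_zero]
  rfl

omit [FiniteDimensional ℂ H] in
theorem eq_of_apply_eq_commutant {y z : Op H} (hy : y ∈ Set.centralizer (M : Set (Op H)))
    (hz : z ∈ Set.centralizer (M : Set (Op H))) (h0 : y e = z e) : y = z := by
  refine sub_eq_zero.mp (h.separating_commutant ?_ (by simp [h0]))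
  refine Set.mem_centralizer_iff.mpr fun x hx => ?_
  rw [mul_sub, sub_mul, Set.mem_centralizer_iff.mp hy x hx, Set.mem_centralizer_iff.mp hz x hx]

omit [FiniteDimensional ℂ H] in
theorem star_mem_centralizer {y : Op H} (hy : y ∈ Set.centralizer (M : Set (Op H))) :
    star y ∈ Set.centralizer (M : Set (Op H)) := by
  refine Set.mem_centralizer_iff.mpr fun x hx => ?_
  have := congrArg star (Set.mem_centralizer_iff.mp hy _ (h.star_mem x hx))
  rw [star_mul, star_mul, star_star] at this
  exact this.symm

omit [FiniteDimensional ℂ H] in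
-- The Tomita operator of the commutant is the adjoint DJ of that of `M`.
theorem conj_commutant {y : Op H} (hy : y ∈ Set.centralizer (M : Set (Op H))) :
    D (J (y e)) = star y e := by
  refine ext_inner_left ℂ fun a => ?_
  obtain ⟨x, hx, rfl⟩ := h.cyclic a
  rw [h.inner_D, h.inner_J_right, h.conj x hx, inner_star_right, inner_star_right,
    ← op_mul_apply, ← op_mul_apply, Set.mem_centralizer_iff.mp hy x hx]

omit [FiniteDimensional ℂ H] in
-- Mirror image of `cj_D_mem`: the vector e is cyclic for the commutant too, the operator in
-- question acts there by right multiplication, and the bicommutant property brings it back into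
-- `M`.
theorem cj_Di_mem {y : Op H} (hy : y ∈ Set.centralizer (M : Set (Op H))) :
    cj J (Di * y * D) ∈ M := by
  have hcyc : ∀ v : H, ∃ z ∈ Set.centralizer (M : Set (Op H)), z e = v := fun v => by
    obtain ⟨x, hx, rfl⟩ := h.cyclic v
    exact ⟨_, h.cj_D_mem (h.star_mem x hx), by rw [h.cj_D_e (h.star_mem x hx), star_star]⟩
  have key : ∀ z ∈ Set.centralizer (M : Set (Op H)),
      cj J (Di * y * D) (z e) = (z * star y) e := fun z hz => by
    rw [cj_apply, op_mul_apply, op_mul_apply, h.symm_eq, h.conj_commutant hz, ← h.D_J,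
      ← op_mul_apply y (star z), h.conj_commutant (Set.mul_mem_centralizer hy (h.star_mem_centralizer hz)),
      star_mul, star_star]
  refine h.bicomm _ fun z hz => ?_
  ext v
  obtain ⟨w, hw, rfl⟩ := hcyc v
  rw [op_mul_apply, op_mul_apply, key w hw, ← op_mul_apply z w,
    key _ (Set.mul_mem_centralizer hz hw)]
  simp only [op_mul_apply]

omit [FiniteDimensional ℂ H] in
-- Composing the two preceding conjugations gives ΔMΔ⁻¹ ⊆ M with Δ = D². Passing from Δ to its
-- square root is the purpose of `exists_eigen_sum`.
theorem D_sq_mem {x : Op H} (hx : x ∈ M) : D * D * x * (Di * Di) ∈ M := by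
  have h1 := h.cj_Di_mem (h.cj_D_mem hx)
  rw [cj_mul, cj_mul, h.cj_cj, h.cj_D, h.cj_Di] at h1
  simpa only [mul_assoc] using h1

/-- The vector xe is split along an eigenbasis of `D`, and each component is written y_i e with y_i
in `M`. Both Δ y_i Δ⁻¹ and d_i² y_i lie in `M` and agree on e, so they are equal. On matrix entries
this reads d_j² = d_i² d_k² wherever the entry (j, k) of y_i is nonzero. As the eigenvalues are
positive, d_j = d_i d_k, which is D y_i = d_i y_i D. -/
theorem exists_eigen_sum {x : Op H} (hx : x ∈ M) : ∃ (y : Fin (Module.finrank ℂ H) → Op H)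
    (d : Fin (Module.finrank ℂ H) → ℂ), (∀ i, y i ∈ M) ∧ (∀ i, d i ≠ 0) ∧
      (∀ i, D * y i = d i • (y i * D)) ∧ x = ∑ i, y i := by
  have hsym : (D : H →ₗ[ℂ] H).IsSymmetric := h.pos.isSymmetric
  let f := hsym.eigenvectorBasis rfl
  let d : Fin (Module.finrank ℂ H) → ℝ := hsym.eigenvalues rfl
  have hf : ∀ i, D (f i) = (d i : ℂ) • f i := fun i => hsym.apply_eigenvectorBasis rfl i
  have hd : ∀ i, 0 < d i := fun i => by
    have h1 := h.pos.inner_nonneg_right (f i)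
    rw [hf, inner_smul_right, inner_self_eq_norm_sq_to_K, f.orthonormal.1 i] at h1
    have h2 : (0 : ℝ) ≤ d i := by
      have : (0 : ℂ) ≤ (d i : ℂ) := by simpa using h1
      exact_mod_cast this
    refine lt_of_le_of_ne h2 fun h0 => ?_
    have h3 := hf i
    rw [← h0] at h3
    have h4 := h.Di_D (f i)
    rw [h3] at h4
    simp only [Complex.ofReal_zero, zero_smul, map_zero] at h4
    exact f.orthonormal.ne_zero i h4.symm
  choose y hy hye using fun i => h.cyclic (⟪f i, x e⟫_ℂ • f i)
  refine ⟨y, fun i => d i, hy, fun i => Complex.ofReal_ne_zero.mpr (hd i).ne', fun i => ?_, ?_⟩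
  · -- `D²` and `y i` commute up to the factor `(d i)²`
    have hDf : D (y i e) = (d i : ℂ) • y i e := by
      rw [hye, map_smul, hf, smul_comm]
    have h1 : D * D * y i * (Di * Di) = ((d i : ℂ) * d i) • y i := by
      refine sub_eq_zero.mp (h.separating _ (M.sub_mem (h.D_sq_mem (hy i))
        (M.smul_mem _ (hy i))) ?_)
      rw [sub_apply, op_mul_apply, op_mul_apply, op_mul_apply, op_mul_apply, h.Di_e, h.Di_e, hDf,
        map_smul, hDf, smul_apply, smul_smul, sub_self]
    have h2 : D * D * y i = ((d i : ℂ) * d i) • (y i * (D * D)) := by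
      rw [← op_smul_mul, ← h1]
      calc D * D * y i = D * D * y i * (Di * (Di * D) * D) := by
            rw [h.inv_left, mul_one, h.inv_left, mul_one]
        _ = _ := by simp only [mul_assoc]
    have hk : ∀ j k, (⟪f j, y i (f k)⟫_ℂ ≠ 0) → d j = d i * d k := fun j k hjk => by
      have h3 : ⟪f j, (D * D * y i) (f k)⟫_ℂ =
        ⟪f j, (((d i : ℂ) * d i) • (y i * (D * D))) (f k)⟫_ℂ := by rw [h2]
      simp only [op_mul_apply, smul_apply, hf, map_smul, inner_smul_right, h.inner_D,
        inner_smul_left, Complex.conj_ofReal] at h3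
      have h4 : ((d j : ℂ) * d j) = (d i * d k) * (d i * d k) := by
        refine mul_right_cancel₀ hjk ?_
        rw [mul_assoc, h3]; ring
      have h5 : d j * d j = (d i * d k) * (d i * d k) := by exact_mod_cast h4
      exact (mul_self_inj (hd j).le (mul_nonneg (hd i).le (hd k).le)).mp h5
    refine op_eq_of_inner fun a b => ?_
    have hab : ∀ k, ⟪a, (D * y i) (f k)⟫_ℂ = ⟪a, ((d i : ℂ) • (y i * D)) (f k)⟫_ℂ := fun k => by
      congr 1
      refine f.toBasis.ext_elem_iff.mpr fun j => ?_
      simp only [OrthonormalBasis.coe_toBasis_repr_apply, f.repr_apply_apply]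
      simp only [op_mul_apply, smul_apply, hf, map_smul, inner_smul_right, h.inner_D,
        inner_smul_left, Complex.conj_ofReal]
      by_cases hjk : ⟪f j, y i (f k)⟫_ℂ = 0
      · rw [hjk]; simp
      · rw [hk j k hjk]; push_cast; ring
    rw [← f.sum_repr' b, map_sum, map_sum, inner_sum, inner_sum]
    exact Finset.sum_congr rfl fun k _ => by
      rw [map_smul, map_smul, inner_smul_right, inner_smul_right, hab]
  · refine sub_eq_zero.mp (h.separating _ (M.sub_mem hx (M.sum_mem fun i _ => hy i)) ?_)
    rw [sub_apply, sum_apply]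
    simp only [hye]
    rw [f.sum_repr', sub_self]

theorem Di_mem {x : Op H} (hx : x ∈ M) : Di * x * D ∈ M := by
  obtain ⟨y, d, hy, hd, hD, rfl⟩ := h.exists_eigen_sum hx
  rw [Finset.mul_sum, Finset.sum_mul]
  refine M.sum_mem fun i _ => ?_
  have : y i * D = (d i)⁻¹ • (D * y i) := by rw [hD, smul_smul, inv_mul_cancel₀ (hd i), one_smul]
  rw [mul_assoc, this, op_mul_smul, ← mul_assoc, h.inv_left, one_mul]
  exact M.smul_mem _ (hy i)

/-- `J M J ⊆ M'`. -/
theorem cj_mem_centralizer {x : Op H} (hx : x ∈ M) :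
    cj J x ∈ Set.centralizer (M : Set (Op H)) := by
  have h1 := h.cj_D_mem (h.Di_mem hx)
  have h2 : D * (Di * x * D) * Di = (D * Di) * x * (D * Di) := by simp only [mul_assoc]
  rwa [h2, h.inv_right, one_mul, mul_one] at h1

/-- `J M' J ⊆ M`. -/
theorem cj_mem {y : Op H} (hy : y ∈ Set.centralizer (M : Set (Op H))) : cj J y ∈ M := by
  have h1 := h.Di_mem (h.cj_Di_mem hy)
  rw [cj_mul, cj_mul, h.cj_Di, h.cj_D] at h1
  have h2 : Di * (D * cj J y * Di) * D = (Di * D) * cj J y * (Di * D) := by simp only [mul_assoc]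
  rwa [h2, h.inv_left, one_mul, mul_one] at h1

omit [FiniteDimensional ℂ H] in
/-- If `a ∈ M` and `c ∈ M'` satisfy `a e = c e` and `a* e = c* e`, then
`J Δ^{1/2} a Δ^{-1/2} J = c*`. -/
theorem cj_D_eq_star {a c : Op H} (ha : a ∈ M) (hc : c ∈ Set.centralizer (M : Set (Op H)))
    (h2 : star a e = star c e) : cj J (D * a * Di) = star c :=
  h.eq_of_apply_eq_commutant (h.cj_D_mem ha) (h.star_mem_centralizer hc) (by rw [h.cj_D_e ha, h2])

omit [FiniteDimensional ℂ H] in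
/-- If `a ∈ M` and `c ∈ M'` satisfy `a e = c e` and `a* e = c* e`, then `J a J = c*`. -/
theorem cj_eq_star {a c : Op H} (ha : a ∈ M) (hc : c ∈ Set.centralizer (M : Set (Op H)))
    (h1 : a e = c e) (h2 : star a e = star c e) : cj J a = star c := by
  -- The preceding lemma applied to a, and to a* followed by an adjoint, gives two expressions of
  -- c*, so that DaD⁻¹ = D⁻¹aD. Then D² commutes with a, hence so does its positive root `D`, and
  -- the factors D and D⁻¹ cancel.
  have h3 := h.cj_D_eq_star ha hc h2
  have h4 := h.cj_D_eq_star (h.star_mem _ ha) (h.star_mem_centralizer hc)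
    (by rw [star_star, star_star, h1])
  have h5 := congrArg star h4
  rw [star_cj, star_mul, star_mul, star_star, star_star, h.star_D, h.star_Di, ← h3,
    ← mul_assoc] at h5
  have h6 := cj_injective J h5
  have h7 : Commute (D * D) a := by
    have h8 : D * (Di * a * D) * D = D * (D * a * Di) * D := by rw [h6]
    have h9 : D * (Di * a * D) * D = (D * Di) * a * (D * D) := by simp only [mul_assoc]
    have h10 : D * (D * a * Di) * D = D * D * a * (Di * D) := by simp only [mul_assoc]
    rw [h9, h10, h.inv_left, h.inv_right, one_mul, mul_one] at h8
    exact h8.symm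
  have h8 := commute_of_commute_mul_self h.pos h7
  rw [← h3, h8.eq, mul_assoc, h.inv_right, mul_one]

omit [FiniteDimensional ℂ H] in
/-- An antiunitary involution that preserves `M` and `e` commutes with the modular conjugation of
`(M, e)`. -/
theorem commute_J {J' : H ≃ₗᵢ⋆[ℂ] H} (hJ' : J'.symm = J') (hM : ∀ x ∈ M, cj J' x ∈ M)
    (he : J' e = e) (v : H) : J' (J v) = J (J' v) := by
  have hinv : ∀ v, J' (J' v) = v := fun v => by
    have := J'.symm_apply_apply v
    rwa [hJ'] at this
  -- `J'` commutes with the Tomita operator JD. Comparing absolute values, it commutes with `D`, and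
  -- therefore with `J`.
  have h1 : ∀ v, J' (J (D (J' v))) = J (D v) := fun v => by
    obtain ⟨x, hx, rfl⟩ := h.cyclic v
    have h2 : J' (x e) = cj J' x e := by rw [cj_apply, hJ', he]
    rw [h2, h.conj _ (hM x hx), star_cj, cj_apply, hinv, hJ', he, h.conj x hx]
  have h3 : D * D = cj J' D * cj J' D := by
    refine op_eq_of_inner fun a b => ?_
    rw [op_mul_apply, h.inner_D, ← inner_antiunitary J, ← h1 b, ← h1 a, inner_antiunitary J',
      inner_antiunitary J, h.inner_D, op_mul_apply, cj_apply, cj_apply, J'.symm_apply_apply, hJ',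
      inner_antiunitary_right, hJ']
  have h4 := eq_of_mul_self_eq h.pos (isPositive_cj J' h.pos) h3
  have h5 : ∀ v, D (J' v) = J' (D v) := fun v => by
    conv_lhs => rw [h4, cj_apply, J'.symm_apply_apply]
  have h6 := h1 (J' (Di v))
  rw [hinv, h.D_Di, h5, h.D_Di] at h6
  exact h6

end ModularData

/-! ### The Casimir element of the base -/

section Casimir

variable {G : Type w} {n : G → ℕ}

theorem mul_unit (x : Base n) (γ : G) (i j : Fin (n γ)) :
    x * unit n γ i j = ∑ k, x γ k i • unit n γ k j := by
  classical
  funext γ'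
  by_cases hγ : γ' = γ
  · subst hγ
    simp only [Pi.mul_apply, unit, Pi.single_eq_same, Finset.sum_apply, Pi.smul_apply]
    ext a b
    rw [Matrix.sum_apply]
    simp [Matrix.mul_apply, Matrix.single_apply, ite_and]
  · simp [unit, Pi.single_eq_of_ne hγ, Finset.sum_apply]

theorem unit_mul (x : Base n) (γ : G) (i j : Fin (n γ)) :
    unit n γ i j * x = ∑ k, x γ j k • unit n γ i k := by
  classical
  funext γ'
  by_cases hγ : γ' = γ
  · subst hγ
    simp only [Pi.mul_apply, unit, Pi.single_eq_same, Finset.sum_apply, Pi.smul_apply]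
    ext a b
    rw [Matrix.sum_apply]
    simp [Matrix.mul_apply, Matrix.single_apply, ite_and]
  · simp [unit, Pi.single_eq_of_ne hγ, Finset.sum_apply]

/-- For the Casimir element c = ∑ n_γ⁻¹ e_ij ⊗ e_ji this is (x ⊗ 1)c = c(1 ⊗ x). It moves elements
of the base from one leg of a support projection to the other. -/
theorem sum_mul_unit [Fintype G] {W : Type*} [AddCommGroup W] [Module ℂ W]
    (B : Base n →ₗ[ℂ] Base n →ₗ[ℂ] W) (x : Base n) :
    ∑ γ, ∑ i, ∑ j, ((n γ : ℂ)⁻¹) • B (x * unit n γ i j) (unit n γ j i) =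
      ∑ γ, ∑ i, ∑ j, ((n γ : ℂ)⁻¹) • B (unit n γ i j) (unit n γ j i * x) := by
  refine Finset.sum_congr rfl fun γ _ => ?_
  simp only [mul_unit, unit_mul, map_sum, map_smul, LinearMap.sum_apply, LinearMap.smul_apply,
    ← Finset.smul_sum]
  congr 1
  calc ∑ i, ∑ j, ∑ k, x γ k i • B (unit n γ k j) (unit n γ j i)
      = ∑ i, ∑ k, ∑ j, x γ k i • B (unit n γ k j) (unit n γ j i) :=
        Finset.sum_congr rfl fun i _ => Finset.sum_comm
    _ = ∑ k, ∑ i, ∑ j, x γ k i • B (unit n γ k j) (unit n γ j i) := Finset.sum_comm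
    _ = ∑ k, ∑ j, ∑ i, x γ k i • B (unit n γ k j) (unit n γ j i) :=
        Finset.sum_congr rfl fun i _ => Finset.sum_comm

theorem sum_unit_mul_unit [Fintype G] :
    ∑ γ, ∑ i, ∑ j, ((n γ : ℂ)⁻¹) • (unit n γ i j * unit n γ j i) = (1 : Base n) := by
  classical
  have h1 : ∀ γ (i j : Fin (n γ)), unit n γ i j * unit n γ j i = unit n γ i i := fun γ i j => by
    rw [mul_unit, Finset.sum_eq_single i]
    · simp [unit]
    · intro k _ hk; simp [unit, hk.symm]
    · simp
  have h2 : ∀ γ (i : Fin (n γ)), ∑ _j : Fin (n γ), ((n γ : ℂ)⁻¹) • unit n γ i i = unit n γ i i :=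
    fun γ i => by
      have : (n γ : ℂ) ≠ 0 := by exact_mod_cast (Fin.pos i).ne'
      rw [Finset.sum_const, Finset.card_univ, Fintype.card_fin, ← Nat.cast_smul_eq_nsmul ℂ,
        smul_smul, mul_inv_cancel₀ this, one_smul]
  simp only [h1, h2]
  funext γ'
  rw [Finset.sum_apply, Finset.sum_eq_single γ']
  · rw [Finset.sum_apply]
    simp only [unit, Pi.single_eq_same, Pi.one_apply]
    ext a b
    rw [Matrix.sum_apply]
    by_cases hab : a = b
    · subst hab; simp [Matrix.single_apply]
    · simp [Matrix.single_apply, hab, Matrix.one_apply_ne hab]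
  · intro γ _ hγ
    simp [unit, Finset.sum_apply, Pi.single_eq_of_ne hγ.symm]
  · simp

theorem sum_unit_mul_unit' [Fintype G] :
    ∑ γ, ∑ i, ∑ j, ((n γ : ℂ)⁻¹) • (unit n γ j i * unit n γ i j) = (1 : Base n) := by
  rw [← sum_unit_mul_unit]
  exact Finset.sum_congr rfl fun γ _ => Finset.sum_comm

end Casimir

/-! ### Relations between `I` and its base -/

namespace Mpi

variable {G : Type w} [Fintype G] {n : G → ℕ}
variable {H : Type v} [NormedAddCommGroup H] [InnerProductSpace ℂ H]
  [FiniteDimensional ℂ H] [CompleteSpace H] (V : Mpi n H)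

/-- `α` as a linear map. -/
def al : Base n →ₗ[ℂ] Op H where
  toFun x := V.α x
  map_add' := map_add V.α
  map_smul' := map_smul V.α

/-- `β` as a linear map on `N`. -/
def be : Base n →ₗ[ℂ] Op H where
  toFun x := V.β (op x)
  map_add' x y := map_add V.β (op x) (op y)
  map_smul' c x := map_smul V.β c (op x)

/-- `β̂` as a linear map on `N`. -/
def bh : Base n →ₗ[ℂ] Op H where
  toFun x := V.βh (op x)
  map_add' x y := map_add V.βh (op x) (op y)
  map_smul' c x := map_smul V.βh c (op x)

theorem al_mul (x y : Base n) : V.al (x * y) = V.al x * V.al y := map_mul V.α x y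
theorem be_mul (x y : Base n) : V.be (x * y) = V.be y * V.be x := map_mul V.β (op y) (op x)
theorem bh_mul (x y : Base n) : V.bh (x * y) = V.bh y * V.bh x := map_mul V.βh (op y) (op x)
@[simp] theorem al_one : V.al 1 = 1 := map_one V.α
@[simp] theorem be_one : V.be 1 = 1 := map_one V.β
@[simp] theorem bh_one : V.bh 1 = 1 := map_one V.βh
theorem star_al (x : Base n) : star (V.al x) = V.al (star x) := (map_star V.α x).symm
theorem star_be (x : Base n) : star (V.be x) = V.be (star x) := (map_star V.β (op x)).symm
theorem star_bh (x : Base n) : star (V.bh x) = V.bh (star x) := (map_star V.βh (op x)).symm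
theorem be_bh (x y : Base n) : V.be x * V.bh y = V.bh y * V.be x := V.commute_β_βh (op x) (op y)

/-- `x, y ↦ s(x) ⊗ r(y)`. -/
def tensBil (s r : Base n →ₗ[ℂ] Op H) : Base n →ₗ[ℂ] Base n →ₗ[ℂ] Op (Ten H H) :=
  LinearMap.mk₂ ℂ (fun x y => tens (s x) (r y))
    (fun x x' y => by rw [map_add, tens_add_left]) (fun c x y => by rw [map_smul, tens_smul_left])
    (fun x y y' => by rw [map_add, tens_add_right]) fun c x y => by rw [map_smul, tens_smul_right]

theorem initial' : star V.I * V.I = ∑ γ, ∑ i, ∑ j,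
    ((n γ : ℂ)⁻¹) • tens (V.bh (unit n γ i j)) (V.al (unit n γ j i)) := V.initial

theorem final' : V.I * star V.I = ∑ γ, ∑ i, ∑ j,
    ((n γ : ℂ)⁻¹) • tens (V.al (unit n γ i j)) (V.be (unit n γ j i)) := V.final

theorem initial_mul_bh (x : Base n) :
    star V.I * V.I * tens (V.bh x) 1 = star V.I * V.I * tens 1 (V.al x) := by
  rw [initial']
  simp only [Finset.sum_mul, op_smul_mul, tens_mul, ← bh_mul, ← al_mul, mul_one]
  exact sum_mul_unit (tensBil V.bh V.al) x

theorem al_mul_final (x : Base n) :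
    tens (V.al x) 1 * (V.I * star V.I) = tens 1 (V.be x) * (V.I * star V.I) := by
  rw [final']
  simp only [Finset.mul_sum, op_mul_smul, tens_mul, ← be_mul, ← al_mul, one_mul]
  exact sum_mul_unit (tensBil V.al V.be) x

theorem sum_al_mul_al : ∑ γ, ∑ i, ∑ j, ((n γ : ℂ)⁻¹) •
    (V.al (unit n γ i j) * V.al (unit n γ j i)) = 1 := by
  simp only [← al_mul, ← map_smul, ← map_sum, sum_unit_mul_unit, al_one]

theorem sum_be_mul_be : ∑ γ, ∑ i, ∑ j, ((n γ : ℂ)⁻¹) •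
    (V.be (unit n γ i j) * V.be (unit n γ j i)) = 1 := by
  simp only [← be_mul, ← map_smul, ← map_sum, sum_unit_mul_unit', be_one]

theorem sum_bh_mul_bh : ∑ γ, ∑ i, ∑ j, ((n γ : ℂ)⁻¹) •
    (V.bh (unit n γ i j) * V.bh (unit n γ j i)) = 1 := by
  simp only [← bh_mul, ← map_smul, ← map_sum, sum_unit_mul_unit', bh_one]

/-- The support absorbs β̂ on its first leg as α on its second. In the square, all of one factor
ends up on the second leg, where the Casimir sum ∑ n_γ⁻¹ α(e_ij)α(e_ji) equals 1. -/
theorem initial_idem : star V.I * V.I * (star V.I * V.I) = star V.I * V.I := by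
  have h : ∀ γ (i j : Fin (n γ)), star V.I * V.I *
      (((n γ : ℂ)⁻¹) • tens (V.bh (unit n γ i j)) (V.al (unit n γ j i))) =
      star V.I * V.I * tens 1
        (((n γ : ℂ)⁻¹) • (V.al (unit n γ i j) * V.al (unit n γ j i))) := fun γ i j => by
    have h1 : tens (V.bh (unit n γ i j)) (V.al (unit n γ j i)) =
      tens (V.bh (unit n γ i j)) 1 * tens 1 (V.al (unit n γ j i)) := by
        rw [tens_mul, mul_one, one_mul]
    rw [op_mul_smul, h1, ← mul_assoc, initial_mul_bh, mul_assoc, tens_mul, one_mul,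
      tens_smul_right, op_mul_smul]
  conv_lhs => rw [V.initial', ← V.initial']
  conv_lhs => rw [mul_assoc, ← mul_assoc]
  conv_lhs =>
    arg 2
    rw [V.initial']
  simp only [Finset.mul_sum, h]
  simp only [← Finset.mul_sum, ← tens_sum_right, sum_al_mul_al, tens_one, mul_one]

/-- Since p = I*I is idempotent, (Ip − I)*(Ip − I) = 0, and the C*-identity gives Ip = I. -/
theorem I_star_I : V.I * (star V.I * V.I) = V.I := by
  have h : star (V.I * (star V.I * V.I) - V.I) * (V.I * (star V.I * V.I) - V.I) = 0 := by
    have h1 := V.initial_idem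
    have h2 : star (V.I * (star V.I * V.I) - V.I) * (V.I * (star V.I * V.I) - V.I) =
        star V.I * V.I * (star V.I * V.I) * (star V.I * V.I) - star V.I * V.I * (star V.I * V.I)
        - star V.I * V.I * (star V.I * V.I) + star V.I * V.I := by
      simp only [star_sub, star_mul, star_star]; noncomm_ring
    rw [h2, h1, h1]; abel
  exact sub_eq_zero.mp (CStarRing.star_mul_self_eq_zero_iff _ |>.mp h)

theorem star_I_I_star : star V.I * (V.I * star V.I) = star V.I := by
  have := congrArg star V.I_star_I
  simpa [star_mul, mul_assoc] using this

theorem I_bh (x : Base n) : V.I * tens (V.bh x) 1 = V.I * tens 1 (V.al x) := by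
  have h := congrArg (V.I * ·) (V.initial_mul_bh x)
  simp only [← mul_assoc] at h
  have h1 : V.I * star V.I * V.I = V.I := by rw [mul_assoc, V.I_star_I]
  rwa [h1] at h

theorem al_I (x : Base n) : tens (V.al x) 1 * V.I = tens 1 (V.be x) * V.I := by
  have h := congrArg (· * V.I) (V.al_mul_final x)
  simpa only [mul_assoc, V.I_star_I] using h

theorem I_al (x : Base n) : V.I * tens (V.al x) 1 = tens 1 (V.al x) * V.I := by
  have := V.intertwine x 1
  rw [map_one, map_one] at this
  exact this

theorem I_be (y : Base n) : V.I * tens 1 (V.be y) = tens (V.bh y) 1 * V.I := by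
  have := V.intertwine 1 (op y)
  rw [map_one] at this
  exact this

theorem I_comm_be (y : Base n) : V.I * tens (V.be y) 1 = tens (V.be y) 1 * V.I := by
  have := V.commute_I (op y) 1
  rw [map_one] at this
  exact this

theorem I_comm_bh (y : Base n) : V.I * tens 1 (V.bh y) = tens 1 (V.bh y) * V.I := by
  have := V.commute_I 1 (op y)
  rw [map_one] at this
  exact this

/-! #### The two legs of `I` -/

theorem sl_mem_Sh (a b : H) : sl a b V.I ∈ V.Sh :=
  Submodule.subset_span ⟨vf a b, sliceRight_vf a b V.I⟩

theorem lsl_mem_S (a b : H) : lsl a b V.I ∈ V.S :=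
  Submodule.subset_span ⟨vf a b, sliceRight_vf a b _⟩

theorem Sh_induction {p : Op H → Prop} (hs : ∀ a b, p (sl a b V.I)) (hadd : ∀ x y, p x → p y → p (x + y))
    (hsmul : ∀ (c : ℂ) x, p x → p (c • x)) {x : Op H} (hx : x ∈ V.Sh) : p x := by
  have h0 : p 0 := by simpa using hsmul 0 _ (hs 0 0)
  refine Submodule.span_induction ?_ h0 (fun x y _ _ => hadd x y) (fun c x _ => hsmul c x) hx
  rintro _ ⟨ω, rfl⟩
  exact Finset.sum_induction _ p hadd h0 fun i _ =>
    Finset.sum_induction _ p hadd h0 fun j _ => hsmul _ _ (hs _ _)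

theorem S_induction {p : Op H → Prop} (hs : ∀ a b, p (lsl a b V.I)) (hadd : ∀ x y, p x → p y → p (x + y))
    (hsmul : ∀ (c : ℂ) x, p x → p (c • x)) {x : Op H} (hx : x ∈ V.S) : p x := by
  have h0 : p 0 := by simpa using hsmul 0 _ (hs 0 0)
  refine Submodule.span_induction ?_ h0 (fun x y _ _ => hadd x y) (fun c x _ => hsmul c x) hx
  rintro _ ⟨ω, rfl⟩
  have h1 : sliceLeft ω V.I = ∑ i, ∑ j, ω (ketbra i j) •
      lsl (stdOrthonormalBasis ℂ H i) (stdOrthonormalBasis ℂ H j) V.I := by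
    simp only [sliceLeft, sliceRight, entry_eq_sl, lsl_def]
  change p (sliceLeft ω V.I)
  rw [h1]
  exact Finset.sum_induction _ p hadd h0 fun i _ =>
    Finset.sum_induction _ p hadd h0 fun j _ => hsmul _ _ (hs _ _)

theorem S_comm_bh {s : Op H} (hs : s ∈ V.S) (y : Base n) : s * V.bh y = V.bh y * s := by
  refine V.S_induction (p := fun s => s * V.bh y = V.bh y * s) (fun a b => ?_)
    (fun x z hx hz => ?_) (fun c x hx => ?_) hs
  · have := congrArg (lsl a b) (V.I_comm_bh y)
    rw [lsl_tens_right, lsl_tens_left, star_one] at this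
    exact this
  · rw [add_mul, mul_add, hx, hz]
  · rw [op_smul_mul, op_mul_smul, hx]

theorem Sh_comm_be {x : Op H} (hx : x ∈ V.Sh) (y : Base n) : x * V.be y = V.be y * x := by
  refine V.Sh_induction (p := fun x => x * V.be y = V.be y * x) (fun a b => ?_)
    (fun x z hx hz => ?_) (fun c x hx => ?_) hx
  · have := congrArg (sl a b) (V.I_comm_be y)
    rw [sl_tens_right, sl_tens_left, star_one] at this
    exact this
  · rw [add_mul, mul_add, hx, hz]
  · rw [op_smul_mul, op_mul_smul, hx]

theorem bh_mem_centralizer (y : Base n) : V.bh y ∈ Set.centralizer (V.S : Set (Op H)) :=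
  Set.mem_centralizer_iff.mpr fun _ hs => V.S_comm_bh hs y

theorem be_mem_centralizer (y : Base n) : V.be y ∈ Set.centralizer (V.Sh : Set (Op H)) :=
  Set.mem_centralizer_iff.mpr fun _ hs => V.Sh_comm_be hs y

theorem al_mul_lsl (y : Base n) (a b : H) : V.al y * lsl a b V.I = lsl a (V.al y b) V.I := by
  have := congrArg (lsl a b) (V.I_al y)
  rw [lsl_tens_right, lsl_tens_left, star_one, mul_one] at this
  exact this.symm

theorem be_mul_lsl (y : Base n) (a b : H) :
    V.be y * lsl a b V.I = lsl (star (V.al y) a) b V.I := by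
  have := congrArg (lsl a b) (V.al_I y)
  rw [lsl_tens_left, lsl_tens_left, star_one, one_mul] at this
  exact this.symm

theorem bh_mul_sl (y : Base n) (a b : H) : V.bh y * sl a b V.I = sl a (V.be y b) V.I := by
  have := congrArg (sl a b) (V.I_be y)
  rw [sl_tens_right, sl_tens_left, star_one, mul_one] at this
  exact this.symm

theorem al_mul_sl (y : Base n) (a b : H) :
    V.al y * sl a b V.I = sl (star (V.be y) a) b V.I := by
  have := congrArg (sl a b) (V.al_I y)
  rw [sl_tens_left, sl_tens_left, star_one, one_mul] at this
  exact this

/-- The unit is a combination of coefficients of `I`, so c = c · 1 is a combination of elements of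
`S`. -/
theorem mem_S_of_mul {c : Op H} (h1 : 1 ∈ V.S) (h : ∀ a b, c * lsl a b V.I ∈ V.S) : c ∈ V.S := by
  have : c * 1 ∈ V.S := by
    refine V.S_induction (p := fun x => c * x ∈ V.S) h (fun x z hx hz => ?_) (fun k x hx => ?_) h1
    · rw [mul_add]; exact V.S.add_mem hx hz
    · rw [op_mul_smul]; exact V.S.smul_mem _ hx
  rwa [mul_one] at this

theorem mem_Sh_of_mul {c : Op H} (h1 : 1 ∈ V.Sh) (h : ∀ a b, c * sl a b V.I ∈ V.Sh) :
    c ∈ V.Sh := by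
  have : c * 1 ∈ V.Sh := by
    refine V.Sh_induction (p := fun x => c * x ∈ V.Sh) h (fun x z hx hz => ?_) (fun k x hx => ?_) h1
    · rw [mul_add]; exact V.Sh.add_mem hx hz
    · rw [op_mul_smul]; exact V.Sh.smul_mem _ hx
  rwa [mul_one] at this

theorem al_mem_S (h1 : 1 ∈ V.S) (y : Base n) : V.al y ∈ V.S :=
  V.mem_S_of_mul h1 fun a b => by rw [al_mul_lsl]; exact V.lsl_mem_S _ _

theorem be_mem_S (h1 : 1 ∈ V.S) (y : Base n) : V.be y ∈ V.S :=
  V.mem_S_of_mul h1 fun a b => by rw [be_mul_lsl]; exact V.lsl_mem_S _ _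

theorem al_mem_Sh (h1 : 1 ∈ V.Sh) (y : Base n) : V.al y ∈ V.Sh :=
  V.mem_Sh_of_mul h1 fun a b => by rw [al_mul_sl]; exact V.sl_mem_Sh _ _

theorem bh_mem_Sh (h1 : 1 ∈ V.Sh) (y : Base n) : V.bh y ∈ V.Sh :=
  V.mem_Sh_of_mul h1 fun a b => by rw [bh_mul_sl]; exact V.sl_mem_Sh _ _

theorem initial_comm_S {s : Op H} (hs : s ∈ V.S) :
    star V.I * V.I * tens s 1 = tens s 1 * (star V.I * V.I) := by
  rw [initial']
  simp only [Finset.sum_mul, Finset.mul_sum, op_smul_mul, op_mul_smul, tens_mul, mul_one, one_mul,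
    V.S_comm_bh hs]

theorem final_comm_Sh {x : Op H} (hx : x ∈ V.Sh) :
    V.I * star V.I * tens 1 x = tens 1 x * (V.I * star V.I) := by
  rw [final']
  simp only [Finset.sum_mul, Finset.mul_sum, op_smul_mul, op_mul_smul, tens_mul, mul_one, one_mul,
    V.Sh_comm_be hx]

/-! #### The coproducts -/

/-- `Γ` as a linear map. -/
def comulₗ : Op H →ₗ[ℂ] Op (Ten H H) where
  toFun s := V.I * tens s 1 * star V.I
  map_add' x y := by rw [tens_add_left, mul_add, add_mul]
  map_smul' c x := by rw [tens_smul_left, op_mul_smul, op_smul_mul]; rfl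

/-- `Γ̂` as a linear map. -/
def comulHatₗ : Op H →ₗ[ℂ] Op (Ten H H) where
  toFun s := star V.I * tens 1 s * V.I
  map_add' x y := by rw [tens_add_right, mul_add, add_mul]
  map_smul' c x := by rw [tens_smul_right, op_mul_smul, op_smul_mul]; rfl

theorem comulₗ_apply (s : Op H) : V.comulₗ s = V.I * tens s 1 * star V.I := rfl

theorem comulHatₗ_apply (s : Op H) : V.comulHatₗ s = star V.I * tens 1 s * V.I := rfl

variable {ι : Type*} [Fintype ι] (f : OrthonormalBasis ι ℂ H)

theorem sum_sl_tens_sl (a b : H) : ∑ m, tens (sl a (f m) V.I) (sl (f m) b V.I) =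
    sl a b (leg13 V.I * leg23 H V.I) := by
  rw [sl_mul f]
  simp only [sl_leg13, sl_leg23, tens_mul, mul_one, one_mul]

/-- The pentagon equation sliced on its third leg. -/
theorem I_mul_sum_sl (a b : H) : V.I * ∑ m, tens (sl a (f m) V.I) (sl (f m) b V.I) =
    tens 1 (sl a b V.I) * V.I := by
  have := congrArg (sl a b) V.pentagon
  rw [mul_assoc, leg12, sl_tens_left, sl_tens_right, star_one, sl_leg23] at this
  rw [sum_sl_tens_sl]
  exact this

/-- Needed to cancel I*I after multiplying `I_mul_sum_sl` by I*. The factor β̂(y) passes through I₁₃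
and α(z) is absorbed by I₂₃. Both become elements of β(N) on the third leg, between I₁₃ and I₂₃,
where the Casimir sum is 1. -/
theorem initial_mul_sum_sl (a b : H) :
    star V.I * V.I * ∑ m, tens (sl a (f m) V.I) (sl (f m) b V.I) =
      ∑ m, tens (sl a (f m) V.I) (sl (f m) b V.I) := by
  rw [sum_sl_tens_sl]
  have h2 : ∀ (z : Base n) (Y : Op (Ten H H)), tens (tens (1 : Op H) (V.al z)) (1 : Op H) *
      leg13 Y = leg13 Y * tens (tens 1 (V.al z)) 1 := fun z Y => by
    induction Y using tens_induction with
    | tens p q => rw [leg13_tens, tens_mul, tens_mul, tens_mul, tens_mul]; simp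
    | add X Y hX hY => rw [leg13_add, mul_add, add_mul, hX, hY]
  have h : ∀ y z : Base n, tens (V.bh y) (V.al z) * sl a b (leg13 V.I * leg23 H V.I) =
      sl a b (leg13 V.I * tens 1 (V.be y * V.be z) * leg23 H V.I) := fun y z => by
    have h1 : tens (tens (V.bh y) (V.al z)) (1 : Op H) * (leg13 V.I * leg23 H V.I) =
        leg13 (tens (V.bh y) 1 * V.I) * leg23 H (tens (V.al z) 1 * V.I) := by
      rw [leg13_mul, leg23_mul, leg13_tens, leg23_tens]
      have h3 : tens (tens (V.bh y) (V.al z)) (1 : Op H) =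
          tens (tens (V.bh y) 1) 1 * tens (tens 1 (V.al z)) 1 := by
        rw [tens_mul, tens_mul, mul_one, one_mul, one_mul]
      rw [h3]
      simp only [mul_assoc]
      rw [← mul_assoc _ (leg13 V.I) (leg23 H V.I), h2]
      simp only [mul_assoc]
    have h4 := congrArg (sl a b) h1
    rw [sl_tens_left, star_one] at h4
    rw [← V.I_be, V.al_I, leg13_mul, leg23_mul, leg13_tens, leg23_tens, tens_one] at h4
    refine h4.trans (congrArg (sl a b) ?_)
    rw [← mul_one (1 : Op (Ten H H)), ← tens_mul]
    simp only [mul_assoc, mul_one]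
  rw [initial']
  simp only [Finset.sum_mul, op_smul_mul, h]
  have h5 : ∀ (c : ℂ) (t : Op H), c • sl a b (leg13 V.I * tens 1 t * leg23 H V.I) =
      sl a b (leg13 V.I * tens 1 (c • t) * leg23 H V.I) := fun c t => by
    rw [tens_smul_right, op_mul_smul, op_smul_mul, map_smul]
  simp only [h5, ← map_sum, ← Finset.sum_mul, ← Finset.mul_sum, ← tens_sum_right]
  rw [sum_be_mul_be, tens_one, mul_one]

/-- `Γ̂` on the coefficients of `I`. -/
theorem comulHat_sl (a b : H) :
    V.comulHatₗ (sl a b V.I) = ∑ m, tens (sl a (f m) V.I) (sl (f m) b V.I) := by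
  rw [comulHatₗ_apply, mul_assoc, ← V.I_mul_sum_sl f, ← mul_assoc, V.initial_mul_sum_sl f]

theorem I_mul_lsl (a b : H) : V.I * tens (lsl a b V.I) 1 =
    (∑ m, tens (lsl a (f m) V.I) (lsl (f m) b V.I)) * V.I := by
  have := congrArg (sl3 a b) V.pentagon
  rw [sl3_mul_leg23, sl3_leg23_mul, sl3_leg12_leg13 f, sl3_leg12] at this
  exact this.symm

/-- Counterpart of `initial_mul_sum_sl` for the pentagon equation sliced on its first leg: α and β
are turned into β̂ on that leg, where the Casimir sum is again 1. -/
theorem sum_lsl_mul_final (a b : H) :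
    (∑ m, tens (lsl a (f m) V.I) (lsl (f m) b V.I)) * (V.I * star V.I) =
      ∑ m, tens (lsl a (f m) V.I) (lsl (f m) b V.I) := by
  have h : ∀ y z : Base n, (∑ m, tens (lsl a (f m) V.I) (lsl (f m) b V.I)) *
      tens (V.al y) (V.be z) =
      sl3 a b (leg12 V.I * (tens (tens (V.bh y * V.bh z) 1) 1 * leg13 V.I)) :=
    fun y z => by
    have h1 : ∀ m, tens (lsl a (f m) V.I) (lsl (f m) b V.I) * tens (V.al y) (V.be z) =
        tens (lsl a (f m) (V.I * tens (V.bh y) 1)) (lsl (f m) b (tens (V.bh z) 1 * V.I)) :=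
      fun m => by
        rw [V.I_bh, ← V.I_be, lsl_tens_right, lsl_tens_right, tens_mul]
        rfl
    rw [Finset.sum_mul]
    simp only [h1]
    have h2 : tens (tens (V.bh y * V.bh z) (1 : Op H)) (1 : Op H) =
        leg12 (tens (V.bh y) 1) * tens (tens (V.bh z) 1) 1 := by
      rw [leg12, tens_mul, tens_mul, mul_one]
    rw [← sl3_leg12_leg13 f, leg12_mul, leg13_mul, leg13_tens, h2, mul_assoc, mul_assoc]
  have h5 : ∀ (c : ℂ) (t : Op H), c • sl3 a b (leg12 V.I * (tens (tens t 1) 1 * leg13 V.I)) =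
      sl3 a b (leg12 V.I * (tens (tens (c • t) 1) 1 * leg13 V.I)) := fun c t => by
    rw [tens_smul_left, tens_smul_left, op_smul_mul, op_mul_smul, map_smul]
  rw [final']
  simp only [Finset.mul_sum, op_mul_smul, h, h5]
  simp only [← map_sum, ← Finset.sum_mul, ← Finset.mul_sum, ← tens_sum_left]
  rw [sum_bh_mul_bh, tens_one, tens_one, one_mul, sl3_leg12_leg13 f]

/-- `Γ` on the coefficients of `I`. -/
theorem comul_lsl (a b : H) :
    V.comulₗ (lsl a b V.I) = ∑ m, tens (lsl a (f m) V.I) (lsl (f m) b V.I) := by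
  rw [comulₗ_apply, V.I_mul_lsl f, mul_assoc, V.sum_lsl_mul_final f]

end Mpi

/-! ### Conjugate bases, positive tensors and left slices -/

section

variable {H : Type v} [NormedAddCommGroup H] [InnerProductSpace ℂ H]
  [FiniteDimensional ℂ H] [CompleteSpace H]

omit [FiniteDimensional ℂ H] [CompleteSpace H] in
/-- An antiunitary involution maps orthonormal bases to orthonormal bases. -/
theorem exists_conj_basis {J : H ≃ₗᵢ⋆[ℂ] H} (hJ : J.symm = J) {ι : Type*} [Fintype ι]
    (f : OrthonormalBasis ι ℂ H) : ∃ g : OrthonormalBasis ι ℂ H, ∀ m, g m = J (f m) := by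
  classical
  have hon : Orthonormal ℂ fun m => J (f m) := by
    rw [orthonormal_iff_ite]
    intro i j
    rw [inner_antiunitary, orthonormal_iff_ite.mp f.orthonormal]
    exact if_congr eq_comm rfl rfl
  refine ⟨OrthonormalBasis.mk hon ?_, fun m => congrFun (OrthonormalBasis.coe_mk hon _) m⟩
  intro v _
  have h1 : v = J (J v) := by
    conv_rhs => arg 1; rw [← hJ]
    rw [J.symm_apply_apply]
  rw [h1, ← f.sum_repr' (J v), map_sum]
  refine Submodule.sum_mem _ fun m _ => ?_
  rw [LinearIsometryEquiv.map_smulₛₗ]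
  exact Submodule.smul_mem _ _ (Submodule.subset_span ⟨m, rfl⟩)

theorem isPositive_tens {P Q : Op H} (hP : P.IsPositive) (hQ : Q.IsPositive) :
    (tens P Q : Op (Ten H H)).IsPositive := by
  rw [← ContinuousLinearMap.nonneg_iff_isPositive] at hP hQ ⊢
  have h1 : ∀ R : Op H, star (CFC.sqrt R) = CFC.sqrt R := fun R =>
    (IsSelfAdjoint.of_nonneg (CFC.sqrt_nonneg R)).star_eq
  have h2 : tens P Q = star (tens (CFC.sqrt P) (CFC.sqrt Q)) * tens (CFC.sqrt P) (CFC.sqrt Q) := by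
    rw [star_tens, h1, h1, tens_mul, CFC.sqrt_mul_sqrt_self P hP, CFC.sqrt_mul_sqrt_self Q hQ]
  rw [h2]
  exact star_mul_self_nonneg _

theorem op_ext_lsl {X Y : Op (Ten H H)} (h : ∀ ξ η, lsl ξ η X = lsl ξ η Y) : X = Y :=
  op_ext_inner fun k l k' l' => by rw [← inner_lsl, ← inner_lsl, h]

end

/-! ### Modular theory of the two legs of `I` -/

namespace Mpi

variable {G : Type w} [Fintype G] {n : G → ℕ}
variable {H : Type v} [NormedAddCommGroup H] [InnerProductSpace ℂ H]
  [FiniteDimensional ℂ H] [CompleteSpace H] (V : Mpi n H)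

/-- The part of the irreducible form that is used below: the Tomita operators of `(S, e)` and of
`(Ŝ, ê)`, the invariance of the two vectors, and their relative phase. -/
structure Canonical (e eh : H) (J Jh : H ≃ₗᵢ⋆[ℂ] H) (D Di Dh Dhi : Op H) : Prop where
  mS : ModularData V.S e J D Di
  mSh : ModularData V.Sh eh Jh Dh Dhi
  fixed : ∀ η : H, V.I (e ⊗ₜ[ℂ] η) = (V.I * star V.I) (e ⊗ₜ[ℂ] η)
  cofixed : ∀ η : H, V.I (η ⊗ₜ[ℂ] eh) = (V.I * star V.I) (η ⊗ₜ[ℂ] eh)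
  cone : ∃ x ∈ V.S, eh = x (J (x e))

theorem exists_canonical (hreg : V.IsRegular) {e eh : H} {J Jh : H ≃ₗᵢ⋆[ℂ] H}
    (hirr : V.IsIrreducible e eh J Jh) : ∃ D Di Dh Dhi, V.Canonical e eh J Jh D Di Dh Dhi := by
  obtain ⟨D, Di, h1⟩ := exists_modularData hreg.1 hirr.standard hirr.modular
  obtain ⟨Dh, Dhi, h2⟩ := exists_modularData hreg.2 hirr.standardHat hirr.modularHat
  exact ⟨D, Di, Dh, Dhi, h1, h2, hirr.fixed, hirr.cofixed, hirr.cone⟩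

namespace Canonical

variable {V} {e eh : H} {J Jh : H ≃ₗᵢ⋆[ℂ] H} {D Di Dh Dhi : Op H}
  (h : V.Canonical e eh J Jh D Di Dh Dhi)

include h

/-- Fixedness of e means that I* agrees with I*I on e ⊗ η. Since s ⊗ 1 commutes with I*I, the
operator `I` implements `Γ` on the vectors se. -/
theorem comul_fixed {s : Op H} (hs : s ∈ V.S) (η : H) :
    V.I (s e ⊗ₜ[ℂ] η) = V.comulₗ s (e ⊗ₜ[ℂ] η) := by
  have h1 : star V.I (e ⊗ₜ[ℂ] η) = (star V.I * V.I) (e ⊗ₜ[ℂ] η) := by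
    rw [op_mul_apply, h.fixed, ← op_mul_apply, V.star_I_I_star]
  rw [comulₗ_apply, op_mul_apply, h1, ← op_mul_apply, mul_assoc, ← V.initial_comm_S hs,
    ← mul_assoc, V.I_star_I]
  rfl

theorem comulHat_cofixed {x : Op H} (hx : x ∈ V.Sh) (η : H) :
    star V.I (η ⊗ₜ[ℂ] x eh) = V.comulHatₗ x (η ⊗ₜ[ℂ] eh) := by
  rw [comulHatₗ_apply, op_mul_apply, h.cofixed, ← op_mul_apply, mul_assoc, ← V.final_comm_Sh hx,
    ← mul_assoc, V.star_I_I_star]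
  rfl

end Canonical

theorem sl_comul_mem {s : Op H} (hs : s ∈ V.S) (a b : H) : sl a b (V.comulₗ s) ∈ V.S := by
  refine V.S_induction (p := fun s => sl a b (V.comulₗ s) ∈ V.S) (fun c d => ?_)
    (fun x y hx hy => ?_) (fun c x hx => ?_) hs
  · rw [V.comul_lsl (stdOrthonormalBasis ℂ H), map_sum]
    refine V.S.sum_mem fun m _ => ?_
    rw [sl_tens]
    exact V.S.smul_mem _ (V.lsl_mem_S _ _)
  · rw [map_add, map_add]; exact V.S.add_mem hx hy
  · rw [map_smul, map_smul]; exact V.S.smul_mem _ hx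

theorem lsl_comulHat_mem {x : Op H} (hx : x ∈ V.Sh) (a b : H) :
    lsl a b (V.comulHatₗ x) ∈ V.Sh := by
  refine V.Sh_induction (p := fun x => lsl a b (V.comulHatₗ x) ∈ V.Sh) (fun c d => ?_)
    (fun x y hx hy => ?_) (fun c x hx => ?_) hx
  · rw [V.comulHat_sl (stdOrthonormalBasis ℂ H), map_sum]
    refine V.Sh.sum_mem fun m _ => ?_
    rw [lsl_tens]
    exact V.Sh.smul_mem _ (V.sl_mem_Sh _ _)
  · rw [map_add, map_add]; exact V.Sh.add_mem hx hy
  · rw [map_smul, map_smul]; exact V.Sh.smul_mem _ hx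

theorem sl_comulHat_mem {x : Op H} (hx : x ∈ V.Sh) (a b : H) :
    sl a b (V.comulHatₗ x) ∈ V.Sh := by
  refine V.Sh_induction (p := fun x => sl a b (V.comulHatₗ x) ∈ V.Sh) (fun c d => ?_)
    (fun x y hx hy => ?_) (fun c x hx => ?_) hx
  · rw [V.comulHat_sl (stdOrthonormalBasis ℂ H), map_sum]
    refine V.Sh.sum_mem fun m _ => ?_
    rw [sl_tens]
    exact V.Sh.smul_mem _ (V.sl_mem_Sh _ _)
  · rw [map_add, map_add]; exact V.Sh.add_mem hx hy
  · rw [map_smul, map_smul]; exact V.Sh.smul_mem _ hx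

theorem star_comul (s : Op H) : star (V.comulₗ s) = V.comulₗ (star s) := by
  rw [comulₗ_apply, comulₗ_apply, star_mul, star_mul, star_star, star_tens, star_one, mul_assoc]

theorem star_comulHat (x : Op H) : star (V.comulHatₗ x) = V.comulHatₗ (star x) := by
  rw [comulHatₗ_apply, comulHatₗ_apply, star_mul, star_mul, star_star, star_tens, star_one,
    mul_assoc]

theorem comulHat_mul {x y : Op H} (hx : x ∈ V.Sh) :
    V.comulHatₗ (x * y) = V.comulHatₗ x * V.comulHatₗ y := by
  have h1 : tens (1 : Op H) (x * y) = tens 1 x * tens 1 y := by rw [tens_mul, one_mul]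
  have h2 : V.comulHatₗ x * V.comulHatₗ y =
      star V.I * (tens 1 x * (V.I * star V.I)) * tens 1 y * V.I := by
    simp only [comulHatₗ_apply, mul_assoc]
  rw [h2, ← V.final_comm_Sh hx, ← mul_assoc (star V.I), V.star_I_I_star, comulHatₗ_apply, h1]
  simp only [mul_assoc]

theorem comulHat_mul_initial {x : Op H} : V.comulHatₗ x * (star V.I * V.I) = V.comulHatₗ x := by
  rw [comulHatₗ_apply, mul_assoc, V.I_star_I]

namespace Canonical

variable {V} {e eh : H} {J Jh : H ≃ₗᵢ⋆[ℂ] H} {D Di Dh Dhi : Op H}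
  (h : V.Canonical e eh J Jh D Di Dh Dhi)

include h

/-- By `comul_fixed` the slice (i ⊗ ω_{ab})(I) maps se to (i ⊗ ω_{ab})(Γ(s))e, and JD takes adjoints
in `S`. As `Γ` preserves adjoints, the indices a and b are exchanged. -/
theorem conj_sl (a b v : H) : J (D (sl a b V.I v)) = sl b a V.I (J (D v)) := by
  obtain ⟨s, hs, rfl⟩ := h.mS.cyclic v
  have h1 : ∀ s ∈ V.S, ∀ a b : H, sl a b V.I (s e) = sl a b (V.comulₗ s) e := fun s hs a b => by
    rw [sl_apply, sl_apply, h.comul_fixed hs]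
  rw [h1 s hs, h.mS.conj _ (V.sl_comul_mem hs a b), h.mS.conj s hs, h1 _ (h.mS.star_mem s hs),
    star_sl, star_comul]

/-- Dual form of `conj_sl`: I* implements `Γ̂` on the vectors xê, so the Tomita operator of (Ŝ, ê)
exchanges the indices of the slices of I* on the first leg. -/
theorem conj_lsl (a b v : H) :
    Jh (Dh (star (lsl b a V.I) v)) = star (lsl a b V.I) (Jh (Dh v)) := by
  obtain ⟨x, hx, rfl⟩ := h.mSh.cyclic v
  have h1 : ∀ x ∈ V.Sh, ∀ a b : H, star (lsl b a V.I) (x eh) = lsl a b (V.comulHatₗ x) eh :=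
    fun x hx a b => by
      rw [star_lsl]
      refine ext_inner_left ℂ fun c => ?_
      rw [inner_lsl, inner_lsl, h.comulHat_cofixed hx]
  rw [h1 x hx, h.mSh.conj _ (V.lsl_comulHat_mem hx a b), h.mSh.conj x hx,
    h1 _ (h.mSh.star_mem x hx), star_lsl, star_comulHat]

theorem inner_I_conj_left (ξ a η b : H) : ⟪ξ ⊗ₜ[ℂ] a, star V.I (η ⊗ₜ[ℂ] Jh (Dh b))⟫_ℂ =
    ⟪ξ ⊗ₜ[ℂ] b, V.I (η ⊗ₜ[ℂ] Dh (Jh a))⟫_ℂ := by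
  rw [← inner_lsl, ← inner_lsl, ← star_lsl, ← h.conj_lsl η ξ, h.mSh.inner_J_right,
    ← h.mSh.inner_D, inner_star_left]

theorem inner_I_conj_right (a η b ξ : H) : ⟪a ⊗ₜ[ℂ] η, V.I (J (D b) ⊗ₜ[ℂ] ξ)⟫_ℂ =
    ⟪b ⊗ₜ[ℂ] η, star V.I (D (J a) ⊗ₜ[ℂ] ξ)⟫_ℂ := by
  rw [← inner_sl, ← inner_sl, ← star_sl, ← h.conj_sl ξ η, h.mS.inner_J_right,
    ← h.mS.inner_D, inner_star_right]

theorem inner_I_DJ (ξ b c a : H) : ⟪ξ ⊗ₜ[ℂ] b, V.I (D (J c) ⊗ₜ[ℂ] Dh (Jh a))⟫_ℂ =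
    ⟪c ⊗ₜ[ℂ] a, V.I (J (D ξ) ⊗ₜ[ℂ] Jh (Dh b))⟫_ℂ := by
  rw [← h.inner_I_conj_left, ← h.inner_I_conj_right]

theorem inner_Di_I_D (ξ b c a : H) :
    ⟪ξ ⊗ₜ[ℂ] b, (tens Di Dhi * V.I * tens D Dh) (J c ⊗ₜ[ℂ] Jh a)⟫_ℂ =
      ⟪c ⊗ₜ[ℂ] a, V.I (J ξ ⊗ₜ[ℂ] Jh b)⟫_ℂ := by
  have h1 : star (tens Di Dhi) = tens Di Dhi := by rw [star_tens, h.mS.star_Di, h.mSh.star_Di]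
  have h2 := h.inner_I_DJ (Di ξ) (Dhi b) c a
  rw [h.mS.D_Di, h.mSh.D_Di] at h2
  rw [op_mul_apply, op_mul_apply, ← inner_star_left, h1, tens_tmul, tens_tmul, h2]

theorem commute_D_I : Commute (tens D Dh) V.I := by
  refine commute_of_commute_mul_self (isPositive_tens h.mS.pos h.mSh.pos) ?_
  -- `inner_Di_I_D` identifies conjugation by D ⊗ D̂ with an involutive transformation of `I`. Used
  -- twice, it shows that conjugation by (D ⊗ D̂)² fixes `I`. The positive root D ⊗ D̂ then commutes
  -- with `I`.
  have h1 : tens Di Dhi * (tens Di Dhi * V.I * tens D Dh) * tens D Dh = V.I := by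
    refine op_ext_inner fun ξ b c a => ?_
    have h1 : star (tens Di Dhi) = tens Di Dhi := by rw [star_tens, h.mS.star_Di, h.mSh.star_Di]
    have h2 := h.inner_Di_I_D (Di ξ) (Dhi b) (J (D c)) (Jh (Dh a))
    have h3 := h.inner_Di_I_D (J c) (Jh a) ξ b
    rw [op_mul_apply, op_mul_apply, ← inner_star_left, h1, tens_tmul, tens_tmul, h.mS.J_J,
      h.mSh.J_J] at h3
    rw [h.mS.J_J, h.mSh.J_J, h.mS.J_D, h.mSh.J_D, ← h.mS.D_J, ← h.mSh.D_J, h3] at h2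
    rw [op_mul_apply, op_mul_apply, ← inner_star_left, h1, tens_tmul, tens_tmul, h2]
  have h2 : tens D Dh * tens Di Dhi = 1 := by
    rw [tens_mul, h.mS.inv_right, h.mSh.inv_right, tens_one]
  change tens D Dh * tens D Dh * V.I = V.I * (tens D Dh * tens D Dh)
  conv_lhs => rw [← h1]
  calc tens D Dh * tens D Dh * (tens Di Dhi * (tens Di Dhi * V.I * tens D Dh) * tens D Dh)
      = tens D Dh * (tens D Dh * tens Di Dhi) * tens Di Dhi * V.I * tens D Dh * tens D Dh := by
        simp only [mul_assoc]
    _ = V.I * (tens D Dh * tens D Dh) := by rw [h2, mul_one, h2, one_mul, mul_assoc]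

/-- The identity (J ⊗ Ĵ)I(J ⊗ Ĵ) = I*, in terms of matrix coefficients so that no antilinear tensor
product is needed. -/
theorem inner_I_J (c a ξ b : H) : ⟪c ⊗ₜ[ℂ] a, V.I (J ξ ⊗ₜ[ℂ] Jh b)⟫_ℂ =
    ⟪ξ ⊗ₜ[ℂ] b, V.I (J c ⊗ₜ[ℂ] Jh a)⟫_ℂ := by
  rw [← h.inner_Di_I_D, mul_assoc, ← h.commute_D_I.eq, ← mul_assoc, tens_mul, h.mS.inv_left,
    h.mSh.inv_left, tens_one, one_mul]

theorem cj_sl (a b : H) : cj J (sl a b V.I) = star (sl (Jh b) (Jh a) V.I) := by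
  refine op_eq_of_inner fun c ξ => ?_
  rw [cj_apply, h.mS.symm_eq, h.mS.inner_J_right, inner_star_right,
    ← inner_conj_symm (sl a b V.I (J ξ)) (J c), inner_sl,
    ← inner_conj_symm (sl (Jh b) (Jh a) V.I c) ξ, inner_sl]
  have := h.inner_I_J (J c) a ξ (Jh b)
  rw [h.mSh.J_J, h.mS.J_J] at this
  rw [this]

theorem cj_lsl (a b : H) : cj Jh (lsl a b V.I) = star (lsl (J b) (J a) V.I) := by
  refine op_eq_of_inner fun c ξ => ?_
  rw [cj_apply, h.mSh.symm_eq, h.mSh.inner_J_right, inner_star_right,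
    ← inner_conj_symm (lsl a b V.I (Jh ξ)) (Jh c), inner_lsl,
    ← inner_conj_symm (lsl (J b) (J a) V.I c) ξ, inner_lsl]
  have := h.inner_I_J a (Jh c) (J b) ξ
  rw [h.mSh.J_J, h.mS.J_J] at this
  rw [this]

theorem cj_mem_Sh {x : Op H} (hx : x ∈ V.Sh) : cj J x ∈ V.Sh := by
  refine V.Sh_induction (p := fun x => cj J x ∈ V.Sh) (fun a b => ?_)
    (fun x y hx hy => ?_) (fun c x hx => ?_) hx
  · rw [h.cj_sl]
    exact h.mSh.star_mem _ (V.sl_mem_Sh _ _)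
  · have : cj J (x + y) = cj J x + cj J y := by
      ext v; simp [cj_apply]
    rw [this]; exact V.Sh.add_mem hx hy
  · have : cj J (c • x) = (starRingEnd ℂ) c • cj J x := by
      ext v; simp [cj_apply, LinearIsometryEquiv.map_smulₛₗ]
    rw [this]; exact V.Sh.smul_mem _ hx

theorem cj_mem_S {x : Op H} (hx : x ∈ V.S) : cj Jh x ∈ V.S := by
  refine V.S_induction (p := fun x => cj Jh x ∈ V.S) (fun a b => ?_)
    (fun x y hx hy => ?_) (fun c x hx => ?_) hx
  · rw [h.cj_lsl]
    exact h.mS.star_mem _ (V.lsl_mem_S _ _)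
  · have : cj Jh (x + y) = cj Jh x + cj Jh y := by
      ext v; simp [cj_apply]
    rw [this]; exact V.S.add_mem hx hy
  · have : cj Jh (c • x) = (starRingEnd ℂ) c • cj Jh x := by
      ext v; simp [cj_apply, LinearIsometryEquiv.map_smulₛₗ]
    rw [this]; exact V.S.smul_mem _ hx

end Canonical

end Mpi

theorem ext_inner_tmul {K : Type u} [NormedAddCommGroup K] [InnerProductSpace ℂ K] {H : Type v}
    [NormedAddCommGroup H] [InnerProductSpace ℂ H] {x y : Ten K H}
    (hxy : ∀ k l, ⟪k ⊗ₜ[ℂ] l, x⟫_ℂ = ⟪k ⊗ₜ[ℂ] l, y⟫_ℂ) : x = y := by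
  refine ext_inner_left ℂ fun v => ?_
  induction v using TensorProduct.induction_on with
  | zero => rw [inner_zero_left, inner_zero_left]
  | tmul k l => exact hxy k l
  | add v w hv hw => rw [inner_add_left, inner_add_left, hv, hw]

/-! ### Antipodes, conjugations of the base and the unitary `U` -/

namespace Mpi

variable {G : Type w} [Fintype G] {n : G → ℕ}
variable {H : Type v} [NormedAddCommGroup H] [InnerProductSpace ℂ H]
  [FiniteDimensional ℂ H] [CompleteSpace H] (V : Mpi n H)

theorem exists_slice_of_mem_Sh {x : Op H} (hx : x ∈ V.Sh) :
    ∃ ω : Module.Dual ℂ (Op H), sliceRight ω V.I = x := by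
  refine Submodule.span_induction (p := fun x _ => ∃ ω : Module.Dual ℂ (Op H), sliceRight ω V.I = x)
    (fun _ hω => hω) ⟨0, by simp [sliceRight]⟩ ?_ ?_ hx
  · rintro _ _ _ _ ⟨ω, rfl⟩ ⟨ω', rfl⟩
    exact ⟨ω + ω', by simp only [sliceRight, LinearMap.add_apply, add_smul, Finset.sum_add_distrib]⟩
  · rintro c _ _ ⟨ω, rfl⟩
    exact ⟨c • ω, by simp only [sliceRight, LinearMap.smul_apply, smul_assoc, Finset.smul_sum]⟩

theorem exists_slice_of_mem_S {x : Op H} (hx : x ∈ V.S) :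
    ∃ ω : Module.Dual ℂ (Op H), sliceLeft ω V.I = x := by
  refine Submodule.span_induction (p := fun x _ => ∃ ω : Module.Dual ℂ (Op H), sliceLeft ω V.I = x)
    (fun _ hω => hω) ⟨0, by simp [sliceLeft, sliceRight]⟩ ?_ ?_ hx
  · rintro _ _ _ _ ⟨ω, rfl⟩ ⟨ω', rfl⟩
    exact ⟨ω + ω', by
      simp only [sliceLeft, sliceRight, LinearMap.add_apply, add_smul, Finset.sum_add_distrib]⟩
  · rintro c _ _ ⟨ω, rfl⟩
    exact ⟨c • ω, by
      simp only [sliceLeft, sliceRight, LinearMap.smul_apply, smul_assoc, Finset.smul_sum]⟩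

omit [CompleteSpace H] in
theorem sliceRight_eq (ω : Module.Dual ℂ (Op H)) (X : Op (Ten H H)) :
    sliceRight ω X = ∑ i, ∑ j, ω (ketbra i j) •
      sl (stdOrthonormalBasis ℂ H i) (stdOrthonormalBasis ℂ H j) X := by
  simp only [sliceRight, entry_eq_sl]

omit [CompleteSpace H] in
theorem sliceLeft_eq (ω : Module.Dual ℂ (Op H)) (X : Op (Ten H H)) :
    sliceLeft ω X = ∑ i, ∑ j, ω (ketbra i j) •
      lsl (stdOrthonormalBasis ℂ H i) (stdOrthonormalBasis ℂ H j) X := by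
  simp only [sliceLeft, sliceRight, entry_eq_sl, lsl_def]

/-- The map `U = J Ĵ`. -/
def uOp (J Jh : H ≃ₗᵢ⋆[ℂ] H) : Op H := (Jh.trans J).toContinuousLinearEquiv.toContinuousLinearMap

omit [FiniteDimensional ℂ H] [CompleteSpace H] in
theorem uOp_apply (J Jh : H ≃ₗᵢ⋆[ℂ] H) (v : H) : uOp J Jh v = J (Jh v) := rfl

theorem tilde_eq (J Jh : H ≃ₗᵢ⋆[ℂ] H) : V.tilde J Jh =
    flip H * (tens 1 (uOp J Jh) * V.I * tens 1 (uOp J Jh)) * flip H := by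
  simp only [tilde, mul_assoc]
  rfl

namespace Canonical

variable {V} {e eh : H} {J Jh : H ≃ₗᵢ⋆[ℂ] H} {D Di Dh Dhi : Op H}
  (h : V.Canonical e eh J Jh D Di Dh Dhi)

include h

/-- With F̂ the Tomita operator of (Ŝ, ê), κ(x) = F̂x*F̂. The right side depends only on x, so the
form chosen in the definition of the antipode is irrelevant. -/
theorem antipode_apply {x : Op H} (hx : x ∈ V.S) (v : H) :
    V.antipode x v = Jh (Dh (star x (Jh (Dh v)))) := by
  have h1 : ∀ a b : H, lsl a b (star V.I) v = Jh (Dh (star (lsl a b V.I) (Jh (Dh v)))) :=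
    fun a b => by rw [h.conj_lsl, h.mSh.conj_conj, star_lsl]
  have h2 := V.exists_slice_of_mem_S hx
  rw [antipode, dif_pos h2]
  conv_rhs => rw [← h2.choose_spec]
  rw [sliceLeft_eq, sliceLeft_eq]
  simp [h1, star_sum, LinearIsometryEquiv.map_smulₛₗ]

/-- By `conj_sl`, conjugation by the Tomita operator of (S, e) exchanges the indices of a slice of
`I`, and the adjoint then yields the slice of I* with the original indices. Again the choice of the
form does not matter. -/
theorem antipodeHat_eq {x : Op H} (hx : x ∈ V.Sh) :
    V.antipodeHat x = star (cj J (D * x * Di)) := by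
  have h1 : ∀ a b : H, sl a b (star V.I) = star (cj J (D * sl a b V.I * Di)) := fun a b => by
    rw [← star_sl]
    congr 1
    ext v
    rw [cj_apply, op_mul_apply, op_mul_apply, h.mS.J_Di, h.conj_sl, h.mS.conj_conj]
  have h2 := V.exists_slice_of_mem_Sh hx
  rw [antipodeHat, dif_pos h2]
  conv_rhs => rw [← h2.choose_spec]
  rw [sliceRight_eq, sliceRight_eq]
  have h3 : ∀ x y, star (cj J (D * (x + y) * Di)) =
      star (cj J (D * x * Di)) + star (cj J (D * y * Di)) := fun x y => by
    rw [← star_add]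
    congr 1
    ext v
    simp [cj_apply, mul_add, add_mul]
  have h4 : ∀ (c : ℂ) x, star (cj J (D * (c • x) * Di)) = c • star (cj J (D * x * Di)) :=
    fun c x => by
      rw [← star_star (c • star _), star_smul]
      congr 1
      ext v
      simp [cj_apply, LinearIsometryEquiv.map_smulₛₗ]
  let F : Op H →ₗ[ℂ] Op H :=
    { toFun := fun x => star (cj J (D * x * Di)), map_add' := h3, map_smul' := h4 }
  change _ = F _
  simp only [map_sum, map_smul]
  refine Finset.sum_congr rfl fun i _ => Finset.sum_congr rfl fun j _ => ?_
  rw [h1]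
  rfl

theorem antipode_one : V.antipode 1 = 1 := by
  ext v
  rw [h.antipode_apply h.mS.one_mem, star_one]
  exact h.mSh.conj_conj v

theorem eq_zero_of_I {ζ : H} (h0 : ∀ η, V.I (ζ ⊗ₜ[ℂ] η) = 0) : ζ = 0 := by
  have : (1 : Op H) ζ = 0 := V.Sh_induction (p := fun x => x ζ = 0)
    (fun a b => by rw [sl_apply, h0, map_zero])
    (fun x y hx hy => by rw [add_apply, hx, hy, add_zero])
    (fun c x hx => by rw [smul_apply, hx, smul_zero]) h.mSh.one_mem
  exact this

theorem eq_zero_of_star_I {ζ : H} (h0 : ∀ η, star V.I (η ⊗ₜ[ℂ] ζ) = 0) : ζ = 0 := by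
  have : star (star (1 : Op H)) ζ = 0 := V.S_induction (p := fun x => star x ζ = 0)
    (fun a b => by
      rw [star_lsl]
      refine ext_inner_left ℂ fun c => ?_
      rw [inner_lsl, h0, inner_zero_right, inner_zero_right])
    (fun x y hx hy => by rw [star_add, add_apply, hx, hy, add_zero])
    (fun c x hx => by rw [star_smul, smul_apply, hx, smul_zero]) (h.mS.star_mem _ h.mS.one_mem)
  rwa [star_one, star_one] at this

/-- Vectors ζ are detected by I(ζ ⊗ η), since 1 is a combination of slices of `I`. On α(y)e ⊗ η this
gives (1 ⊗ α(y))I(e ⊗ η), on β̂(y)e ⊗ η it gives I(e ⊗ α(y)η). They agree because on e ⊗ η the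
operator `I` is its final projection, which commutes with 1 ⊗ α(y). -/
theorem al_e (y : Base n) : V.al y e = V.bh y e := by
  refine sub_eq_zero.mp (h.eq_zero_of_I fun η => ?_)
  have h1 : ∀ x : Op H, V.I (x e ⊗ₜ[ℂ] η) = (V.I * tens x (1 : Op H)) (e ⊗ₜ[ℂ] η) := fun x => rfl
  have h2 : (V.I * star V.I) * tens 1 (V.al y) = tens 1 (V.al y) * (V.I * star V.I) :=
    V.final_comm_Sh (V.al_mem_Sh h.mSh.one_mem y)
  rw [TensorProduct.sub_tmul, map_sub, h1, h1, V.I_al, V.I_bh, op_mul_apply, h.fixed,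
    ← op_mul_apply, ← h2]
  exact sub_eq_zero.mpr (h.fixed (V.al y η)).symm

theorem al_eh (y : Base n) : V.al y eh = V.be y eh := by
  refine sub_eq_zero.mp (h.eq_zero_of_star_I fun η => ?_)
  have h1 : ∀ x : Op H, star V.I (η ⊗ₜ[ℂ] x eh) = (star V.I * tens (1 : Op H) x) (η ⊗ₜ[ℂ] eh) :=
    fun x => rfl
  have h2 := V.initial_comm_S (V.al_mem_S h.mS.one_mem y)
  have h3 : star V.I * tens 1 (V.al y) = tens (V.al y) 1 * star V.I := by
    have := congrArg star (V.I_al (star y))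
    rwa [star_mul, star_mul, star_tens, star_tens, star_al, star_star, star_one, eq_comm] at this
  have h4 : star V.I * tens 1 (V.be y) = star V.I * tens (V.al y) 1 := by
    have := congrArg star (V.al_I (star y))
    rwa [star_mul, star_mul, star_tens, star_tens, star_al, star_be, star_star, star_one,
      eq_comm] at this
  have h5 : star V.I (V.al y η ⊗ₜ[ℂ] eh) = (star V.I * V.I) (V.al y η ⊗ₜ[ℂ] eh) := by
    rw [op_mul_apply, h.cofixed, ← op_mul_apply, V.star_I_I_star]
  have h6 : star V.I (η ⊗ₜ[ℂ] eh) = (star V.I * V.I) (η ⊗ₜ[ℂ] eh) := by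
    rw [op_mul_apply, h.cofixed, ← op_mul_apply, V.star_I_I_star]
  rw [TensorProduct.tmul_sub, map_sub, h1, h1, h3, h4, op_mul_apply, op_mul_apply, h6,
    ← op_mul_apply, ← h2, tens_tmul, op_mul_apply, tens_tmul]
  exact sub_eq_zero.mpr h5.symm

theorem cj_al (y : Base n) : cj J (V.al y) = star (V.bh y) :=
  h.mS.cj_eq_star (V.al_mem_S h.mS.one_mem y) (V.bh_mem_centralizer y) (h.al_e y)
    (by rw [star_al, star_bh, h.al_e])

theorem cj_hat_al (y : Base n) : cj Jh (V.al y) = star (V.be y) :=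
  h.mSh.cj_eq_star (V.al_mem_Sh h.mSh.one_mem y) (V.be_mem_centralizer y) (h.al_eh y)
    (by rw [star_al, star_be, h.al_eh])

theorem cj_cj_be (y : Base n) : cj J (cj Jh (V.be y)) = V.bh y := by
  have h1 := h.cj_hat_al (star y)
  rw [star_be, star_star] at h1
  rw [← h1, h.mSh.cj_cj, h.cj_al, star_bh, star_star]

theorem antipodeHat_al (y : Base n) : V.antipodeHat (V.al y) = V.bh y := by
  rw [h.antipodeHat_eq (V.al_mem_Sh h.mSh.one_mem y),
    h.mS.cj_D_eq_star (V.al_mem_S h.mS.one_mem y) (V.bh_mem_centralizer y)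
      (by rw [star_al, star_bh, h.al_e]), star_star]

/-- Writing ê = x(JxJ)e, the two factors commute because JxJ lies in S'. Applying J interchanges
them, so ê is fixed. Here the choice of phase of ê enters. -/
theorem J_eh : J eh = eh := by
  obtain ⟨x, hx, h1⟩ := h.cone
  have h2 := Set.mem_centralizer_iff.mp (h.mS.cj_mem_centralizer hx) x hx
  have h3 : ∀ v, cj J x v = J (x (J v)) := fun v => by rw [cj_apply, h.mS.symm_eq]
  have h4 := congrArg (fun T : Op H => T e) h2
  simp only [op_mul_apply, h3, h.mS.J_e] at h4
  rw [h1]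
  exact h4.symm

theorem J_Jh (v : H) : J (Jh v) = Jh (J v) :=
  h.mSh.commute_J h.mS.symm_eq (fun _ hx => h.cj_mem_Sh hx) h.J_eh v

theorem uOp_mul_uOp : uOp J Jh * uOp J Jh = 1 := by
  ext v
  rw [op_mul_apply, uOp_apply, uOp_apply, ← h.J_Jh, h.mS.J_J, h.mSh.J_J]
  rfl

theorem star_uOp : star (uOp J Jh) = uOp J Jh := by
  refine op_eq_of_inner fun a b => ?_
  rw [inner_star_right, uOp_apply, uOp_apply, h.mS.inner_J_left, h.mSh.inner_J_right, h.J_Jh]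

theorem uOp_conj (x : Op H) : uOp J Jh * x * uOp J Jh = cj J (cj Jh x) := by
  ext v
  rw [op_mul_apply, op_mul_apply, uOp_apply, uOp_apply, cj_apply, cj_apply, h.mS.symm_eq,
    h.mSh.symm_eq, h.J_Jh v]

/-! #### The operator `Ĩ` -/

theorem uOp_conj_mem {s : Op H} (hs : s ∈ V.S) :
    uOp J Jh * s * uOp J Jh ∈ Set.centralizer (V.S : Set (Op H)) := by
  rw [h.uOp_conj]
  exact h.mS.cj_mem_centralizer (h.cj_mem_S hs)

theorem exists_uOp_conj {c : Op H} (hc : c ∈ Set.centralizer (V.S : Set (Op H))) :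
    ∃ s ∈ V.S, uOp J Jh * s * uOp J Jh = c :=
  ⟨_, h.cj_mem_S (h.mS.cj_mem hc), by rw [h.uOp_conj, h.mSh.cj_cj, h.mS.cj_cj]⟩

omit h in
theorem sl_tilde (a b : H) : sl a b (V.tilde J Jh) = uOp J Jh * lsl a b V.I * uOp J Jh := by
  rw [tilde_eq, ← lsl_def, lsl_tens_right, lsl_tens_left, star_one]
  rfl

theorem sl_tilde_mem (a b : H) :
    sl a b (V.tilde J Jh) ∈ Set.centralizer (V.S : Set (Op H)) := by
  rw [sl_tilde]
  exact h.uOp_conj_mem (V.lsl_mem_S a b)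

theorem tilde_comm {s : Op H} (hs : s ∈ V.S) :
    V.tilde J Jh * tens s 1 = tens s 1 * V.tilde J Jh := by
  refine op_ext_sl fun a b => ?_
  rw [sl_tens_right, sl_tens_left, star_one]
  exact (Set.mem_centralizer_iff.mp (h.sl_tilde_mem a b) s hs).symm

theorem star_tilde : star (V.tilde J Jh) =
    flip H * (tens 1 (uOp J Jh) * star V.I * tens 1 (uOp J Jh)) * flip H := by
  rw [tilde_eq, star_flip_conj, star_mul, star_mul, star_tens, h.star_uOp, star_one, mul_assoc (tens 1 (uOp J Jh))]

/-- Conjugation by U carries β to β̂, so II* = e_{α,β} becomes e_{α,β̂}, and the flip turns this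
into e_{β̂,α} = I*I. -/
theorem tilde_mul_star : V.tilde J Jh * star (V.tilde J Jh) = star V.I * V.I := by
  have h1 : tens (1 : Op H) (uOp J Jh) * tens 1 (uOp J Jh) = 1 := by
    rw [tens_mul, h.uOp_mul_uOp, one_mul, tens_one]
  rw [h.star_tilde, tilde_eq, ← flip_conj_mul]
  have h2 : tens 1 (uOp J Jh) * V.I * tens 1 (uOp J Jh) *
      (tens 1 (uOp J Jh) * star V.I * tens 1 (uOp J Jh)) =
      tens 1 (uOp J Jh) * (V.I * star V.I) * tens 1 (uOp J Jh) := by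
    calc _ = tens 1 (uOp J Jh) * V.I * (tens 1 (uOp J Jh) * tens 1 (uOp J Jh)) * star V.I *
          tens 1 (uOp J Jh) := by simp only [mul_assoc]
      _ = _ := by rw [h1, mul_one]; simp only [mul_assoc]
  rw [h2, V.final', V.initial']
  simp only [Finset.mul_sum, Finset.sum_mul, op_mul_smul, op_smul_mul, tens_mul, one_mul, mul_one,
    flip_tens_flip, h.uOp_conj, h.cj_cj_be]
  exact Finset.sum_congr rfl fun γ _ => Finset.sum_comm

/-- Conjugation by J reverses the legs of `Γ̂`: it is the adjoint combined with an exchange of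
indices, which transposes the matrix coproduct. -/
theorem comulHat_cj_sl {ι : Type*} [Fintype ι] (f : OrthonormalBasis ι ℂ H) (a b : H) :
    V.comulHatₗ (cj J (sl a b V.I)) =
      ∑ m, tens (cj J (sl (f m) b V.I)) (cj J (sl a (f m) V.I)) := by
  obtain ⟨g, hg⟩ := exists_conj_basis h.mSh.symm_eq f
  rw [h.cj_sl, ← star_comulHat, V.comulHat_sl g, star_sum]
  refine Finset.sum_congr rfl fun m _ => ?_
  rw [star_tens, hg, h.cj_sl, h.cj_sl]

/-- A slice of `Ĩ` has the form J(ĴsĴ)J with s a slice of `I` on its first leg, and ĴsĴ is the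
adjoint of such a slice. By cofixedness this adjoint acts on Ŝê through the first leg of `Γ̂`. The
outer conjugations by J reverse the legs of `Γ̂`, which gives the slice on the second leg. -/
theorem tilde_eh {x : Op H} (hx : x ∈ V.Sh) (η : H) :
    V.tilde J Jh (x eh ⊗ₜ[ℂ] η) = V.comulHatₗ x (eh ⊗ₜ[ℂ] η) := by
  refine V.Sh_induction
    (p := fun x => V.tilde J Jh (x eh ⊗ₜ[ℂ] η) = V.comulHatₗ x (eh ⊗ₜ[ℂ] η)) (fun a b => ?_)
    (fun x y hx hy => ?_) (fun c x hx => ?_) hx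
  · let f := stdOrthonormalBasis ℂ H
    have h1 : ∀ d : H, cj J (star (lsl (J η) (J d) V.I)) (sl a b V.I eh) =
        sl d η (V.comulHatₗ (sl a b V.I)) eh := fun d => by
      have h2 : star (lsl (J η) (J d) V.I) (cj J (sl a b V.I) eh) =
          lsl (J d) (J η) (V.comulHatₗ (cj J (sl a b V.I))) eh := by
        rw [star_lsl]
        refine ext_inner_left ℂ fun c => ?_
        rw [inner_lsl, inner_lsl, h.comulHat_cofixed (h.cj_mem_Sh (V.sl_mem_Sh a b))]
      have h3 : cj J (sl a b V.I) eh = J (sl a b V.I eh) := by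
        rw [cj_apply, h.mS.symm_eq, h.J_eh]
      rw [cj_apply, h.mS.symm_eq, ← h3, h2, h.comulHat_cj_sl f, V.comulHat_sl f, map_sum, map_sum,
        sum_apply, sum_apply, map_sum]
      refine Finset.sum_congr rfl fun m _ => ?_
      rw [lsl_tens, sl_tens, smul_apply, smul_apply, LinearIsometryEquiv.map_smulₛₗ, cj_apply,
        cj_apply, h.mS.symm_eq, h.mS.J_J, h.J_eh, h.mS.J_J, inner_antiunitary]
      congr 1
      exact inner_conj_symm _ _
    refine ext_inner_tmul fun c d => ?_
    rw [← inner_sl, ← inner_sl, sl_tilde, h.uOp_conj, h.cj_lsl, h1]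
  · rw [add_apply, TensorProduct.add_tmul, map_add, hx, hy, map_add, add_apply]
  · rw [smul_apply, ← TensorProduct.smul_tmul', map_smul, hx, map_smul, smul_apply]

/-- As ê is cyclic, it suffices to test on xê ⊗ η, where `tilde_eh` reduces the identity to Γ̂(yx) =
Γ̂(y)Γ̂(x). -/
theorem tilde_mul_tens {y : Op H} (hy : y ∈ V.Sh) :
    V.tilde J Jh * tens y 1 = V.comulHatₗ y * V.tilde J Jh := by
  refine op_ext fun k η => ?_
  obtain ⟨x, hx, rfl⟩ := h.mSh.cyclic k
  rw [op_mul_apply, op_mul_apply, tens_tmul, h.tilde_eh hx, ← op_mul_apply y x,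
    show (1 : Op H) η = η from rfl, h.tilde_eh (h.mSh.mul_mem _ hy _ hx), V.comulHat_mul hy, op_mul_apply]

end Canonical

end Mpi

/-! ### The bicommutant theorem and contraction of the last leg -/

section

variable {H : Type v} [NormedAddCommGroup H] [InnerProductSpace ℂ H]
  [FiniteDimensional ℂ H] [CompleteSpace H]

/-- The bicommutant theorem in finite dimension. -/
theorem mem_of_mem_bicommutant {W : Submodule ℂ (Op H)} (h1 : 1 ∈ W)
    (hmul : ∀ x ∈ W, ∀ y ∈ W, x * y ∈ W) (hstar : ∀ x ∈ W, star x ∈ W) {T : Op H}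
    (hT : ∀ c ∈ Set.centralizer (W : Set (Op H)), c * T = T * c) : T ∈ W := by
  let f := stdOrthonormalBasis ℂ H
  -- The map w ↦ (w ⊗ 1)ζ is injective. The projection onto (W ⊗ 1)ζ commutes with W ⊗ 1, so its
  -- slices lie in the commutant of W and commute with T. Hence T ⊗ 1 preserves this subspace, and
  -- (T ⊗ 1)ζ = (w ⊗ 1)ζ for some w in W.
  let ζ : Ten H H := ∑ i, f i ⊗ₜ[ℂ] f i
  let F : Op H →ₗ[ℂ] Ten H H :=
    { toFun := fun w => tens w (1 : Op H) ζ
      map_add' := fun x y => by rw [tens_add_left, add_apply]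
      map_smul' := fun c x => by rw [tens_smul_left, smul_apply]; rfl }
  let L : Submodule ℂ (Ten H H) := W.map F
  let p : Op (Ten H H) := L.starProjection
  have hL : ∀ w ∈ W, ∀ v ∈ L, tens w 1 v ∈ L := by
    rintro w hw _ ⟨x, hx, rfl⟩
    refine ⟨w * x, hmul w hw x hx, ?_⟩
    change tens (w * x) 1 ζ = tens w 1 (tens x 1 ζ)
    rw [← op_mul_apply, tens_mul, one_mul]
  have hp : ∀ w ∈ W, tens w 1 * p = p * tens w 1 := fun w hw => by
    ext v
    refine (Submodule.eq_starProjection_of_mem_of_inner_eq_zero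
      (hL w hw _ (L.starProjection_apply_mem v)) fun u hu => ?_).symm
    change ⟪tens w 1 v - tens w 1 (p v), u⟫_ℂ = 0
    rw [← map_sub, ← inner_star_right, star_tens, star_one]
    exact L.starProjection_inner_eq_zero v _ (hL _ (hstar w hw) u hu)
  have hTp : tens T 1 * p = p * tens T 1 := op_ext_sl fun a b => by
    rw [sl_tens_left, sl_tens_right, star_one]
    refine (hT (sl a b p) (Set.mem_centralizer_iff.mpr fun w hw => ?_)).symm
    have := congrArg (sl a b) (hp w hw)
    rwa [sl_tens_left, sl_tens_right, star_one] at this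
  have hζ : p ζ = ζ := Submodule.starProjection_eq_self_iff.mpr
    ⟨1, h1, by change tens 1 1 ζ = ζ; rw [tens_one]; rfl⟩
  obtain ⟨w, hw, h2⟩ : tens T 1 ζ ∈ L := by
    have h3 : tens T 1 ζ = p (tens T 1 ζ) := by
      rw [← op_mul_apply, ← hTp, op_mul_apply, hζ]
    rw [h3]
    exact L.starProjection_apply_mem _
  have h4 : ∀ (x : Op H) j, bra H (f j) (tens x 1 ζ) = x (f j) := fun x j => by
    rw [map_sum, map_sum, Finset.sum_eq_single j]
    · rw [tens_tmul, bra_tmul]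
      change ⟪f j, f j⟫_ℂ • _ = _
      rw [orthonormal_iff_ite.mp f.orthonormal, if_pos rfl, one_smul]
    · intro i _ hij
      rw [tens_tmul, bra_tmul]
      change ⟪f j, f i⟫_ℂ • _ = _
      rw [orthonormal_iff_ite.mp f.orthonormal, if_neg hij.symm, zero_smul]
    · simp
  have h5 : w = T := by
    refine ContinuousLinearMap.coe_injective (f.toBasis.ext fun j => ?_)
    rw [OrthonormalBasis.coe_toBasis]
    change w (f j) = T (f j)
    rw [← h4, ← h4]
    exact congrArg _ h2
  rwa [← h5]

theorem sum_inner_smul_lsl {ι : Type*} [Fintype ι] (f : OrthonormalBasis ι ℂ H) (a v : H)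
    (X : Op (Ten H H)) : ∑ m, ⟪f m, v⟫_ℂ • lsl a (f m) X = lsl a v X := by
  refine op_eq_of_inner fun c d => ?_
  rw [inner_lsl]
  conv_rhs => rw [← f.sum_repr' v]
  simp only [sum_apply, smul_apply, inner_sum, inner_smul_right, inner_lsl, TensorProduct.sum_tmul,
    ← TensorProduct.smul_tmul', map_sum, map_smul]
  exact Finset.sum_congr rfl fun i _ => (inner_smul_right (𝕜 := ℂ) (E := Ten H H) _ _ _).symm

omit [CompleteSpace H] in
theorem inner_sliceRight (ω : Module.Dual ℂ (Op H)) (X : Op (Ten H H)) (a b : H) :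
    ⟪a, sliceRight ω X b⟫_ℂ = ω (lsl a b X) := by
  induction X using tens_induction with
  | tens x y => rw [sliceRight_tens, lsl_tens, smul_apply, inner_smul_right, map_smul, smul_eq_mul,
      mul_comm]
  | add X Y hX hY =>
    rw [← sliceRightₗ_apply] at hX hY ⊢
    rw [map_add, map_add, map_add, ← hX, ← hY, add_apply, inner_add_right]

variable {K : Type u} [NormedAddCommGroup K] [InnerProductSpace ℂ K]
variable {L : Type w} [NormedAddCommGroup L] [InnerProductSpace ℂ L]

/-- The linear map `x ⊗ z ↦ ρ(z) x`. -/
def contr (ρ : Op H →ₗ[ℂ] Op L) : Op (Ten L H) →ₗ[ℂ] Op L where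
  toFun X := ∑ i, ∑ j, ρ (ketbra i j) * entry i j X
  map_add' X Y := by
    simp only [entry_eq_sl, map_add, mul_add, Finset.sum_add_distrib]
  map_smul' c X := by
    simp only [entry_eq_sl, map_smul, op_mul_smul, Finset.smul_sum, RingHom.id_apply]

omit [CompleteSpace H] in
theorem contr_tens (ρ : Op H →ₗ[ℂ] Op L) (x : Op L) (z : Op H) :
    contr ρ (tens x z) = ρ z * x := by
  change ∑ i, ∑ j, ρ (ketbra i j) * entry i j (tens x z) = _
  conv_rhs => rw [← sum_ketbra z]
  simp only [entry_tens, op_mul_smul, map_sum, map_smul, Finset.sum_mul, op_smul_mul]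

omit [CompleteSpace H] in
theorem continuous_sw_contr [CompleteSpace L] (ρ : Op H →ₗ[ℂ] Op L) :
    Continuous[sigmaWeak (Ten L H), sigmaWeak L] fun X => contr ρ X := by
  change Continuous[sigmaWeak (Ten L H), sigmaWeak L] fun X : Op (Ten L H) => ∑ i, ∑ j, ρ (ketbra i j) * entry i j X
  let _ := sigmaWeak (Ten L H)
  exact continuous_sw_sum (K := L) (Z := Op (Ten L H)) _ fun i _ =>
    continuous_sw_sum (K := L) (Z := Op (Ten L H)) _ fun j _ => by
      exact continuous_sw_comp (K := Ten L H) (K' := L)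
        (ρ (ketbra i j) ∘L bra L (stdOrthonormalBasis ℂ H i)) (ket L (stdOrthonormalBasis ℂ H j))

end

/-! ### The span of `Ŝ S'`, the counit and the map `θ` -/

namespace Mpi

variable {G : Type w} [Fintype G] {n : G → ℕ}
variable {H : Type v} [NormedAddCommGroup H] [InnerProductSpace ℂ H]
  [FiniteDimensional ℂ H] [CompleteSpace H] (V : Mpi n H)

/-- The element `(ω_{ab} ⊗ i)(∑ 1/n_γ α(e_ij) ⊗ e_ji)` of `N`. -/
def baseSlice (a b : H) : Base n :=
  ∑ γ, ∑ i, ∑ j, ((n γ : ℂ)⁻¹ * ⟪a, V.al (unit n γ i j) b⟫_ℂ) • unit n γ j i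

namespace Canonical

variable {V} {e eh : H} {J Jh : H ≃ₗᵢ⋆[ℂ] H} {D Di Dh Dhi : Op H}
  (h : V.Canonical e eh J Jh D Di Dh Dhi)

include h

/-- Cofixedness replaces `I` by e_{α,β}, whose slices on the first leg lie in β(N). Hence Sê ⊆
β(N)ê. -/
theorem lsl_eh (a b : H) : lsl a b V.I eh = V.be (V.baseSlice a b) eh := by
  have h1 : lsl a b V.I eh = lsl a b (V.I * star V.I) eh := by
    refine ext_inner_left ℂ fun c => ?_
    rw [inner_lsl, inner_lsl, h.cofixed]
  rw [h1, V.final']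
  simp only [baseSlice, map_sum, map_smul, lsl_tens, smul_smul]

/-- `S ∩ Ŝ' = β(N)` -/
theorem exists_be {s : Op H} (hs : s ∈ V.S) (hs' : s ∈ Set.centralizer (V.Sh : Set (Op H))) :
    ∃ y, s = V.be y := by
  obtain ⟨y, hy⟩ : ∃ y, s eh = V.be y eh := by
    refine V.S_induction (p := fun s => ∃ y, s eh = V.be y eh) (fun a b => ⟨_, h.lsl_eh a b⟩)
      ?_ ?_ hs
    · rintro x x' ⟨y, hy⟩ ⟨y', hy'⟩
      exact ⟨y + y', by rw [add_apply, hy, hy', map_add, add_apply]⟩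
    · rintro c x ⟨y, hy⟩
      exact ⟨c • y, by rw [smul_apply, hy, map_smul, smul_apply]⟩
  exact ⟨y, h.mSh.eq_of_apply_eq_commutant hs' (V.be_mem_centralizer y) hy⟩

/-- The linear span of the products `ŝ s'`. -/
theorem commutant_mul_mem {c x : Op H} (hc : c ∈ Set.centralizer (V.S : Set (Op H)))
    (hx : x ∈ V.Sh) : c * x ∈ Submodule.span ℂ
      {T | ∃ s ∈ V.Sh, ∃ t ∈ Set.centralizer (V.S : Set (Op H)), T = s * t} := by
  obtain ⟨s, hs, rfl⟩ := h.exists_uOp_conj hc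
  let W := Submodule.span ℂ
      {T | ∃ s ∈ V.Sh, ∃ t ∈ Set.centralizer (V.S : Set (Op H)), T = s * t}
  refine V.S_induction (p := fun s => uOp J Jh * s * uOp J Jh * x ∈ W) (fun a b => ?_)
    (fun y z hy hz => ?_) (fun k y hy => ?_) hs
  · rw [← sl_tilde]
    -- Slicing Ĩ(x ⊗ 1) = Γ̂(x)Ĩ on the second leg rewrites a product s'ŝ as a sum of products in
    -- the other order.
    have h1 := congrArg (sl a b) (h.tilde_mul_tens hx)
    rw [sl_tens_right, sl_mul (stdOrthonormalBasis ℂ H)] at h1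
    change sl a b (V.tilde J Jh) * x = _ at h1
    rw [h1]
    exact Submodule.sum_mem _ fun m _ => Submodule.subset_span
      ⟨_, V.sl_comulHat_mem hx _ _, _, h.sl_tilde_mem _ _, rfl⟩
  · rw [mul_add, add_mul, add_mul]; exact W.add_mem hy hz
  · rw [op_mul_smul, op_smul_mul, op_smul_mul]; exact W.smul_mem _ hy

/-- The linear span of the products `ŝ s'` is the commutant of `β(N)`. -/
theorem span_mul_commutant : (Submodule.span ℂ
      {T | ∃ s ∈ V.Sh, ∃ t ∈ Set.centralizer (V.S : Set (Op H)), T = s * t} : Set (Op H)) =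
    Set.centralizer (Set.range V.β) := by
  let X : Set (Op H) := {T | ∃ s ∈ V.Sh, ∃ t ∈ Set.centralizer (V.S : Set (Op H)), T = s * t}
  have h1 : ∀ t ∈ Set.centralizer (V.S : Set (Op H)), t ∈ Submodule.span ℂ X := fun t ht =>
    Submodule.subset_span ⟨1, h.mSh.one_mem, t, ht, (one_mul t).symm⟩
  have h2 : ∀ s ∈ V.Sh, s ∈ Submodule.span ℂ X := fun s hs =>
    Submodule.subset_span ⟨s, hs, 1, Set.one_mem_centralizer, (mul_one s).symm⟩
  apply Set.Subset.antisymm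
  · intro T hT
    refine Submodule.span_induction (p := fun T _ => T ∈ Set.centralizer (Set.range V.β))
      ?_ Set.zero_mem_centralizer (fun _ _ _ _ => Set.add_mem_centralizer)
      (fun c x _ hx => Set.mem_centralizer_iff.mpr fun m hm => by
        rw [op_mul_smul, op_smul_mul, Set.mem_centralizer_iff.mp hx m hm]) hT
    rintro _ ⟨s, hs, t, ht, rfl⟩
    refine Set.mul_mem_centralizer (Set.mem_centralizer_iff.mpr ?_)
      (Set.mem_centralizer_iff.mpr ?_)
    · rintro _ ⟨y, rfl⟩
      exact (V.Sh_comm_be hs (unop y)).symm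
    · rintro _ ⟨y, rfl⟩
      exact Set.mem_centralizer_iff.mp ht _ (V.be_mem_S h.mS.one_mem (unop y))
  · intro T hT
    have hmul : ∀ x ∈ Submodule.span ℂ X, ∀ y ∈ Submodule.span ℂ X, x * y ∈ Submodule.span ℂ X := by
      have hl : ∀ s ∈ V.Sh, ∀ x ∈ Submodule.span ℂ X, s * x ∈ Submodule.span ℂ X :=
        fun s hs x hx => by
          refine Submodule.span_induction (p := fun x _ => s * x ∈ Submodule.span ℂ X)
            ?_ (by simp) (fun x y _ _ hx hy => by rw [mul_add]; exact Submodule.add_mem _ hx hy)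
            (fun c x _ hx => by rw [op_mul_smul]; exact Submodule.smul_mem _ _ hx) hx
          rintro _ ⟨s', hs', t, ht, rfl⟩
          exact Submodule.subset_span ⟨s * s', h.mSh.mul_mem _ hs _ hs', t, ht,
            (mul_assoc _ _ _).symm⟩
      have hr : ∀ t ∈ Set.centralizer (V.S : Set (Op H)), ∀ x ∈ Submodule.span ℂ X,
          x * t ∈ Submodule.span ℂ X :=
        fun t ht x hx => by
          refine Submodule.span_induction (p := fun x _ => x * t ∈ Submodule.span ℂ X)
            ?_ (by simp) (fun x y _ _ hx hy => by rw [add_mul]; exact Submodule.add_mem _ hx hy)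
            (fun c x _ hx => by rw [op_smul_mul]; exact Submodule.smul_mem _ _ hx) hx
          rintro _ ⟨s, hs, t', ht', rfl⟩
          exact Submodule.subset_span ⟨s, hs, t' * t, Set.mul_mem_centralizer ht' ht,
            mul_assoc _ _ _⟩
      intro x hx y hy
      refine Submodule.span_induction (p := fun x _ => x * y ∈ Submodule.span ℂ X)
        ?_ (by simp) (fun x y _ _ hx hy => by rw [add_mul]; exact Submodule.add_mem _ hx hy)
        (fun c x _ hx => by rw [op_smul_mul]; exact Submodule.smul_mem _ _ hx) hx
      rintro _ ⟨s, hs, t, ht, rfl⟩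
      refine Submodule.span_induction (p := fun y _ => s * t * y ∈ Submodule.span ℂ X)
        ?_ (by simp) (fun x y _ _ hx hy => by rw [mul_add]; exact Submodule.add_mem _ hx hy)
        (fun c x _ hx => by rw [op_mul_smul]; exact Submodule.smul_mem _ _ hx) hy
      rintro _ ⟨s', hs', t', ht', rfl⟩
      have h3 : s * t * (s' * t') = s * ((t * s') * t') := by simp only [mul_assoc]
      rw [h3]
      exact hl s hs _ (hr t' ht' _ (h.commutant_mul_mem ht hs'))
    have hstar : ∀ x ∈ Submodule.span ℂ X, star x ∈ Submodule.span ℂ X := fun x hx => by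
      refine Submodule.span_induction (p := fun x _ => star x ∈ Submodule.span ℂ X)
        ?_ (by simp) (fun x y _ _ hx hy => by rw [star_add]; exact Submodule.add_mem _ hx hy)
        (fun c x _ hx => by rw [star_smul]; exact Submodule.smul_mem _ _ hx) hx
      rintro _ ⟨s, hs, t, ht, rfl⟩
      rw [star_mul]
      exact h.commutant_mul_mem (h.mS.star_mem_centralizer ht) (h.mSh.star_mem _ hs)
    -- Whatever commutes with the span commutes with S' and with Ŝ, so it lies in S ∩ Ŝ' = β(N) and
    -- commutes with T.
    refine mem_of_mem_bicommutant (h2 1 h.mSh.one_mem) hmul hstar fun c hc => ?_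
    rw [Set.mem_centralizer_iff] at hc
    have h3 : c ∈ V.S := h.mS.bicomm c fun y hy => (hc y (h1 y hy)).symm
    obtain ⟨y, rfl⟩ := h.exists_be h3 (Set.mem_centralizer_iff.mpr fun s hs => hc s (h2 s hs))
    exact Set.mem_centralizer_iff.mp hT _ ⟨op y, rfl⟩

/-- A form with (i ⊗ ω)(I) = 1 takes the value ⟨a, b⟩ on the coefficient (ω_{ab} ⊗ i)(I), as a
counit of a matrix coproduct must. -/
theorem exists_counit : ∃ ω : Module.Dual ℂ (Op H), ∀ s ∈ V.S, sliceRight ω (V.comulₗ s) = s := by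
  obtain ⟨ω, hω⟩ := V.exists_slice_of_mem_Sh h.mSh.one_mem
  have h1 : ∀ a b : H, ω (lsl a b V.I) = ⟪a, b⟫_ℂ := fun a b => by
    rw [← inner_sliceRight, hω]; rfl
  refine ⟨ω, fun s hs => ?_⟩
  simp only [← sliceRightₗ_apply]
  refine V.S_induction (p := fun s => sliceRightₗ ω (V.comulₗ s) = s) (fun a b => ?_)
    (fun x y hx hy => by rw [map_add, map_add, hx, hy])
    (fun c x hx => by rw [map_smul, map_smul, hx]) hs
  rw [V.comul_lsl (stdOrthonormalBasis ℂ H), map_sum]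
  simp only [sliceRightₗ_apply, sliceRight_tens, h1]
  exact sum_inner_smul_lsl _ _ _ _

/-- θ(T) is the element of Ŝ with θ(T)ê = Tê. Uniqueness of this element gives left Ŝ-linearity. By
`lsl_eh` and α(y)ê = β(y)ê, θ maps coefficients of `I` into α(N), so contracting Γ(s) with θ leaves
a Casimir sum of α, which is 1, times s. -/
theorem exists_theta : ∃ θ : Op H →ₗ[ℂ] Op H, (∀ T, θ T ∈ V.Sh) ∧
    (∀ y ∈ V.Sh, ∀ T, θ (y * T) = y * θ T) ∧ ∀ s ∈ V.S, contr θ (V.comulₗ s) = s := by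
  let ev : V.Sh →ₗ[ℂ] H :=
    { toFun := fun x => (x : Op H) eh, map_add' := fun x y => rfl, map_smul' := fun c x => rfl }
  have hev : Function.Bijective ev := by
    refine ⟨(injective_iff_map_eq_zero ev).mpr fun x hx =>
      Subtype.ext (h.mSh.separating _ x.2 hx), fun v => ?_⟩
    obtain ⟨x, hx, h1⟩ := h.mSh.cyclic v
    exact ⟨⟨x, hx⟩, h1⟩
  let E := LinearEquiv.ofBijective ev hev
  let θ : Op H →ₗ[ℂ] Op H :=
    { toFun := fun T => (E.symm (T eh) : Op H)
      map_add' := fun x y => by rw [add_apply, map_add]; rfl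
      map_smul' := fun c x => by rw [smul_apply, map_smul]; rfl }
  have hmem : ∀ T, θ T ∈ V.Sh := fun T => (E.symm (T eh)).2
  have heh : ∀ T, θ T eh = T eh := fun T => E.apply_symm_apply (T eh)
  have huniq : ∀ T, ∀ x ∈ V.Sh, x eh = T eh → θ T = x := fun T x hx h1 => by
    refine sub_eq_zero.mp (h.mSh.separating _ (V.Sh.sub_mem (hmem T) hx) ?_)
    rw [sub_apply, heh, h1, sub_self]
  refine ⟨θ, hmem, fun y hy T => huniq _ _ (h.mSh.mul_mem _ hy _ (hmem T)) ?_, fun s hs => ?_⟩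
  · rw [op_mul_apply, op_mul_apply, heh]
  · have h1 : ∀ a b : H, θ (lsl a b V.I) = V.al (V.baseSlice a b) := fun a b =>
      huniq _ _ (V.al_mem_Sh h.mSh.one_mem _) (by rw [h.al_eh, h.lsl_eh])
    refine V.S_induction (p := fun s => contr θ (V.comulₗ s) = s) (fun a b => ?_)
      (fun x y hx hy => by rw [map_add, map_add, hx, hy])
      (fun c x hx => by rw [map_smul, map_smul, hx]) hs
    let f := stdOrthonormalBasis ℂ H
    rw [V.comul_lsl f, map_sum]
    simp only [contr_tens, h1, baseSlice, map_sum, map_smul, Finset.sum_mul, op_smul_mul]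
    rw [Finset.sum_comm]
    have h2 : ∀ γ (i j : Fin (n γ)), ∑ m, ((n γ : ℂ)⁻¹ * ⟪f m, V.al (unit n γ i j) b⟫_ℂ) •
        (V.al (unit n γ j i) * lsl a (f m) V.I) =
        ((n γ : ℂ)⁻¹) • (V.al (unit n γ j i) * V.al (unit n γ i j)) * lsl a b V.I :=
      fun γ i j => by
        simp only [mul_smul, ← op_mul_smul]
        rw [← Finset.mul_sum, ← Finset.smul_sum, sum_inner_smul_lsl, ← al_mul_lsl]
        simp only [op_mul_smul, op_smul_mul, mul_assoc]
    have h3 : ∀ γ, ∑ m, ∑ i, ∑ j, ((n γ : ℂ)⁻¹ * ⟪f m, V.al (unit n γ i j) b⟫_ℂ) •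
        (V.al (unit n γ j i) * lsl a (f m) V.I) = ∑ i, ∑ j,
        ((n γ : ℂ)⁻¹) • (V.al (unit n γ j i) * V.al (unit n γ i j)) * lsl a b V.I := fun γ => by
      rw [Finset.sum_comm]
      refine Finset.sum_congr rfl fun i _ => ?_
      rw [Finset.sum_comm]
      exact Finset.sum_congr rfl fun j _ => h2 γ i j
    simp only [h3, ← Finset.sum_mul]
    simp only [← al_mul, ← map_smul, ← map_sum]
    rw [sum_unit_mul_unit', al_one, one_mul]

end Canonical

end Mpi

/-! ### Spans, slices and contractions over `K ⊗ H` -/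

section

variable {K : Type u} [NormedAddCommGroup K] [InnerProductSpace ℂ K] [CompleteSpace K]
variable {K' : Type w} [NormedAddCommGroup K'] [InnerProductSpace ℂ K'] [CompleteSpace K']
variable {H : Type v} [NormedAddCommGroup H] [InnerProductSpace ℂ H]
  [FiniteDimensional ℂ H] [CompleteSpace H]

/-- The `*`-algebra spanned by a set that is closed under products and adjoints up to linear
combinations. -/
def spanStarSubalgebra (X : Set (Op K))
    (hmul : ∀ x ∈ X, ∀ y ∈ X, x * y ∈ Submodule.span ℂ X)
    (hstar : ∀ x ∈ X, star x ∈ Submodule.span ℂ X) : NonUnitalStarSubalgebra ℂ (Op K) where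
  carrier := Submodule.span ℂ X
  add_mem' := Submodule.add_mem _
  zero_mem' := Submodule.zero_mem _
  smul_mem' c _ hx := Submodule.smul_mem _ c hx
  mul_mem' {x y} hx hy := by
    refine Submodule.span_induction (p := fun x _ => x * y ∈ Submodule.span ℂ X)
      (fun x hx => ?_) (by simp) (fun x z _ _ hx hz => by rw [add_mul]; exact add_mem hx hz)
      (fun c x _ hx => by rw [op_smul_mul]; exact Submodule.smul_mem _ _ hx) hx
    exact Submodule.span_induction (p := fun y _ => x * y ∈ Submodule.span ℂ X)
      (fun y hy => hmul x hx y hy) (by simp)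
      (fun y z _ _ hy hz => by rw [mul_add]; exact add_mem hy hz)
      (fun c y _ hy => by rw [op_mul_smul]; exact Submodule.smul_mem _ _ hy) hy
  star_mem' {x} hx := Submodule.span_induction (p := fun x _ => star x ∈ Submodule.span ℂ X)
      hstar (by simp) (fun x y _ _ hx hy => by rw [star_add]; exact add_mem hx hy)
      (fun c x _ hx => by rw [star_smul]; exact Submodule.smul_mem _ _ hx) hx

theorem isClosed_sw_of_subtype {A : NonUnitalStarSubalgebra ℂ (Op K)} (hA : IsVonNeumann A)
    {P : A → Prop} (hP : IsClosed[(sigmaWeak K).induced Subtype.val] {x : A | P x}) :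
    IsClosed[sigmaWeak K] {x : Op K | ∃ h : x ∈ A, P ⟨x, h⟩} := by
  obtain ⟨t, ht, h1⟩ := (@isClosed_induced_iff _ _ (sigmaWeak K) _ _).mp hP
  have h2 : {x : Op K | ∃ h : x ∈ A, P ⟨x, h⟩} = t ∩ (A : Set (Op K)) := by
    ext x
    constructor
    · rintro ⟨h, hx⟩
      have : (⟨x, h⟩ : A) ∈ Subtype.val ⁻¹' t := by rw [h1]; exact hx
      exact ⟨this, h⟩
    · rintro ⟨hx, h⟩
      have : (⟨x, h⟩ : A) ∈ {x : A | P x} := by rw [← h1]; exact hx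
      exact ⟨h, this⟩
  rw [h2]
  exact @IsClosed.inter _ _ _ (sigmaWeak K) ht hA

theorem ampHom_tens_mul {A : NonUnitalStarSubalgebra ℂ (Op K)} (δ : A →⋆ₙₐ[ℂ] Op K') (T : amp A H)
    (y : Op H) :
    ampHom δ H ⟨tens 1 y * T.1, tens_mul_mem_amp T.2 y⟩ = tens 1 y * ampHom δ H T := by
  refine op_ext_sl fun ξ η => ?_
  refine (sl_ampHom δ _ ξ η).trans ?_
  conv_rhs => rw [sl_tens_left, one_mul, sl_ampHom]
  exact congrArg δ (Subtype.ext ((sl_tens_left _ _ _ _ _).trans (one_mul _)))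

theorem vnTensor_le_amp {A : NonUnitalStarSubalgebra ℂ (Op K)} {S : Submodule ℂ (Op H)}
    {X : Op (Ten K H)} (hX : X ∈ vnTensor A S) : X ∈ amp A H := by
  refine Submodule.span_induction (p := fun X _ => X ∈ amp A H) ?_ (zero_mem _)
    (fun _ _ _ _ => add_mem) (fun c x _ hx => SMulMemClass.smul_mem c hx) hX
  rintro _ ⟨a, ha, s, -, rfl⟩
  exact tens_mem_amp ha s

omit [CompleteSpace H] in
theorem leg23_leg12_comm {A : NonUnitalStarSubalgebra ℂ (Op K)} {S : Submodule ℂ (Op H)}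
    {T : Op (Ten H H)} (hT : ∀ s ∈ S, T * tens s 1 = tens s 1 * T)
    {X : Op (Ten K H)} (hX : X ∈ vnTensor A S) :
    leg23 K T * leg12 X = leg12 X * leg23 K T := by
  refine Submodule.span_induction (p := fun X _ => leg23 K T * leg12 X = leg12 X * leg23 K T)
    ?_ ?_ (fun X Y _ _ hX hY => by rw [leg12_add, mul_add, add_mul, hX, hY]) (fun c X _ hX => ?_) hX
  · rintro _ ⟨a, -, s, hs, rfl⟩
    rw [leg12, ← rebracket_tens, leg23, ← rebracket_mul, ← rebracket_mul, tens_mul, tens_mul,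
      hT s hs, one_mul, mul_one]
  · rw [leg12, tens_zero_left, mul_zero, zero_mul]
  · rw [leg12, tens_smul_left, op_mul_smul, op_smul_mul]
    exact congrArg (c • ·) hX

/-- `idTensor` as a linear map. -/
def idTensorₗ (F : Op H →ₗ[ℂ] Op K') : Op (Ten K H) →ₗ[ℂ] Op (Ten K K') where
  toFun := idTensor F
  map_add' X Y := by
    simp only [idTensor, entry_eq_sl, map_add, tens_add_left, Finset.sum_add_distrib]
  map_smul' c X := by
    simp only [idTensor, entry_eq_sl, map_smul, tens_smul_left, Finset.smul_sum, RingHom.id_apply]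

omit [CompleteSpace K] [CompleteSpace H] in
theorem sliceRight_rebracket (ω : Module.Dual ℂ (Op H)) (a : Op K) (X : Op (Ten H H)) :
    sliceRight ω (rebracket (tens a X)) = tens a (sliceRight ω X) := by
  induction X using tens_induction with
  | tens y z => rw [rebracket_tens, sliceRight_tens, sliceRight_tens, tens_smul_right]
  | add X Y hX hY =>
    have h1 : rebracket (tens a (X + Y)) = rebracket (tens a X) + rebracket (tens a Y) := by
      rw [tens_add_right]; exact map_add rebracketₗ _ _
    rw [← sliceRightₗ_apply] at hX hY ⊢
    rw [h1, map_add, hX, hY, ← sliceRightₗ_apply, ← sliceRightₗ_apply, ← sliceRightₗ_apply, map_add,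
      tens_add_right]

omit [CompleteSpace K] [CompleteSpace H] in
theorem contr_rebracket (θ : Op H →ₗ[ℂ] Op H) (a : Op K) (X : Op (Ten H H)) :
    contr (tensRight 1 ∘ₗ θ) (rebracket (tens a X)) = tens a (contr θ X) := by
  induction X using tens_induction with
  | tens y z =>
    rw [rebracket_tens, contr_tens, contr_tens]
    change tens 1 (θ z) * tens a y = _
    rw [tens_mul, one_mul]
  | add X Y hX hY =>
    have h1 : rebracket (tens a (X + Y)) = rebracket (tens a X) + rebracket (tens a Y) := by
      rw [tens_add_right]; exact map_add rebracketₗ _ _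
    rw [h1, map_add, hX, hY, map_add, tens_add_right]

omit [CompleteSpace K] [CompleteSpace H] in
theorem contr_tens_mul {S : Submodule ℂ (Op H)} {θ : Op H →ₗ[ℂ] Op H}
    (hθ : ∀ y ∈ S, ∀ T, θ (y * T) = y * θ T) {y : Op H} (hy : y ∈ S) (X : Op (Ten (Ten K H) H)) :
    contr (tensRight 1 ∘ₗ θ) (tens 1 y * X) = tens 1 y * contr (tensRight 1 ∘ₗ θ) X := by
  induction X using tens_induction with
  | tens B z =>
    rw [tens_mul, contr_tens, contr_tens, one_mul]
    change tens 1 (θ (y * z)) * B = tens 1 y * (tens 1 (θ z) * B)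
    rw [hθ y hy, ← mul_assoc, tens_mul, one_mul]
  | add X Y hX hY => rw [mul_add, map_add, map_add, hX, hY, mul_add]

theorem sliceRight_ampHom {A : NonUnitalStarSubalgebra ℂ (Op K)} (δ : A →⋆ₙₐ[ℂ] Op K')
    (ω : Module.Dual ℂ (Op H)) (T : amp A H) : ∃ hT : sliceRight ω T.1 ∈ A,
    sliceRight ω (ampHom δ H T) = δ ⟨sliceRight ω T.1, hT⟩ := by
  refine ⟨sum_mem fun i _ => sum_mem fun j _ => SMulMemClass.smul_mem _ (T.2 i j), ?_⟩
  simp only [sliceRight, entry_ampHom, ← map_smul, ← map_sum]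
  refine congrArg δ (Subtype.ext ?_)
  simp only [AddSubmonoidClass.coe_finsetSum]
  rfl

end

/-! ### The crossed product as a linear span -/

namespace Mpi

variable {G : Type w} [Fintype G] {n : G → ℕ}
variable {H : Type v} [NormedAddCommGroup H] [InnerProductSpace ℂ H]
  [FiniteDimensional ℂ H] [CompleteSpace H] {V : Mpi n H}
  {e eh : H} {J Jh : H ≃ₗᵢ⋆[ℂ] H} {D Di Dh Dhi : Op H}
  {K : Type u} [NormedAddCommGroup K] [InnerProductSpace ℂ K] [CompleteSpace K]
  {A : NonUnitalStarSubalgebra ℂ (Op K)} {b : (V.qg.tgt)ᵐᵒᵖ →⋆ₙₐ[ℂ] A}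
  {δ : A →⋆ₙₐ[ℂ] Op (Ten K H)}

omit [CompleteSpace K] in
theorem rebracket_idTensor_comul (X : Op (Ten K H)) :
    rebracket (idTensor V.comulₗ X) = leg23 K V.I * leg12 X * leg23 K (star V.I) := by
  induction X using tens_induction with
  | tens a s =>
    rw [idTensor_tens, comulₗ_apply, leg12, ← rebracket_tens, leg23, leg23, ← rebracket_mul,
      ← rebracket_mul, tens_mul, tens_mul, one_mul, mul_one]
  | add X Y hX hY =>
    have h1 : idTensor V.comulₗ (X + Y) = idTensor V.comulₗ X + idTensor V.comulₗ Y :=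
      map_add (idTensorₗ V.comulₗ) X Y
    have h2 : ∀ Y Z : Op (Ten K (Ten H H)), rebracket (Y + Z) = rebracket Y + rebracket Z :=
      map_add rebracketₗ
    rw [h1, h2, hX, hY, leg12_add, mul_add, add_mul]

theorem eAct_eq : eAct V.qg b = ∑ γ, ∑ i, ∑ j, ((n γ : ℂ)⁻¹) •
    tens (b (op (V.qg.tgtUnit γ i j)) : Op K) (V.be (unit n γ i j)) := rfl

theorem eAct_comm {y : Op H} (hy : ∀ x, y * V.be x = V.be x * y) :
    tens 1 y * eAct V.qg b = eAct V.qg b * tens 1 y := by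
  rw [eAct_eq]
  simp only [Finset.mul_sum, Finset.sum_mul, op_mul_smul, op_smul_mul, tens_mul, one_mul, mul_one,
    hy]

section Action

variable (hδ : IsRightAction V.qg A b δ)

include hδ

theorem delta_mem_amp (a : A) : δ a ∈ amp A H := vnTensor_le_amp (hδ.mem_tensor a)

theorem ampHom_delta (a : A) : ampHom δ H ⟨δ a, delta_mem_amp hδ a⟩ =
    leg23 K V.I * leg12 (δ a) * leg23 K (star V.I) := by
  rw [← tensorId_eq_ampHom, hδ.coassoc, ← rebracket_idTensor_comul]
  rfl

/-- Coassociativity without the factor I*: the initial support of `I` commutes with S ⊗ 1 and is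
absorbed by `I`. -/
theorem ampHom_delta_mul (a : A) : ampHom δ H ⟨δ a, delta_mem_amp hδ a⟩ * leg23 K V.I =
    leg23 K V.I * leg12 (δ a) := by
  rw [ampHom_delta hδ, mul_assoc, ← leg23_mul, mul_assoc,
    ← leg23_leg12_comm (fun s hs => V.initial_comm_S hs) (hδ.mem_tensor a), ← mul_assoc,
    ← leg23_mul, V.I_star_I]

theorem delta_b_mul (a : A) : δ (b 1) * δ a = δ a := by
  rw [← map_mul, (hδ.b_unital a).1]

theorem delta_mul_b (a : A) : δ a * δ (b 1) = δ a := by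
  rw [← map_mul, (hδ.b_unital a).2]

end Action

namespace Canonical

variable (h : V.Canonical e eh J Jh D Di Dh Dhi) (hδ : IsRightAction V.qg A b δ)

include h hδ

theorem eAct_eq_delta : eAct V.qg b = δ (b 1) := by
  have h1 := hδ.map_b 1
  have h2 : V.qg.antipode ((1 : V.qg.tgt) : Op H) = 1 := h.antipode_one
  rw [h2, tens_one, mul_one] at h1
  exact h1.symm

omit h in
-- Slicing `ampHom_delta_mul` on the third leg gives (1 ⊗ I_{cd})δ(a) = ∑_m δ(a_m)(1 ⊗ I_{md}),
-- where a_m is the slice of δ(a) by (c, m). This commutation rule makes the span closed under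
-- products and adjoints.
theorem tens_mul_delta_mem (a : A) {y : Op H} (hy : y ∈ V.Sh) : tens 1 y * δ a ∈
    Submodule.span ℂ {T | ∃ a, ∃ y ∈ V.Sh, T = δ a * tens 1 y} := by
  refine V.Sh_induction (p := fun y => tens 1 y * δ a ∈
    Submodule.span ℂ {T | ∃ a, ∃ y ∈ V.Sh, T = δ a * tens 1 y}) (fun c d => ?_)
    (fun x y hx hy => ?_) (fun c x hx => ?_) hy
  · have h1 := congrArg (sl c d) (ampHom_delta_mul hδ a)
    rw [sl_mul (stdOrthonormalBasis ℂ H), leg12, sl_tens_right, sl_leg23] at h1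
    refine (congrArg (· ∈ _) h1).mp (Submodule.sum_mem _ fun m _ => ?_)
    rw [sl_ampHom, sl_leg23]
    exact Submodule.subset_span ⟨_, _, V.sl_mem_Sh _ _, rfl⟩
  · rw [tens_add_right, add_mul]; exact add_mem hx hy
  · rw [tens_smul_right, op_smul_mul]; exact Submodule.smul_mem _ _ hx

/-- The linear span of the products `δ(a)(1 ⊗ ŝ)`, which turns out to be the crossed product. -/
def crossedSpan : NonUnitalStarSubalgebra ℂ (Op (Ten K H)) :=
  spanStarSubalgebra {T | ∃ a, ∃ y ∈ V.Sh, T = δ a * tens 1 y}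
    (by
      rintro _ ⟨a, y, hy, rfl⟩ _ ⟨a', y', hy', rfl⟩
      have h1 := tens_mul_delta_mem hδ a' hy
      have h2 : δ a * tens 1 y * (δ a' * tens 1 y') = δ a * (tens 1 y * δ a') * tens 1 y' := by
        simp only [mul_assoc]
      rw [h2]
      refine Submodule.span_induction (p := fun T _ => δ a * T * tens 1 y' ∈ Submodule.span ℂ
        {T | ∃ a, ∃ y ∈ V.Sh, T = δ a * tens 1 y}) ?_ (by simp)
        (fun x z _ _ hx hz => by rw [mul_add, add_mul]; exact add_mem hx hz)
        (fun c x _ hx => by rw [op_mul_smul, op_smul_mul]; exact Submodule.smul_mem _ _ hx) h1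
      rintro _ ⟨a'', y'', hy'', rfl⟩
      refine Submodule.subset_span ⟨a * a'', y'' * y', h.mSh.mul_mem _ hy'' _ hy', ?_⟩
      rw [map_mul, ← one_mul (1 : Op K), ← tens_mul]
      simp only [mul_assoc, one_mul])
    (by
      rintro _ ⟨a, y, hy, rfl⟩
      rw [star_mul, star_tens, star_one, ← map_star]
      exact tens_mul_delta_mem hδ _ (h.mSh.star_mem _ hy))

/-- Contracting (δ ⊗ i)δ(a) = (i ⊗ Γ)δ(a) with θ returns δ(a), and left linearity of θ extends this
to (1 ⊗ y)δ(a). Conversely, any contraction is a sum of terms (1 ⊗ θ(z))δ(a'), which belong to the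
span. Both sides of the equation are σ-weakly continuous in T, which makes the span closed. -/
theorem mem_crossedSpan_iff (T : Op (Ten K H)) {θ : Op H →ₗ[ℂ] Op H} (hmem : ∀ T, θ T ∈ V.Sh)
    (hmul : ∀ y ∈ V.Sh, ∀ T, θ (y * T) = y * θ T) (hθ : ∀ s ∈ V.S, contr θ (V.comulₗ s) = s) :
    T ∈ h.crossedSpan hδ ↔
      ∃ hT : T ∈ amp A H, contr (tensRight 1 ∘ₗ θ) (ampHom δ H ⟨T, hT⟩) = T := by
  constructor
  · intro hT
    have h1 : ∀ a, contr (tensRight 1 ∘ₗ θ) (ampHom δ H ⟨δ a, delta_mem_amp hδ a⟩) = δ a := fun a => by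
      rw [ampHom_delta hδ, ← rebracket_idTensor_comul]
      refine Submodule.span_induction (p := fun X _ =>
        contr (tensRight 1 ∘ₗ θ) (rebracketₗ (idTensorₗ V.comulₗ X)) = X) ?_ (by simp)
        (fun X Y _ _ hX hY => by rw [map_add, map_add, map_add, hX, hY])
        (fun c X _ hX => by rw [map_smul, map_smul, map_smul, hX]) (hδ.mem_tensor a)
      rintro _ ⟨a, -, s, hs, rfl⟩
      change contr (tensRight 1 ∘ₗ θ) (rebracket (idTensor V.comulₗ (tens a s))) = _
      rw [idTensor_tens, contr_rebracket, hθ s hs]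
    -- θ is linear on the left only, so the equation is checked on the products (1 ⊗ y)δ(a). These
    -- are the adjoints of the generators of the self-adjoint span.
    have h2 : star T ∈ h.crossedSpan hδ := star_mem hT
    suffices hs : ∃ hT : star (star T) ∈ amp A H,
        contr (tensRight 1 ∘ₗ θ) (ampHom δ H ⟨star (star T), hT⟩) = star (star T) by
      obtain ⟨h3, h4⟩ := hs
      simp only [star_star] at h3 h4
      exact ⟨h3, h4⟩
    refine Submodule.span_induction (p := fun T _ => ∃ hT : star T ∈ amp A H,
        contr (tensRight 1 ∘ₗ θ) (ampHom δ H ⟨star T, hT⟩) = star T) ?_ ?_ ?_ ?_ h2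
    · rintro _ ⟨a, y, hy, rfl⟩
      have h3 : star (δ a * tens 1 y) = tens 1 (star y) * δ (star a) := by
        rw [star_mul, star_tens, star_one, map_star]
      have h4 := tens_mul_mem_amp (delta_mem_amp hδ (star a)) (star y)
      simp only [h3]
      refine ⟨h4, ?_⟩
      rw [ampHom_tens_mul δ ⟨_, delta_mem_amp hδ (star a)⟩,
        contr_tens_mul hmul (h.mSh.star_mem _ hy), h1]
    · simp only [star_zero]
      exact ⟨zero_mem _, (congrArg _ (map_zero (ampHom δ H))).trans (map_zero _)⟩
    · rintro x y - - ⟨hx, hx'⟩ ⟨hy, hy'⟩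
      simp only [star_add]
      refine ⟨add_mem hx hy, ?_⟩
      have := map_add (ampHom δ H) ⟨star x, hx⟩ ⟨star y, hy⟩
      conv_rhs => rw [← hx', ← hy', ← map_add, ← this]
      rfl
    · rintro c x - ⟨hx, hx'⟩
      simp only [star_smul]
      refine ⟨SMulMemClass.smul_mem _ hx, ?_⟩
      have := map_smul (ampHom δ H) (star c) ⟨star x, hx⟩
      conv_rhs => rw [← hx', ← map_smul, ← this]
      rfl
  · rintro ⟨hT, h1⟩
    rw [← h1]
    change ∑ i, ∑ j, tens 1 (θ (ketbra i j)) * entry i j (ampHom δ H ⟨T, hT⟩) ∈ _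
    refine sum_mem fun i _ => sum_mem fun j _ => ?_
    rw [entry_ampHom]
    exact tens_mul_delta_mem hδ _ (hmem _)

theorem isVonNeumann_crossedSpan : IsVonNeumann (h.crossedSpan hδ) := by
  obtain ⟨θ, hmem, hmul, hθ⟩ := h.exists_theta
  have h1 : ((h.crossedSpan hδ : NonUnitalStarSubalgebra ℂ (Op (Ten K H))) : Set (Op (Ten K H))) =
      {T | ∃ hT : T ∈ amp A H, contr (tensRight 1 ∘ₗ θ) (ampHom δ H ⟨T, hT⟩) = T} :=
    Set.ext fun T => h.mem_crossedSpan_iff hδ T hmem hmul hθ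
  unfold IsVonNeumann
  rw [h1]
  refine isClosed_sw_of_subtype (P := fun T : amp A H =>
    contr (tensRight 1 ∘ₗ θ) (ampHom δ H T) = T.1) (isVonNeumann_amp hδ.vonNeumann) ?_
  let t : TopologicalSpace (amp A H) := (sigmaWeak (Ten K H)).induced Subtype.val
  refine isClosed_sw_eq (K := Ten K H) (Z := amp A H) ?_ ?_
  · exact @Continuous.comp (amp A H) (Op (Ten (Ten K H) H)) (Op (Ten K H)) t (sigmaWeak _)
      (sigmaWeak _) _ _ (continuous_sw_contr _) (ampHom_normal hδ.normal)
  · exact continuous_induced_dom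

theorem crossed_eq : crossed V.qg b δ V.Sh = h.crossedSpan hδ := by
  have hE := h.eAct_eq_delta hδ
  refine le_antisymm (vnGen_le (h.isVonNeumann_crossedSpan hδ) ?_) fun T hT => ?_
  · rintro _ (⟨a, rfl⟩ | ⟨y, hy, rfl⟩)
    · exact Submodule.subset_span ⟨a, 1, h.mSh.one_mem, by rw [tens_one, mul_one]⟩
    · exact Submodule.subset_span ⟨b 1, y, hy, by rw [hE]⟩
  · refine Submodule.span_induction (p := fun T _ => T ∈ crossed V.qg b δ V.Sh) ?_ (zero_mem _)
      (fun _ _ _ _ => add_mem) (fun c x _ hx => SMulMemClass.smul_mem c hx) hT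
    rintro _ ⟨a, y, hy, rfl⟩
    rw [← delta_mul_b hδ a, mul_assoc, ← hE]
    exact mul_mem (subset_vnGen _ (Or.inl ⟨a, rfl⟩)) (subset_vnGen _ (Or.inr ⟨y, hy, rfl⟩))

theorem delta_mul_mem (a : A) {y : Op H} (hy : y ∈ V.Sh) :
    δ a * tens 1 y ∈ crossed V.qg b δ V.Sh := by
  rw [h.crossed_eq hδ]
  exact Submodule.subset_span ⟨a, y, hy, rfl⟩

/-- Induction on the elements of the crossed product. -/
theorem crossed_induction {p : crossed V.qg b δ V.Sh → Prop}
    (hg : ∀ a c d, p ⟨δ a * tens 1 (sl c d V.I), h.delta_mul_mem hδ a (V.sl_mem_Sh c d)⟩)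
    (hadd : ∀ x y, p x → p y → p (x + y))
    (hsmul : ∀ (c : ℂ) x (hx : x ∈ crossed V.qg b δ V.Sh), p ⟨x, hx⟩ →
      p ⟨c • x, SMulMemClass.smul_mem c hx⟩)
    (x : crossed V.qg b δ V.Sh) : p x := by
  have h0 : p 0 := by
    have h1 := hsmul 0 _ _ (hg 0 0 0)
    simp only [zero_smul] at h1
    exact h1
  obtain ⟨x, hx⟩ := x
  have hx' := hx
  rw [h.crossed_eq hδ] at hx'
  obtain ⟨hx1, h1⟩ : ∃ hx : x ∈ crossed V.qg b δ V.Sh, p ⟨x, hx⟩ := by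
    refine Submodule.span_induction (p := fun x _ => ∃ hx : x ∈ crossed V.qg b δ V.Sh, p ⟨x, hx⟩)
      ?_ ⟨zero_mem _, h0⟩ ?_ ?_ hx'
    · rintro _ ⟨a, y, hy, rfl⟩
      refine V.Sh_induction (p := fun y => ∃ hx : δ a * tens 1 y ∈ crossed V.qg b δ V.Sh, p ⟨_, hx⟩)
        (fun c d => ⟨_, hg a c d⟩) ?_ ?_ hy
      · rintro y z ⟨hy, hy'⟩ ⟨hz, hz'⟩
        simp only [tens_add_right, mul_add]
        exact ⟨add_mem hy hz, hadd _ _ hy' hz'⟩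
      · rintro c y ⟨hy, hy'⟩
        simp only [tens_smul_right, op_mul_smul]
        exact ⟨SMulMemClass.smul_mem c hy, hsmul c _ hy hy'⟩
    · rintro y z - - ⟨hy, hy'⟩ ⟨hz, hz'⟩
      exact ⟨add_mem hy hz, hadd _ _ hy' hz'⟩
    · rintro c y - ⟨hy, hy'⟩
      exact ⟨SMulMemClass.smul_mem c hy, hsmul c _ hy hy'⟩
  exact h1

end Canonical

end Mpi

/-! ### The dual action and its base representation -/

namespace Mpi

variable {G : Type w} [Fintype G] {n : G → ℕ}
variable {H : Type v} [NormedAddCommGroup H] [InnerProductSpace ℂ H]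
  [FiniteDimensional ℂ H] [CompleteSpace H] {V : Mpi n H}
  {e eh : H} {J Jh : H ≃ₗᵢ⋆[ℂ] H} {D Di Dh Dhi : Op H}
  {K : Type u} [NormedAddCommGroup K] [InnerProductSpace ℂ K] [CompleteSpace K]
  {A : NonUnitalStarSubalgebra ℂ (Op K)} {b : (V.qg.tgt)ᵐᵒᵖ →⋆ₙₐ[ℂ] A}
  {δ : A →⋆ₙₐ[ℂ] Op (Ten K H)}

omit [FiniteDimensional ℂ H] [CompleteSpace H] [CompleteSpace K] in
theorem leg12_tens_one (y : Op H) : leg12 (tens (1 : Op K) y) = leg23 K (tens y 1) := by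
  rw [leg12, leg23_tens]

omit [FiniteDimensional ℂ H] [CompleteSpace H] [CompleteSpace K] in
theorem leg23_one_tens (z : Op H) : leg23 K (tens 1 z) = tens 1 z := by
  rw [leg23_tens, tens_one]

theorem comulHat_bh (y : Base n) : V.comulHatₗ (V.bh y) = star V.I * V.I * tens 1 (V.bh y) := by
  rw [comulHatₗ_apply, mul_assoc, ← V.I_comm_bh, mul_assoc]

namespace Canonical

variable (h : V.Canonical e eh J Jh D Di Dh Dhi) (hδ : IsRightAction V.qg A b δ)

include h hδ

theorem tilde_leg12_delta (a : A) {y : Op H} (hy : y ∈ V.Sh) :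
    leg23 K (V.tilde J Jh) * leg12 (δ a * tens 1 y) =
      leg12 (δ a) * leg23 K (V.comulHatₗ y) * leg23 K (V.tilde J Jh) := by
  rw [leg12_mul, ← mul_assoc, leg23_leg12_comm (fun s hs => h.tilde_comm hs) (hδ.mem_tensor a),
    leg12_tens_one, mul_assoc, ← leg23_mul, h.tilde_mul_tens hy, leg23_mul, mul_assoc]

/-- `Ĩ₂₃` commutes with δ(a) ⊗ 1 because the second leg of δ(a) is in `S`. What remains is Ĩ(y ⊗
1)Ĩ* = Γ̂(y)I*I = Γ̂(y). -/
theorem tilde_conj_delta (a : A) {y : Op H} (hy : y ∈ V.Sh) :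
    leg23 K (V.tilde J Jh) * leg12 (δ a * tens 1 y) * star (leg23 K (V.tilde J Jh)) =
      leg12 (δ a) * leg23 K (V.comulHatₗ y) := by
  rw [h.tilde_leg12_delta hδ a hy, mul_assoc, star_leg23, ← leg23_mul, h.tilde_mul_star, mul_assoc,
    ← leg23_mul, comulHat_mul_initial]

/-- This absorption of Ĩ*Ĩ makes x ↦ Ĩ₂₃(x ⊗ 1)Ĩ₂₃* multiplicative. On generators both sides are the
right side of `tilde_leg12_delta`. -/
theorem tilde_mul_leg12 (x : crossed V.qg b δ V.Sh) :
    leg23 K (V.tilde J Jh) * leg12 x.1 * star (leg23 K (V.tilde J Jh)) * leg23 K (V.tilde J Jh) =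
      leg23 K (V.tilde J Jh) * leg12 x.1 := by
  refine h.crossed_induction hδ (p := fun x => leg23 K (V.tilde J Jh) * leg12 x.1 *
    star (leg23 K (V.tilde J Jh)) * leg23 K (V.tilde J Jh) = leg23 K (V.tilde J Jh) * leg12 x.1)
    (fun a c d => ?_) (fun x y hx hy => ?_) (fun c x hx hp => ?_) x
  · rw [h.tilde_conj_delta hδ a (V.sl_mem_Sh c d), h.tilde_leg12_delta hδ a (V.sl_mem_Sh c d)]
  · change leg23 K (V.tilde J Jh) * leg12 (x.1 + y.1) *
      star (leg23 K (V.tilde J Jh)) * leg23 K (V.tilde J Jh) =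
        leg23 K (V.tilde J Jh) * leg12 (x.1 + y.1)
    rw [leg12_add, mul_add, add_mul, add_mul, hx, hy]
  · change leg23 K (V.tilde J Jh) * leg12 (c • x) *
      star (leg23 K (V.tilde J Jh)) * leg23 K (V.tilde J Jh) =
        leg23 K (V.tilde J Jh) * leg12 (c • x)
    have h1 : leg12 (c • x) = c • leg12 x := tens_smul_left c x 1
    rw [h1, op_mul_smul, op_smul_mul, op_smul_mul]
    exact congrArg (c • ·) hp

/-- The map `x ↦ Ĩ₂₃ (x ⊗ 1) Ĩ₂₃^*` on the crossed product. -/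
theorem exists_dualAct : ∃ δh : crossed V.qg b δ V.Sh →⋆ₙₐ[ℂ] Op (Ten (Ten K H) H),
    ∀ x : crossed V.qg b δ V.Sh, δh x =
      leg23 K (V.tilde J Jh) * leg12 x.1 * star (leg23 K (V.tilde J Jh)) := by
  refine ⟨
    { toFun := fun x => leg23 K (V.tilde J Jh) * leg12 x.1 * star (leg23 K (V.tilde J Jh))
      map_smul' := fun c x => ?_
      map_zero' := ?_
      map_add' := fun x y => ?_
      map_mul' := fun x y => ?_
      map_star' := fun x => ?_ }, fun x => rfl⟩
  · have h1 : leg12 (c • x.1) = c • leg12 x.1 := tens_smul_left c x.1 1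
    change leg23 K (V.tilde J Jh) * leg12 (c • x.1) * star (leg23 K (V.tilde J Jh)) = _
    rw [h1, op_mul_smul, op_smul_mul]
    rfl
  · change leg23 K (V.tilde J Jh) * leg12 (0 : Op (Ten K H)) * star (leg23 K (V.tilde J Jh)) = 0
    rw [leg12, tens_zero_left, mul_zero, zero_mul]
  · change leg23 K (V.tilde J Jh) * leg12 (x.1 + y.1) * star (leg23 K (V.tilde J Jh)) = _
    rw [leg12_add, mul_add, add_mul]
  · change leg23 K (V.tilde J Jh) * leg12 (x.1 * y.1) * star (leg23 K (V.tilde J Jh)) = _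
    refine Eq.trans ?_ (show leg23 K (V.tilde J Jh) * leg12 x.1 * star (leg23 K (V.tilde J Jh)) *
      leg23 K (V.tilde J Jh) * leg12 y.1 * star (leg23 K (V.tilde J Jh)) = _ by
        simp only [mul_assoc])
    rw [h.tilde_mul_leg12 hδ x, leg12_mul]
    simp only [mul_assoc]
  · change leg23 K (V.tilde J Jh) * leg12 (star x.1) * star (leg23 K (V.tilde J Jh)) = _
    rw [star_mul, star_mul, star_star, leg12, leg12, star_tens, star_one, mul_assoc]

theorem eAct_mul_mem {y : Op H} (hy : y ∈ V.Sh) :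
    eAct V.qg b * tens 1 y ∈ crossed V.qg b δ V.Sh := by
  rw [h.eAct_eq_delta hδ]
  exact h.delta_mul_mem hδ _ hy

theorem eAct_idem : eAct V.qg b * eAct V.qg b = eAct V.qg b := by
  rw [h.eAct_eq_delta hδ, delta_mul_b hδ]

theorem star_eAct : star (eAct V.qg b) = eAct V.qg b := by
  rw [h.eAct_eq_delta hδ, ← map_star, ← map_star, star_one]

theorem exists_dualBase : ∃ bh : (V.qgHat.tgt)ᵐᵒᵖ →⋆ₙₐ[ℂ] crossed V.qg b δ V.Sh,
    ∀ x : Base n, (bh (op ⟨V.α x, x, rfl⟩) : Op (Ten K H)) =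
      eAct V.qg b * tens 1 (V.βh (op x)) := by
  have hx : ∀ t : V.qgHat.tgt, ∃ x, V.α x = t := fun t => t.2
  -- As α is injective, r is its inverse. All algebraic properties of r below follow by applying α.
  choose r hr using hx
  have hcomm : ∀ y, tens 1 (V.bh y) * eAct V.qg b = eAct V.qg b * tens 1 (V.bh y) := fun y =>
    eAct_comm fun x => (V.be_bh x y).symm
  refine ⟨
    { toFun := fun t => ⟨eAct V.qg b * tens 1 (V.bh (r (unop t))),
        h.eAct_mul_mem hδ (V.bh_mem_Sh h.mSh.one_mem _)⟩
      map_smul' := fun c t => Subtype.ext ?_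
      map_zero' := Subtype.ext ?_
      map_add' := fun s t => Subtype.ext ?_
      map_mul' := fun s t => Subtype.ext ?_
      map_star' := fun t => Subtype.ext ?_ }, fun x => ?_⟩
  · have h1 : r (unop (c • t)) = c • r (unop t) := V.α_injective (by
      rw [hr, map_smul, hr]; rfl)
    change eAct V.qg b * tens 1 (V.bh (r (unop (c • t)))) = c • (eAct V.qg b * tens 1 _)
    rw [h1, map_smul, tens_smul_right, op_mul_smul]
  · have h1 : r (unop (0 : (V.qgHat.tgt)ᵐᵒᵖ)) = 0 := V.α_injective (by
      rw [hr, map_zero]; rfl)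
    change eAct V.qg b * tens 1 (V.bh (r (unop (0 : (V.qgHat.tgt)ᵐᵒᵖ)))) = 0
    rw [h1, map_zero, tens_zero_right, mul_zero]
  · have h1 : r (unop (s + t)) = r (unop s) + r (unop t) := V.α_injective (by
      rw [hr, map_add, hr, hr]; rfl)
    change eAct V.qg b * tens 1 (V.bh (r (unop (s + t)))) =
      eAct V.qg b * tens 1 _ + eAct V.qg b * tens 1 _
    rw [h1, map_add, tens_add_right, mul_add]
  · have h1 : r (unop (s * t)) = r (unop t) * r (unop s) := V.α_injective (by
      rw [hr, map_mul, hr, hr]; rfl)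
    change eAct V.qg b * tens 1 (V.bh (r (unop (s * t)))) =
      eAct V.qg b * tens 1 (V.bh (r (unop s))) * (eAct V.qg b * tens 1 (V.bh (r (unop t))))
    rw [h1, bh_mul, mul_assoc, ← mul_assoc (tens 1 (V.bh (r (unop s)))), hcomm,
      ← mul_assoc, ← mul_assoc, h.eAct_idem hδ, mul_assoc, tens_mul, one_mul]
  · have h1 : r (unop (star t)) = star (r (unop t)) := V.α_injective (by
      rw [hr, map_star, hr]; rfl)
    change eAct V.qg b * tens 1 (V.bh (r (unop (star t)))) =
      star (eAct V.qg b * tens 1 (V.bh (r (unop t))))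
    rw [h1, star_mul, h.star_eAct hδ, star_tens, star_one, star_bh, hcomm]
  · have h1 : r ⟨V.α x, x, rfl⟩ = x := V.α_injective (hr _)
    change eAct V.qg b * tens 1 (V.bh (r ⟨V.α x, x, rfl⟩)) = _
    rw [h1]
    rfl

section Dual

variable {bh : (V.qgHat.tgt)ᵐᵒᵖ →⋆ₙₐ[ℂ] crossed V.qg b δ V.Sh}
  {δh : crossed V.qg b δ V.Sh →⋆ₙₐ[ℂ] Op (Ten (Ten K H) H)}
  (hbh : ∀ x : Base n, (bh (op ⟨V.α x, x, rfl⟩) : Op (Ten K H)) =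
      eAct V.qg b * tens 1 (V.βh (op x)))
  (hδh : ∀ x : crossed V.qg b δ V.Sh, δh x =
      leg23 K (V.tilde J Jh) * leg12 (x : Op (Ten K H)) * star (leg23 K (V.tilde J Jh)))

include hδh

theorem dualAct_delta (a : A) {y : Op H} (hy : y ∈ V.Sh) :
    δh ⟨δ a * tens 1 y, h.delta_mul_mem hδ a hy⟩ = leg12 (δ a) * leg23 K (V.comulHatₗ y) := by
  rw [hδh]
  exact h.tilde_conj_delta hδ a hy

theorem dualAct_sl {ι : Type*} [Fintype ι] (f : OrthonormalBasis ι ℂ H) (a : A) (c d : H) :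
    δh ⟨δ a * tens 1 (sl c d V.I), h.delta_mul_mem hδ a (V.sl_mem_Sh c d)⟩ =
      ∑ m, tens (δ a * tens 1 (sl c (f m) V.I)) (sl (f m) d V.I) := by
  rw [h.dualAct_delta hδ hδh a (V.sl_mem_Sh c d), V.comulHat_sl f, leg23_sum, Finset.mul_sum]
  refine Finset.sum_congr rfl fun m _ => ?_
  rw [leg23_tens, leg12, tens_mul, one_mul]

omit h hδ in
theorem dualAct_smul (c : ℂ) (x : Op (Ten K H)) (hx : x ∈ crossed V.qg b δ V.Sh) :
    δh ⟨c • x, SMulMemClass.smul_mem c hx⟩ = c • δh ⟨x, hx⟩ := by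
  have h1 : leg12 (c • x) = c • leg12 x := tens_smul_left c x 1
  rw [hδh, hδh]
  change leg23 K (V.tilde J Jh) * leg12 (c • x) * star (leg23 K (V.tilde J Jh)) = _
  rw [h1, op_mul_smul, op_smul_mul]

theorem dualAct_mem_tensor (x : crossed V.qg b δ V.Sh) :
    δh x ∈ vnTensor (crossed V.qg b δ V.Sh) V.Sh := by
  refine h.crossed_induction hδ (p := fun x => δh x ∈ vnTensor (crossed V.qg b δ V.Sh) V.Sh)
    (fun a c d => ?_) (fun x y hx hy => ?_) (fun c x hx hp => ?_) x
  · rw [h.dualAct_sl hδ hδh (stdOrthonormalBasis ℂ H)]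
    exact Submodule.sum_mem _ fun m _ => Submodule.subset_span
      ⟨_, h.delta_mul_mem hδ a (V.sl_mem_Sh _ _), _, V.sl_mem_Sh _ _, rfl⟩
  · rw [map_add]; exact Submodule.add_mem _ hx hy
  · rw [dualAct_smul hδh c x hx]
    exact Submodule.smul_mem _ c hp

/-- If the image of x is 0, then Ĩ₂₃(x ⊗ 1) = 0 by `tilde_mul_leg12`. Its slices give (1 ⊗ UsU)x = 0
for all s in `S`, and s = 1 yields x = 0 since U² = 1. -/
theorem dualAct_injective : Function.Injective δh := by
  rw [injective_iff_map_eq_zero]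
  intro x hx
  have h1 := h.tilde_mul_leg12 hδ x
  rw [← hδh, hx, zero_mul] at h1
  have h2 : ∀ s ∈ V.S, tens 1 (uOp J Jh * s * uOp J Jh) * x.1 = 0 := fun s hs => by
    refine V.S_induction (p := fun s => tens 1 (uOp J Jh * s * uOp J Jh) * x.1 = 0)
      (fun c d => ?_) (fun y z hy hz => ?_) (fun c y hy => ?_) hs
    · have h3 := congrArg (sl c d) h1
      rw [map_zero, leg12, sl_tens_right, sl_leg23, sl_tilde] at h3
      exact h3.symm
    · rw [mul_add, add_mul, tens_add_right, add_mul, hy, hz, add_zero]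
    · rw [op_mul_smul, op_smul_mul, tens_smul_right, op_smul_mul, hy]
      exact smul_zero _
  have h3 := h2 1 h.mS.one_mem
  rw [mul_one, h.uOp_mul_uOp, tens_one, one_mul] at h3
  exact Subtype.ext h3

omit h hδ in
theorem dualAct_normal : IsNormalMap δh := by
  let t : TopologicalSpace (crossed V.qg b δ V.Sh) := (sigmaWeak (Ten K H)).induced Subtype.val
  have h1 : (δh : crossed V.qg b δ V.Sh → Op (Ten (Ten K H) H)) = fun x =>
      leg23 K (V.tilde J Jh) * leg12 x.1 * star (leg23 K (V.tilde J Jh)) := funext hδh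
  unfold IsNormalMap
  rw [h1]
  have h2 : Continuous[t, sigmaWeak (Ten (Ten K H) H)]
      fun x : crossed V.qg b δ V.Sh => leg12 x.1 :=
    @Continuous.comp (crossed V.qg b δ V.Sh) (Op (Ten K H)) (Op (Ten (Ten K H) H)) t (sigmaWeak _)
      (sigmaWeak _) _ _ (continuous_sw_tens 1) continuous_induced_dom
  exact @Continuous.comp (crossed V.qg b δ V.Sh) (Op (Ten (Ten K H) H)) (Op (Ten (Ten K H) H)) t
    (sigmaWeak _) (sigmaWeak _) _ _ (continuous_sw_mul _ _) h2

end Dual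

end Canonical

end Mpi

/-! ### Coassociativity and the axioms of the dual coaction -/

namespace Mpi

variable {G : Type w} [Fintype G] {n : G → ℕ}
variable {H : Type v} [NormedAddCommGroup H] [InnerProductSpace ℂ H]
  [FiniteDimensional ℂ H] [CompleteSpace H] {V : Mpi n H}
  {e eh : H} {J Jh : H ≃ₗᵢ⋆[ℂ] H} {D Di Dh Dhi : Op H}
  {K : Type u} [NormedAddCommGroup K] [InnerProductSpace ℂ K] [CompleteSpace K]
  {A : NonUnitalStarSubalgebra ℂ (Op K)} {b : (V.qg.tgt)ᵐᵒᵖ →⋆ₙₐ[ℂ] A}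
  {δ : A →⋆ₙₐ[ℂ] Op (Ten K H)}

variable (V) in
/-- The linear map `i ⊗ Γ̂`. -/
def comulHatTail (L : Type u) [NormedAddCommGroup L] [InnerProductSpace ℂ L] [CompleteSpace L] :
    Op (Ten L H) →ₗ[ℂ] Op (Ten (Ten L H) H) := rebracketₗ ∘ₗ idTensorₗ V.comulHatₗ

variable (V) in
theorem comulHatTail_tens {ι : Type*} [Fintype ι] (f : OrthonormalBasis ι ℂ H) (x : Op K) (c d : H) :
    V.comulHatTail K (tens x (sl c d V.I)) =
      ∑ m, tens (tens x (sl c (f m) V.I)) (sl (f m) d V.I) := by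
  change rebracketₗ (idTensor V.comulHatₗ _) = _
  rw [idTensor_tens, V.comulHat_sl f, tens_sum_right, map_sum]
  exact Finset.sum_congr rfl fun m _ => rebracket_tens _ _ _

section Coassoc

variable {M : NonUnitalStarSubalgebra ℂ (Op K)} {ρ : M →⋆ₙₐ[ℂ] Op (Ten K H)}
  (hm : ∀ x, ρ x ∈ amp M H)

/-- Elements x(d) that transform like the columns of a corepresentation satisfy coassociativity
formally: both sides are the double sum of x(f_k) ⊗ I_{km} ⊗ I_{md}. The generators of the crossed
product have this form. -/
theorem coassoc_of_coefficients {ι : Type*} [Fintype ι] (f : OrthonormalBasis ι ℂ H) (x : H → M)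
    (hx : ∀ d, ρ (x d) = ∑ m, tens (x (f m) : Op K) (sl (f m) d V.I)) (d : H) :
    ampHom ρ H ⟨ρ (x d), hm _⟩ = V.comulHatTail K (ρ (x d)) := by
  have h2 : ∀ m, tens (x (f m) : Op K) (sl (f m) d V.I) ∈ amp M H := fun m =>
    tens_mem_amp (x (f m)).2 _
  have h3 : (⟨ρ (x d), hm _⟩ : amp M H) = ∑ m, ⟨_, h2 m⟩ := by
    refine Subtype.ext ?_
    rw [AddSubmonoidClass.coe_finsetSum]
    exact hx d
  rw [h3, map_sum, hx, map_sum]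
  simp only [ampHom_tens, hx, V.comulHatTail_tens f, tens_sum_left]
  exact Finset.sum_comm

theorem coassoc_add {x y : M} (hx : ampHom ρ H ⟨ρ x, hm x⟩ = V.comulHatTail K (ρ x))
    (hy : ampHom ρ H ⟨ρ y, hm y⟩ = V.comulHatTail K (ρ y)) :
    ampHom ρ H ⟨ρ (x + y), hm (x + y)⟩ = V.comulHatTail K (ρ (x + y)) := by
  have h1 : (⟨ρ (x + y), hm (x + y)⟩ : amp M H) = ⟨ρ x, hm x⟩ + ⟨ρ y, hm y⟩ :=
    Subtype.ext (map_add ρ x y)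
  rw [h1, map_add, hx, hy, map_add, map_add]

set_option synthInstance.maxHeartbeats 400000 in
theorem coassoc_smul (c : ℂ) (x : Op K) (hM : x ∈ M)
    (hx : ampHom ρ H ⟨ρ ⟨x, hM⟩, hm _⟩ = V.comulHatTail K (ρ ⟨x, hM⟩)) :
    ampHom ρ H ⟨ρ ⟨c • x, SMulMemClass.smul_mem c hM⟩, hm _⟩ =
      V.comulHatTail K (ρ ⟨c • x, SMulMemClass.smul_mem c hM⟩) := by
  have h0 : ρ ⟨c • x, SMulMemClass.smul_mem c hM⟩ = c • ρ ⟨x, hM⟩ := map_smul ρ c ⟨x, hM⟩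
  have h1 : (⟨ρ ⟨c • x, SMulMemClass.smul_mem c hM⟩, hm _⟩ : amp M H) =
      c • ⟨ρ ⟨x, hM⟩, hm _⟩ := Subtype.ext h0
  rw [h1, map_smul, hx, h0, map_smul]

end Coassoc

namespace Canonical

variable (h : V.Canonical e eh J Jh D Di Dh Dhi) (hδ : IsRightAction V.qg A b δ)

include h hδ

section Dual

variable {bh : (V.qgHat.tgt)ᵐᵒᵖ →⋆ₙₐ[ℂ] crossed V.qg b δ V.Sh}
  {δh : crossed V.qg b δ V.Sh →⋆ₙₐ[ℂ] Op (Ten (Ten K H) H)}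
  (hbh : ∀ x : Base n, (bh (op ⟨V.α x, x, rfl⟩) : Op (Ten K H)) =
      eAct V.qg b * tens 1 (V.βh (op x)))
  (hδh : ∀ x : crossed V.qg b δ V.Sh, δh x =
      leg23 K (V.tilde J Jh) * leg12 (x : Op (Ten K H)) * star (leg23 K (V.tilde J Jh)))

include hδh

theorem dualAct_coassoc (x : crossed V.qg b δ V.Sh) :
    tensorId (fun x => δh x) (δh x) = rebracket (idTensor V.comulHatₗ (δh x)) := by
  have hm : ∀ x, δh x ∈ amp (crossed V.qg b δ V.Sh) H := fun x =>
    vnTensor_le_amp (h.dualAct_mem_tensor hδ hδh x)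
  rw [tensorId_eq_ampHom δh ⟨δh x, hm x⟩]
  change _ = V.comulHatTail (Ten K H) (δh x)
  refine h.crossed_induction hδ (p := fun x => ampHom δh H ⟨δh x, hm x⟩ =
    V.comulHatTail (Ten K H) (δh x))
    (fun a c d => ?_) (fun x y hx hy => ?_) (fun c x hx hp => ?_) x
  · let X : H → crossed V.qg b δ V.Sh := fun d =>
      ⟨δ a * tens 1 (sl c d V.I), h.delta_mul_mem hδ a (V.sl_mem_Sh c d)⟩
    have hX := h.dualAct_sl hδ hδh (stdOrthonormalBasis ℂ H) a c
    have hX' : ∀ d, δh (X d) = ∑ m, tens (X (stdOrthonormalBasis ℂ H m) : Op (Ten K H))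
        (sl (stdOrthonormalBasis ℂ H m) d V.I) := hX
    have h2 := coassoc_of_coefficients (K := Ten K H) (V := V) (ρ := δh) hm
      (stdOrthonormalBasis ℂ H) X hX' d
    exact h2
  · exact coassoc_add hm hx hy
  · exact coassoc_smul (K := Ten K H) (V := V) (ρ := δh) hm c x hx hp

omit hδh
include hbh

omit h hδ in
theorem eAct_dual : eAct V.qgHat bh = leg12 (eAct V.qg b) * leg23 K (star V.I * V.I) := by
  have h1 : eAct V.qgHat bh = ∑ γ, ∑ i, ∑ j, ((n γ : ℂ)⁻¹) •
      tens (bh (op ⟨V.α (unit n γ i j), _, rfl⟩) : Op (Ten K H)) (V.al (unit n γ j i)) := rfl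
  rw [h1, V.initial']
  simp only [hbh, leg23_sum, leg23_smul, Finset.mul_sum, op_mul_smul]
  refine Finset.sum_congr rfl fun γ _ => Finset.sum_congr rfl fun i _ =>
    Finset.sum_congr rfl fun j _ => congrArg _ ?_
  rw [leg23_tens, leg12, tens_mul, one_mul]
  rfl

omit h in
-- If e_{b,i}(1 ⊗ β̂(x)) = 0, slicing the second leg and using injectivity of b gives ∑ n_γ⁻¹⟨a,
-- β(e_ij)β̂(x)v⟩β(e_ji) = 0 for all a and v. Letting a run through a basis and applying the
-- operators to a, the sum over the basis is ∑ n_γ⁻¹β(e_ji)β(e_ij)β̂(x)v = β̂(x)v, so β̂(x) = 0.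
theorem dualBase_injective : Function.Injective bh := by
  rw [injective_iff_map_eq_zero]
  intro t ht
  obtain ⟨⟨_, x, rfl⟩, rfl⟩ := op_surjective t
  have h1 : eAct V.qg b * tens 1 (V.bh x) = 0 := by
    refine (hbh x).symm.trans ?_
    exact congrArg Subtype.val ht
  let f := stdOrthonormalBasis ℂ H
  let B : Base n →ₗ[ℂ] Op K :=
    { toFun := fun y => (b (op ⟨V.β (op y), op y, rfl⟩) : Op K)
      map_add' := fun y z => by
        have h1 : (⟨V.β (op (y + z)), op (y + z), rfl⟩ : V.qg.tgt) =
            ⟨V.β (op y), op y, rfl⟩ + ⟨V.β (op z), op z, rfl⟩ :=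
          Subtype.ext (map_add V.β (op y) (op z))
        rw [h1, op_add, map_add]
        rfl
      map_smul' := fun c y => by
        have h1 : (⟨V.β (op (c • y)), op (c • y), rfl⟩ : V.qg.tgt) =
            c • ⟨V.β (op y), op y, rfl⟩ := Subtype.ext (map_smul V.β c (op y))
        rw [h1, op_smul, map_smul]
        rfl }
  have h2 : ∀ a v : H, ∑ γ, ∑ i, ∑ j, ((n γ : ℂ)⁻¹ * ⟪a, V.be (unit n γ i j) (V.bh x v)⟫_ℂ) •
      V.be (unit n γ j i) = 0 := fun a v => by
    have h3 := congrArg (sl a v) h1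
    rw [sl_tens_right, mul_one, eAct_eq, map_zero] at h3
    simp only [map_sum, map_smul, sl_tens, smul_smul] at h3
    have h4 : B (∑ γ, ∑ i, ∑ j, ((n γ : ℂ)⁻¹ * ⟪a, V.be (unit n γ i j) (V.bh x v)⟫_ℂ) •
        unit n γ j i) = 0 := by
      simp only [map_sum, map_smul]
      exact h3
    have h5 := hδ.b_faithful ((Subtype.ext h4 : _ = (0 : A)).trans (map_zero b).symm)
    have h6 : V.be (∑ γ, ∑ i, ∑ j, ((n γ : ℂ)⁻¹ * ⟪a, V.be (unit n γ i j) (V.bh x v)⟫_ℂ) •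
        unit n γ j i) = 0 := congrArg (fun t => ((unop t : V.qg.tgt) : Op H)) h5
    simpa only [map_sum, map_smul] using h6
  have h3 : V.bh x = 0 := by
    ext v
    have h4 : (∑ γ, ∑ i, ∑ j, ((n γ : ℂ)⁻¹) •
        (V.be (unit n γ j i) * V.be (unit n γ i j))) (V.bh x v) = V.bh x v := by
      simp only [← be_mul, ← map_smul, ← map_sum, sum_unit_mul_unit, be_one]
      rfl
    rw [← h4]
    have h5 : ∀ w, V.bh x v = w → (∑ γ, ∑ i, ∑ j, ((n γ : ℂ)⁻¹) •
        (V.be (unit n γ j i) * V.be (unit n γ i j))) w = ∑ m, (∑ γ, ∑ i, ∑ j,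
        ((n γ : ℂ)⁻¹ * ⟪f m, V.be (unit n γ i j) w⟫_ℂ) • V.be (unit n γ j i)) (f m) :=
      fun w _ => by
        simp only [sum_apply, smul_apply, op_mul_apply]
        conv_rhs => rw [Finset.sum_comm]
        refine Finset.sum_congr rfl fun γ _ => ?_
        conv_rhs => rw [Finset.sum_comm]
        refine Finset.sum_congr rfl fun i _ => ?_
        conv_rhs => rw [Finset.sum_comm]
        refine Finset.sum_congr rfl fun j _ => ?_
        conv_lhs => rw [← f.sum_repr' (V.be (unit n γ i j) w)]
        simp only [map_sum, map_smul, Finset.smul_sum, smul_smul]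
    rw [h5 _ rfl]
    simp only [h2, zero_apply, Finset.sum_const_zero]
  have h4 : x = 0 := op_injective (V.βh_injective (h3.trans (map_zero V.βh).symm))
  subst h4
  exact congrArg op (Subtype.ext (map_zero V.α))

include hδh

theorem isRightAction_dual : IsRightAction V.qgHat (crossed V.qg b δ V.Sh) bh δh where
  vonNeumann := isVonNeumann_vnGen _
  b_unital x := by
    have h1 : (bh 1 : Op (Ten K H)) = δ (b 1) := by
      have h2 := hbh 1
      have h3 : (⟨V.α 1, 1, rfl⟩ : V.qgHat.tgt) = 1 := Subtype.ext (map_one V.α)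
      rw [h3, op_one, op_one, map_one V.βh, tens_one, mul_one, h.eAct_eq_delta hδ] at h2
      exact h2
    have h4 : ∀ x : crossed V.qg b δ V.Sh, δ (b 1) * x.1 = x.1 := fun x => by
      refine h.crossed_induction hδ (p := fun x => δ (b 1) * x.1 = x.1)
        (fun a c d => ?_) (fun x y hx hy => ?_) (fun c x hx hp => ?_) x
      · change δ (b 1) * (δ a * tens 1 _) = δ a * tens 1 _
        rw [← mul_assoc, delta_b_mul hδ]
      · change δ (b 1) * (x.1 + y.1) = x.1 + y.1
        rw [mul_add, hx, hy]
      · change δ (b 1) * (c • x) = c • x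
        rw [op_mul_smul]
        exact congrArg (c • ·) hp
    refine ⟨Subtype.ext ?_, Subtype.ext ?_⟩
    · change (bh 1 : Op (Ten K H)) * x.1 = x.1
      rw [h1, h4]
    · change x.1 * (bh 1 : Op (Ten K H)) = x.1
      -- The right unit property is the adjoint of the left one.
      have h5 := congrArg star (h4 (star x))
      change star (δ (b 1) * star x.1) = star (star x.1) at h5
      rw [star_mul, star_star, ← h.eAct_eq_delta hδ, h.star_eAct hδ, h.eAct_eq_delta hδ] at h5
      rw [h1, h5]
  b_faithful := dualBase_injective hδ hbh
  mem_tensor := h.dualAct_mem_tensor hδ hδh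
  injective := h.dualAct_injective hδ hδh
  normal := dualAct_normal hδh
  coassoc := h.dualAct_coassoc hδ hδh
  map_b := by
    rintro ⟨_, x, rfl⟩
    -- With κ̂(α(x)) = β̂(x) and Γ̂(β̂(x)) = I*I(1 ⊗ β̂(x)), both sides become (δ(1) ⊗ 1)(I*I)₂₃(1 ⊗
    -- β̂(x)).
    have h1 : V.qgHat.antipode ((⟨V.α x, x, rfl⟩ : V.qgHat.tgt) : Op H) = V.bh x :=
      h.antipodeHat_al x
    have h2 := V.bh_mem_Sh h.mSh.one_mem x
    have h3 : bh (op ⟨V.α x, x, rfl⟩) = ⟨δ (b 1) * tens 1 (V.bh x), h.delta_mul_mem hδ _ h2⟩ :=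
      Subtype.ext ((hbh x).trans (by rw [h.eAct_eq_delta hδ]; rfl))
    refine (congrArg δh h3).trans ?_
    rw [h.dualAct_delta hδ hδh _ h2]
    refine Eq.trans ?_ (congrArg (fun z => eAct V.qgHat bh * tens 1 z) h1).symm
    change _ = eAct V.qgHat bh * tens 1 (V.bh x)
    rw [eAct_dual hbh, comulHat_bh, leg23_mul, leg23_one_tens, h.eAct_eq_delta hδ, mul_assoc]

end Dual

end Canonical

end Mpi

/-! ### Homomorphisms of von Neumann algebras -/

section Homomorphisms

variable {K : Type u} [NormedAddCommGroup K] [InnerProductSpace ℂ K] [CompleteSpace K]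
variable {L : Type w} [NormedAddCommGroup L] [InnerProductSpace ℂ L] [CompleteSpace L]
variable {M B : NonUnitalStarSubalgebra ℂ (Op K)}

/-- The elements of `B` that `ρ` maps into `C`. -/
def pullback (ρ : B →⋆ₙₐ[ℂ] Op L) (C : NonUnitalStarSubalgebra ℂ (Op L)) :
    NonUnitalStarSubalgebra ℂ (Op K) where
  carrier := {T | ∃ hT : T ∈ B, ρ ⟨T, hT⟩ ∈ C}
  add_mem' := by
    rintro x y ⟨hx, hx'⟩ ⟨hy, hy'⟩
    exact ⟨add_mem hx hy, (map_add ρ ⟨x, hx⟩ ⟨y, hy⟩).symm ▸ add_mem hx' hy'⟩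
  zero_mem' := ⟨zero_mem _, (map_zero ρ).symm ▸ zero_mem C⟩
  mul_mem' := by
    rintro x y ⟨hx, hx'⟩ ⟨hy, hy'⟩
    exact ⟨mul_mem hx hy, (map_mul ρ ⟨x, hx⟩ ⟨y, hy⟩).symm ▸ mul_mem hx' hy'⟩
  smul_mem' := by
    rintro c x ⟨hx, hx'⟩
    exact ⟨SMulMemClass.smul_mem c hx, (map_smul ρ c ⟨x, hx⟩).symm ▸ SMulMemClass.smul_mem c hx'⟩
  star_mem' := by
    rintro x ⟨hx, hx'⟩
    exact ⟨star_mem hx, (map_star ρ ⟨x, hx⟩).symm ▸ star_mem hx'⟩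

theorem isVonNeumann_pullback {ρ : B →⋆ₙₐ[ℂ] Op L} (hρ : IsNormalMap ρ) (hB : IsVonNeumann B)
    {C : NonUnitalStarSubalgebra ℂ (Op L)} (hC : IsVonNeumann C) :
    IsVonNeumann (pullback ρ C) :=
  isClosed_sw_of_subtype (P := fun x => ρ x ∈ C) hB
    (@IsClosed.preimage _ _ ((sigmaWeak K).induced Subtype.val) (sigmaWeak L) _ hρ _ hC)

/-- The image of a homomorphism with a `σ`-weakly continuous left inverse is `σ`-weakly closed. -/
theorem isVonNeumann_range {ρ : B →⋆ₙₐ[ℂ] Op L} (hρ : IsNormalMap ρ) (hB : IsVonNeumann B)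
    {Ψ : Op L → Op K} (hΨ : Continuous[sigmaWeak L, sigmaWeak K] Ψ) (hl : ∀ T, Ψ (ρ T) = T.1) :
    IsVonNeumann (NonUnitalStarAlgHom.range ρ) := by
  let t : TopologicalSpace {X : Op L // Ψ X ∈ B} := (sigmaWeak L).induced Subtype.val
  have hv : Continuous[t, sigmaWeak L] fun X : {X : Op L // Ψ X ∈ B} => X.1 :=
    continuous_induced_dom
  have h1 : Continuous[t, sigmaWeak K] fun X : {X : Op L // Ψ X ∈ B} => Ψ X.1 :=
    @Continuous.comp _ _ _ t (sigmaWeak L) (sigmaWeak K) _ _ hΨ hv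
  have h2 := IsNormalMap.comp hρ h1 fun X => X.2
  have h3 := isClosed_sw_eq h2 hv
  obtain ⟨s, hs, h4⟩ := (@isClosed_induced_iff _ _ (sigmaWeak L) _ _).mp h3
  -- X is in the range iff Ψ(X) lies in B and ρ(Ψ(X)) = X. The second condition is an equalizer,
  -- closed in the subspace where the first holds.
  have h5 : ((NonUnitalStarAlgHom.range ρ : NonUnitalStarSubalgebra ℂ (Op L)) : Set (Op L)) =
      s ∩ Ψ ⁻¹' B := by
    ext X
    constructor
    · rintro ⟨T, rfl⟩
      have h6 : Ψ (ρ T) ∈ B := (hl T).symm ▸ T.2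
      refine ⟨?_, h6⟩
      have h7 : (⟨ρ T, h6⟩ : {X : Op L // Ψ X ∈ B}) ∈ Subtype.val ⁻¹' s := by
        rw [h4]
        exact congrArg ρ (Subtype.ext (hl T))
      exact h7
    · rintro ⟨h6, h7⟩
      have h8 : (⟨X, h7⟩ : {X : Op L // Ψ X ∈ B}) ∈ Subtype.val ⁻¹' s := h6
      rw [h4] at h8
      exact ⟨⟨Ψ X, h7⟩, h8⟩
  unfold IsVonNeumann
  rw [h5]
  exact @IsClosed.inter _ _ _ (sigmaWeak L) hs
    (@IsClosed.preimage _ _ (sigmaWeak L) (sigmaWeak K) _ hΨ _ hB)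

theorem nonempty_equiv_of_range_eq (ρ : B →⋆ₙₐ[ℂ] Op L) (hρ : Function.Injective ρ)
    {C : NonUnitalStarSubalgebra ℂ (Op L)} (hC : NonUnitalStarAlgHom.range ρ = C) :
    Nonempty (C ≃⋆ₐ[ℂ] B) := by
  have hm : ∀ T, ρ T ∈ C := fun T => hC ▸ ⟨T, rfl⟩
  have hs : ∀ X : C, ∃ T, ρ T = X.1 := fun X => by
    have h1 : X.1 ∈ NonUnitalStarAlgHom.range ρ := hC.symm ▸ X.2
    exact h1
  choose g hg using hs
  exact ⟨StarAlgEquiv.symm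
    { toFun := fun T => ⟨ρ T, hm T⟩
      invFun := g
      left_inv := fun T => hρ (hg _)
      right_inv := fun X => Subtype.ext (hg X)
      map_mul' := fun T T' => Subtype.ext (map_mul ρ T T')
      map_add' := fun T T' => Subtype.ext (map_add ρ T T')
      map_star' := fun T => Subtype.ext (map_star ρ T)
      map_smul' := fun c T => Subtype.ext (map_smul ρ c T) }⟩

/-- The pullback of `vnGen Y` is a closed algebra containing X, so ρ maps into `vnGen Y`. The range
is closed because of Ψ and contains Y, so ρ is onto. Injectivity comes from Ψ as well. -/
theorem nonempty_equiv_vnGen {X : Set (Op K)} {Y : Set (Op L)} {ρ : vnGen X →⋆ₙₐ[ℂ] Op L}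
    (hρ : IsNormalMap ρ) {Ψ : Op L → Op K} (hΨ : Continuous[sigmaWeak L, sigmaWeak K] Ψ)
    (hl : ∀ T, Ψ (ρ T) = T.1) (hX : X ⊆ pullback ρ (vnGen Y))
    (hY : Y ⊆ NonUnitalStarAlgHom.range ρ) : Nonempty (vnGen Y ≃⋆ₐ[ℂ] vnGen X) := by
  have hB := isVonNeumann_vnGen X
  refine nonempty_equiv_of_range_eq ρ
    (fun T T' h => Subtype.ext (by rw [← hl T, ← hl T', h])) (le_antisymm ?_ ?_)
  · rintro _ ⟨T, rfl⟩
    exact (vnGen_le (isVonNeumann_pullback hρ hB (isVonNeumann_vnGen Y)) hX T.2).2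
  · exact vnGen_le (isVonNeumann_range hρ hB hΨ hl) hY

/-- The homomorphism `T ↦ W* π(T) W`, for `W` a partial isometry whose range contains those of the
operators `π(T)`. -/
def compress (π : B →⋆ₙₐ[ℂ] Op L) (W : Op L) (hW : ∀ T, π T * (W * star W) = π T) :
    B →⋆ₙₐ[ℂ] Op L where
  toFun T := star W * π T * W
  map_smul' c T := by
    have h1 : π (c • T) = c • π T := map_smul π c T
    rw [h1, op_mul_smul, op_smul_mul]
    rfl
  map_zero' := by
    have h1 : π 0 = 0 := map_zero π
    rw [h1, mul_zero, zero_mul]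
  map_add' T T' := by
    have h1 : π (T + T') = π T + π T' := map_add π T T'
    rw [h1, mul_add, add_mul]
  map_mul' T T' := by
    have h1 : π (T * T') = π T * π T' := map_mul π T T'
    rw [h1]
    conv_lhs => rw [← hW T]
    simp only [mul_assoc]
  map_star' T := by
    have h1 : π (star T) = star (π T) := map_star π T
    rw [h1, star_mul, star_mul, star_star, mul_assoc]

theorem compress_normal {π : B →⋆ₙₐ[ℂ] Op L} (hπ : IsNormalMap π) {W : Op L}
    (hW : ∀ T, π T * (W * star W) = π T) : IsNormalMap (compress π W hW) :=
  @Continuous.comp _ _ _ ((sigmaWeak K).induced Subtype.val) (sigmaWeak L) (sigmaWeak L) _ _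
    (continuous_sw_mul (star W) W) hπ

theorem mul_compress_mul {π : B →⋆ₙₐ[ℂ] Op L} {W : Op L}
    (hW : ∀ T, π T * (W * star W) = π T) (T : B) : W * compress π W hW T * star W = π T := by
  have h1 := congrArg star (hW (star T))
  have h2 : π (star T) = star (π T) := map_star π T
  rw [h2, star_mul, star_mul, star_star, star_star] at h1
  change W * (star W * π T * W) * star W = _
  rw [mul_assoc, mul_assoc, mul_assoc, hW T, ← mul_assoc, h1]

/-- The elements of `M` with support and range under the projection `p`. -/
def corner (M : NonUnitalStarSubalgebra ℂ (Op K)) (p : Op K) (hp : star p = p) :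
    NonUnitalStarSubalgebra ℂ (Op K) where
  carrier := {T | T ∈ M ∧ p * T = T ∧ T * p = T}
  add_mem' := fun ⟨h1, h2, h3⟩ ⟨h1', h2', h3'⟩ =>
    ⟨add_mem h1 h1', by rw [mul_add, h2, h2'], by rw [add_mul, h3, h3']⟩
  zero_mem' := ⟨zero_mem M, mul_zero p, zero_mul p⟩
  mul_mem' := fun ⟨h1, h2, h3⟩ ⟨h1', h2', h3'⟩ =>
    ⟨mul_mem h1 h1', by rw [← mul_assoc, h2], by rw [mul_assoc, h3']⟩
  smul_mem' := fun c _ ⟨h1, h2, h3⟩ =>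
    ⟨SMulMemClass.smul_mem c h1, by rw [op_mul_smul, h2], by rw [op_smul_mul, h3]⟩
  star_mem' := by
    rintro x ⟨h1, h2, h3⟩
    exact ⟨star_mem h1, by rw [← hp, ← star_mul, h3], by rw [← hp, ← star_mul, h2]⟩

theorem isVonNeumann_corner (hM : IsVonNeumann M) {p : Op K} (hp : star p = p) :
    IsVonNeumann (corner M p hp) := by
  let _ := sigmaWeak K
  have h1 : Continuous fun x : Op K => p * x := by
    have := continuous_sw_mul p 1
    simpa only [mul_one] using this
  have h2 : Continuous fun x : Op K => x * p := by
    have := continuous_sw_mul 1 p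
    simpa only [one_mul] using this
  exact IsClosed.inter hM ((isClosed_sw_eq h1 continuous_id).inter
    (isClosed_sw_eq h2 continuous_id))

end Homomorphisms

/-! ### The double crossed product -/

namespace Mpi

variable {G : Type w} [Fintype G] {n : G → ℕ}
variable {H : Type v} [NormedAddCommGroup H] [InnerProductSpace ℂ H]
  [FiniteDimensional ℂ H] [CompleteSpace H] {V : Mpi n H}
  {e eh : H} {J Jh : H ≃ₗᵢ⋆[ℂ] H} {D Di Dh Dhi : Op H}
  {K : Type u} [NormedAddCommGroup K] [InnerProductSpace ℂ K] [CompleteSpace K]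
  {A : NonUnitalStarSubalgebra ℂ (Op K)} {b : (V.qg.tgt)ᵐᵒᵖ →⋆ₙₐ[ℂ] A}
  {δ : A →⋆ₙₐ[ℂ] Op (Ten K H)}

theorem I_comm_commutant {r : Op H} (hr : r ∈ Set.centralizer (V.S : Set (Op H))) :
    V.I * tens 1 r = tens 1 r * V.I := by
  refine op_ext_lsl fun ξ η => ?_
  rw [lsl_tens_left, lsl_tens_right, star_one]
  exact hr _ (V.lsl_mem_S ξ η)

/-- The generators of the algebra isomorphic to the double crossed product. -/
def doubleGen (V : Mpi n H) (b : (V.qg.tgt)ᵐᵒᵖ →⋆ₙₐ[ℂ] A) (δ : A →⋆ₙₐ[ℂ] Op (Ten K H)) :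
    Set (Op (Ten K H)) :=
  Set.range δ ∪ (fun x => δ (b 1) * tens 1 x) '' Set.centralizer (Set.range V.β)

section Action

theorem star_delta_b : star (δ (b 1)) = δ (b 1) := by
  rw [← map_star, ← map_star, star_one]

variable (hδ : IsRightAction V.qg A b δ)

include hδ

/-- `(i ⊗ ε)δ = i` for a counit `ε`. -/
theorem sliceRight_delta {ω : Module.Dual ℂ (Op H)}
    (hω : ∀ s ∈ V.S, sliceRight ω (V.comulₗ s) = s) (a : A) : sliceRight ω (δ a) = a := by
  obtain ⟨h1, h2⟩ := sliceRight_ampHom δ ω ⟨δ a, delta_mem_amp hδ a⟩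
  have h3 : sliceRight ω (ampHom δ H ⟨δ a, delta_mem_amp hδ a⟩) = δ a := by
    rw [ampHom_delta hδ, ← rebracket_idTensor_comul]
    refine Submodule.span_induction (p := fun X _ =>
      sliceRight ω (rebracketₗ (idTensorₗ V.comulₗ X)) = X) ?_ ?_
      (fun X Y _ _ hX hY => ?_) (fun c X _ hX => ?_) (hδ.mem_tensor a)
    · rintro _ ⟨a, -, s, hs, rfl⟩
      change sliceRight ω (rebracket (idTensor V.comulₗ (tens a s))) = _
      rw [idTensor_tens, sliceRight_rebracket, hω s hs]
    · rw [map_zero, map_zero, ← sliceRightₗ_apply, map_zero]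
    · rw [← sliceRightₗ_apply] at hX hY ⊢
      rw [map_add, map_add, map_add, hX, hY]
    · rw [← sliceRightₗ_apply] at hX ⊢
      rw [map_smul, map_smul, map_smul, hX]
  -- The counit applied to the last leg of (δ ⊗ i)δ(a) = (i ⊗ Γ)δ(a) shows that δ has the same value
  -- at (i ⊗ ω)δ(a) and at a. Injectivity of δ concludes.
  exact congrArg Subtype.val (hδ.injective (h2.symm.trans h3))

/-- This is the condition under which compression by I₂₃ is multiplicative. Since T = Tδ(1), it
reduces to (δ ⊗ i)δ(1) = I₂₃(δ(1) ⊗ 1)I₂₃*, which the final projection leaves unchanged on the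
right. -/
theorem ampHom_mul_final {T : Op (Ten K H)} (hT : T ∈ amp A H) (h1 : T * δ (b 1) = T) :
    ampHom δ H ⟨T, hT⟩ * (leg23 K V.I * star (leg23 K V.I)) = ampHom δ H ⟨T, hT⟩ := by
  have h2 : ampHom δ H ⟨T, hT⟩ =
      ampHom δ H ⟨T, hT⟩ * ampHom δ H ⟨δ (b 1), delta_mem_amp hδ (b 1)⟩ := by
    rw [← map_mul]
    exact congrArg (ampHom δ H) (Subtype.ext h1.symm)
  have h3 : ampHom δ H ⟨δ (b 1), delta_mem_amp hδ (b 1)⟩ *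
      (leg23 K V.I * star (leg23 K V.I)) = ampHom δ H ⟨δ (b 1), delta_mem_amp hδ (b 1)⟩ := by
    rw [← mul_assoc, ampHom_delta_mul hδ, star_leg23, ← ampHom_delta hδ]
  rw [h2, mul_assoc, h3]

/-- Valid for every y in L(H), so the same formula evaluates the isomorphism on Ŝ, where I*(1 ⊗ y)I
is Γ̂(y), and on S', where it is I*I(1 ⊗ y). -/
theorem compress_delta_mul (a : A) (y : Op H) :
    star (leg23 K V.I) * ampHom δ H ⟨δ a * tens 1 y, mul_tens_mem_amp (delta_mem_amp hδ a) y⟩ *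
      leg23 K V.I = leg12 (δ a) * leg23 K (star V.I * tens 1 y * V.I) := by
  rw [ampHom_mul_tens δ ⟨δ a, delta_mem_amp hδ a⟩ y, ampHom_delta hδ, star_leg23,
    ← leg23_one_tens (K := K) y]
  have h1 : leg23 K (star V.I) * (leg23 K V.I * leg12 (δ a) * leg23 K (star V.I) *
      leg23 K (tens 1 y)) * leg23 K V.I = (leg23 K (star V.I * V.I) * leg12 (δ a)) *
        leg23 K (star V.I * tens 1 y * V.I) := by
    simp only [leg23_mul, mul_assoc]
  rw [h1, leg23_leg12_comm (fun s hs => V.initial_comm_S hs) (hδ.mem_tensor a), mul_assoc,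
    ← leg23_mul, ← mul_assoc (star V.I * V.I), ← mul_assoc (star V.I * V.I),
    mul_assoc (star V.I) V.I, V.star_I_I_star]

end Action

namespace Canonical

variable (h : V.Canonical e eh J Jh D Di Dh Dhi) (hδ : IsRightAction V.qg A b δ)

include h hδ

theorem delta_b_comm {y : Op H} (hy : y ∈ Set.centralizer (Set.range V.β)) :
    tens 1 y * δ (b 1) = δ (b 1) * tens 1 y := by
  rw [← h.eAct_eq_delta hδ]
  exact eAct_comm fun x => (hy _ ⟨_, rfl⟩).symm

theorem vnGen_doubleGen_le :
    vnGen (doubleGen V b δ) ≤ corner (amp A H) (δ (b 1)) (star_delta_b) := by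
  refine vnGen_le (isVonNeumann_corner (isVonNeumann_amp hδ.vonNeumann) _) ?_
  rintro _ (⟨a, rfl⟩ | ⟨y, hy, rfl⟩)
  · exact ⟨delta_mem_amp hδ a, delta_b_mul hδ a, delta_mul_b hδ a⟩
  · refine ⟨mul_tens_mem_amp (delta_mem_amp hδ _) y, ?_, ?_⟩
    · change δ (b 1) * (δ (b 1) * tens 1 y) = δ (b 1) * tens 1 y
      rw [← mul_assoc, delta_b_mul hδ]
    · change δ (b 1) * tens 1 y * δ (b 1) = δ (b 1) * tens 1 y
      rw [mul_assoc, h.delta_b_comm hδ hy, ← mul_assoc, delta_b_mul hδ]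

theorem vnGen_doubleGen_le_amp : vnGen (doubleGen V b δ) ≤ amp A H := fun _ hT =>
  (h.vnGen_doubleGen_le hδ hT).1

/-- The isomorphism onto the double crossed product, as a homomorphism. -/
def dualHom : vnGen (doubleGen V b δ) →⋆ₙₐ[ℂ] Op (Ten (Ten K H) H) :=
  compress ((ampHom δ H).comp
    (NonUnitalStarSubalgebra.inclusion (h.vnGen_doubleGen_le_amp hδ))) (leg23 K V.I)
    fun T => ampHom_mul_final hδ _ (h.vnGen_doubleGen_le hδ T.2).2.2

theorem dualHom_delta_mul (a : A) (y : Op H)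
    (hT : δ a * tens 1 y ∈ vnGen (doubleGen V b δ)) :
    h.dualHom hδ ⟨δ a * tens 1 y, hT⟩ =
      leg12 (δ a) * leg23 K (star V.I * tens 1 y * V.I) := compress_delta_mul hδ a y

theorem dualHom_normal : IsNormalMap (h.dualHom hδ) := by
  refine compress_normal ?_ _
  have h1 : Continuous[(sigmaWeak (Ten K H)).induced Subtype.val, sigmaWeak (Ten K H)]
      fun T : vnGen (doubleGen V b δ) => T.1 := continuous_induced_dom
  exact IsNormalMap.comp (t := (sigmaWeak (Ten K H)).induced Subtype.val)
    (ampHom_normal (H := H) hδ.normal) h1 fun T => h.vnGen_doubleGen_le_amp hδ T.2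

/-- Conjugation by I₂₃ undoes the compression and returns (δ ⊗ i)(T). The counit on the middle leg
then inverts δ on each entry over the third leg. Both operations are defined and continuous on all
of L(K ⊗ H ⊗ H). -/
theorem exists_leftInverse_dualHom : ∃ Ψ : Op (Ten (Ten K H) H) → Op (Ten K H),
    Continuous[sigmaWeak (Ten (Ten K H) H), sigmaWeak (Ten K H)] Ψ ∧
      ∀ T, Ψ (h.dualHom hδ T) = T.1 := by
  obtain ⟨ω, hω⟩ := h.exists_counit
  refine ⟨fun X => ∑ i, ∑ j, tens (sliceRight ω
    (entry i j (leg23 K V.I * X * star (leg23 K V.I)))) (ketbra i j), ?_, fun T => ?_⟩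
  · let _ := sigmaWeak (Ten (Ten K H) H)
    refine continuous_sw_sum (K := Ten K H) _ fun i _ => continuous_sw_sum (K := Ten K H) _
      fun j _ => ?_
    refine @Continuous.comp _ _ _ _ (sigmaWeak K) (sigmaWeak (Ten K H)) _ _
      (continuous_sw_tens (ketbra i j : Op H)) ?_
    refine continuous_sw_sum (K := K) _ fun k _ => continuous_sw_sum (K := K) _
      fun l _ => ?_
    refine @Continuous.comp _ _ _ _ (sigmaWeak K) (sigmaWeak K) _ _
      (continuous_sw_smul (ω (ketbra k l))) ?_
    refine @Continuous.comp _ _ _ _ (sigmaWeak (Ten K H)) (sigmaWeak K) _ _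
      (continuous_sw_sl (stdOrthonormalBasis ℂ H k) (stdOrthonormalBasis ℂ H l)) ?_
    exact @Continuous.comp _ _ _ _ (sigmaWeak (Ten (Ten K H) H)) (sigmaWeak (Ten K H)) _ _
      (continuous_sw_sl (K := Ten K H) (stdOrthonormalBasis ℂ H i) (stdOrthonormalBasis ℂ H j))
      (continuous_sw_mul _ _)
  · conv_rhs => rw [← sum_entry_ketbra T.1]
    refine Finset.sum_congr rfl fun i _ => Finset.sum_congr rfl fun j _ =>
      congrArg (tens · (ketbra i j)) ?_
    have h1 : leg23 K V.I * h.dualHom hδ T * star (leg23 K V.I) =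
        ampHom δ H ⟨T.1, h.vnGen_doubleGen_le_amp hδ T.2⟩ := mul_compress_mul _ T
    change sliceRight ω (entry i j (leg23 K V.I * h.dualHom hδ T * star (leg23 K V.I))) = _
    rw [h1, entry_ampHom, sliceRight_delta hδ hω]

section Dual

variable {bh : (V.qgHat.tgt)ᵐᵒᵖ →⋆ₙₐ[ℂ] crossed V.qg b δ V.Sh}
  {δh : crossed V.qg b δ V.Sh →⋆ₙₐ[ℂ] Op (Ten (Ten K H) H)}
  (hbh : ∀ x : Base n, (bh (op ⟨V.α x, x, rfl⟩) : Op (Ten K H)) =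
      eAct V.qg b * tens 1 (V.βh (op x)))
  (hδh : ∀ x : crossed V.qg b δ V.Sh, δh x =
      leg23 K (V.tilde J Jh) * leg12 (x : Op (Ten K H)) * star (leg23 K (V.tilde J Jh)))

omit h hδ in
theorem Sh_le_centralizer {y : Op H} (hy : y ∈ V.Sh) : y ∈ Set.centralizer (Set.range V.β) := by
  rintro _ ⟨x, rfl⟩
  exact (V.Sh_comm_be hy (unop x)).symm

omit h hδ in
theorem commutant_le_centralizer (h1 : 1 ∈ V.S) {r : Op H}
    (hr : r ∈ Set.centralizer (V.S : Set (Op H))) : r ∈ Set.centralizer (Set.range V.β) := by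
  rintro _ ⟨x, rfl⟩
  have h2 : V.be (unop x) * r = r * V.be (unop x) := hr (V.be (unop x)) (V.be_mem_S h1 (unop x))
  exact h2

omit h hδ in
theorem delta_b_mul_mem {y : Op H} (hy : y ∈ Set.centralizer (Set.range V.β)) :
    δ (b 1) * tens 1 y ∈ vnGen (doubleGen V b δ) :=
  subset_vnGen _ (Or.inr ⟨y, hy, rfl⟩)

omit h in
theorem delta_mul_mem_doubleGen (a : A) {y : Op H} (hy : y ∈ Set.centralizer (Set.range V.β)) :
    δ a * tens 1 y ∈ vnGen (doubleGen V b δ) := by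
  rw [← delta_mul_b hδ a, mul_assoc]
  exact mul_mem (subset_vnGen _ (Or.inl ⟨a, rfl⟩)) (delta_b_mul_mem hy)

include hδh

theorem dualHom_crossed (a : A) {y : Op H} (hy : y ∈ V.Sh) :
    h.dualHom hδ ⟨δ a * tens 1 y, delta_mul_mem_doubleGen hδ a (Sh_le_centralizer hy)⟩ =
      δh ⟨δ a * tens 1 y, h.delta_mul_mem hδ a hy⟩ := by
  rw [dualHom_delta_mul, h.dualAct_delta hδ hδh a hy, comulHatₗ_apply]

omit hδh
include hbh

/-- The second leg of `I` lies in `S`, so 1 ⊗ r commutes with `I` and only the initial support I*I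
remains. Together with δ(1) ⊗ 1 it forms the projection of the dual coaction. -/
theorem dualHom_commutant {r : Op H} (hr : r ∈ Set.centralizer (V.S : Set (Op H))) :
    h.dualHom hδ ⟨δ (b 1) * tens 1 r,
      delta_b_mul_mem (commutant_le_centralizer h.mS.one_mem hr)⟩ =
      eAct V.qgHat bh * tens 1 r := by
  rw [dualHom_delta_mul, eAct_dual hbh, h.eAct_eq_delta hδ, mul_assoc, mul_assoc,
    ← I_comm_commutant hr, ← mul_assoc, leg23_mul, leg23_one_tens]

include hδh

/-- The homomorphism is known on δ(A), on Ŝ and on S'. The generators in β(N)' are reached because Ŝ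
S' spans β(N)'. -/
theorem doubleGen_subset_pullback : doubleGen V b δ ⊆ pullback (h.dualHom hδ)
    (crossed V.qgHat bh δh (Set.centralizer (V.S : Set (Op H)))) := by
  have hc : ∀ a, ∀ y ∈ V.Sh, δ a * tens 1 y ∈ pullback (h.dualHom hδ)
      (crossed V.qgHat bh δh (Set.centralizer (V.S : Set (Op H)))) := fun a y hy => by
    refine ⟨delta_mul_mem_doubleGen hδ a (Sh_le_centralizer hy), ?_⟩
    rw [h.dualHom_crossed hδ hδh a hy]
    exact subset_vnGen _ (Or.inl ⟨_, rfl⟩)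
  rintro _ (⟨a, rfl⟩ | ⟨y, hy, rfl⟩)
  · have h1 := hc a 1 h.mSh.one_mem
    rwa [tens_one, mul_one] at h1
  · rw [← h.span_mul_commutant] at hy
    refine Submodule.span_induction (p := fun y _ => δ (b 1) * tens 1 y ∈ pullback (h.dualHom hδ)
      (crossed V.qgHat bh δh (Set.centralizer (V.S : Set (Op H))))) ?_ ?_
      (fun y z _ _ hy hz => ?_) (fun c y _ hy => ?_) hy
    · rintro _ ⟨s, hs, r, hr, rfl⟩
      -- The projection δ(1) commutes with 1 ⊗ s, so it can be placed between the two factors.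
      have h1 : δ (b 1) * tens 1 (s * r) = (δ (b 1) * tens 1 s) * (δ (b 1) * tens 1 r) := by
        rw [← h.delta_b_comm hδ (Sh_le_centralizer hs), mul_assoc, ← mul_assoc (δ (b 1)),
          delta_b_mul hδ, ← mul_assoc, h.delta_b_comm hδ (Sh_le_centralizer hs), mul_assoc,
          tens_mul, one_mul]
      rw [h1]
      refine mul_mem (hc _ s hs) ⟨delta_b_mul_mem (commutant_le_centralizer h.mS.one_mem hr), ?_⟩
      rw [h.dualHom_commutant hδ hbh hr]
      exact subset_vnGen _ (Or.inr ⟨r, hr, rfl⟩)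
    · rw [tens_zero_right, mul_zero]
      exact zero_mem _
    · rw [tens_add_right, mul_add]
      exact add_mem hy hz
    · rw [tens_smul_right, op_mul_smul]
      exact SMulMemClass.smul_mem c hy

theorem nonempty_double_equiv :
    Nonempty (crossed V.qgHat bh δh (Set.centralizer (V.S : Set (Op H))) ≃⋆ₐ[ℂ]
      vnGen (doubleGen V b δ)) := by
  obtain ⟨Ψ, hΨ, hl⟩ := h.exists_leftInverse_dualHom hδ
  refine nonempty_equiv_vnGen (h.dualHom_normal hδ) hΨ hl
    (h.doubleGen_subset_pullback hδ hbh hδh) ?_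
  rintro _ (⟨x, rfl⟩ | ⟨r, hr, rfl⟩)
  · refine h.crossed_induction hδ (p := fun x => δh x ∈ NonUnitalStarAlgHom.range (h.dualHom hδ))
      (fun a c d => ?_) (fun x y hx hy => ?_) (fun c x hx hp => ?_) x
    · exact ⟨_, h.dualHom_crossed hδ hδh a (V.sl_mem_Sh c d)⟩
    · rw [map_add]
      exact add_mem hx hy
    · rw [dualAct_smul hδh c x hx]
      exact SMulMemClass.smul_mem c hp
  · exact ⟨_, h.dualHom_commutant hδ hbh hr⟩

end Dual

end Canonical

end Mpi

/-! ### Assembly of the dual coaction and of the duality -/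

namespace Mpi.Canonical

variable {G : Type w} [Fintype G] {n : G → ℕ}
variable {H : Type v} [NormedAddCommGroup H] [InnerProductSpace ℂ H]
  [FiniteDimensional ℂ H] [CompleteSpace H] {V : Mpi n H}
  {e eh : H} {J Jh : H ≃ₗᵢ⋆[ℂ] H} {D Di Dh Dhi : Op H}
  {K : Type u} [NormedAddCommGroup K] [InnerProductSpace ℂ K] [CompleteSpace K]
  {A : NonUnitalStarSubalgebra ℂ (Op K)} {b : (V.qg.tgt)ᵐᵒᵖ →⋆ₙₐ[ℂ] A}
  {δ : A →⋆ₙₐ[ℂ] Op (Ten K H)}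

set_option maxHeartbeats 1000000 in
theorem exists_dual_coaction (h : V.Canonical e eh J Jh D Di Dh Dhi)
    (hδ : IsRightAction V.qg A b δ) :
    ∃ (bh : (V.qgHat.tgt)ᵐᵒᵖ →⋆ₙₐ[ℂ] crossed V.qg b δ V.Sh)
      (δh : crossed V.qg b δ V.Sh →⋆ₙₐ[ℂ] Op (Ten (Ten K H) H)),
      (∀ x : Base n, (bh (op ⟨V.α x, x, rfl⟩) : Op (Ten K H)) =
        eAct V.qg b * tens 1 (V.βh (op x))) ∧
      (∀ x : crossed V.qg b δ V.Sh, δh x = leg23 K (V.tilde J Jh) * leg12 (x : Op (Ten K H)) *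
        star (leg23 K (V.tilde J Jh))) ∧
      IsRightAction V.qgHat (crossed V.qg b δ V.Sh) bh δh ∧
      (fun x => δ (b 1) * tens 1 x) ''
          (Submodule.span ℂ {T | ∃ s ∈ V.Sh, ∃ t ∈ Set.centralizer (V.S : Set (Op H)),
            T = s * t} : Set (Op H)) =
        (fun x => δ (b 1) * tens 1 x) '' Set.centralizer (Set.range V.β) ∧
      Nonempty (crossed V.qgHat bh δh (Set.centralizer (V.S : Set (Op H))) ≃⋆ₐ[ℂ]
        vnGen (Set.range δ ∪
          (fun x => δ (b 1) * tens 1 x) '' Set.centralizer (Set.range V.β))) := by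
  obtain ⟨bh, hbh⟩ := h.exists_dualBase hδ
  obtain ⟨δh, hδh⟩ := h.exists_dualAct hδ
  exact ⟨bh, δh, hbh, hδh, h.isRightAction_dual hδ hbh hδh,
    congrArg (Set.image _) h.span_mul_commutant, h.nonempty_double_equiv hδ hbh hδh⟩

end Mpi.Canonical

end FiniteQG

end

theorem mainTheorem7 {G : Type*} [Fintype G] (n : G → ℕ)
    {H : Type*} [NormedAddCommGroup H] [InnerProductSpace ℂ H] [FiniteDimensional ℂ H]
    [CompleteSpace H] (V : FiniteQG.Mpi n H) (hreg : V.IsRegular)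
    (e eh : H) (J Jh : H ≃ₗᵢ⋆[ℂ] H) (hirr : V.IsIrreducible e eh J Jh)
    {K : Type*} [NormedAddCommGroup K] [InnerProductSpace ℂ K] [CompleteSpace K]
    (A : NonUnitalStarSubalgebra ℂ (FiniteQG.Op K)) (b : (V.qg.tgt)ᵐᵒᵖ →⋆ₙₐ[ℂ] A)
    (δ : A →⋆ₙₐ[ℂ] FiniteQG.Op (FiniteQG.Ten K H)) (hδ : FiniteQG.IsRightAction V.qg A b δ) :
    ∃ (bh : (V.qgHat.tgt)ᵐᵒᵖ →⋆ₙₐ[ℂ] FiniteQG.crossed V.qg b δ V.Sh)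
      (δh : FiniteQG.crossed V.qg b δ V.Sh →⋆ₙₐ[ℂ]
        FiniteQG.Op (FiniteQG.Ten (FiniteQG.Ten K H) H)),
      (∀ x : FiniteQG.Base n, (bh (op ⟨V.α x, x, rfl⟩) : FiniteQG.Op (FiniteQG.Ten K H)) =
        FiniteQG.eAct V.qg b * FiniteQG.tens 1 (V.βh (op x))) ∧
      (∀ x : FiniteQG.crossed V.qg b δ V.Sh, δh x =
        FiniteQG.leg23 K (V.tilde J Jh) * FiniteQG.leg12 (x : FiniteQG.Op (FiniteQG.Ten K H)) *
          star (FiniteQG.leg23 K (V.tilde J Jh))) ∧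
      FiniteQG.IsRightAction V.qgHat (FiniteQG.crossed V.qg b δ V.Sh) bh δh ∧
      (fun x => δ (b 1) * FiniteQG.tens 1 x) ''
          (Submodule.span ℂ {T | ∃ s ∈ V.Sh, ∃ t ∈ Set.centralizer (V.S : Set (FiniteQG.Op H)),
            T = s * t} : Set (FiniteQG.Op H)) =
        (fun x => δ (b 1) * FiniteQG.tens 1 x) '' Set.centralizer (Set.range V.β) ∧
      Nonempty (FiniteQG.crossed V.qgHat bh δh (Set.centralizer (V.S : Set (FiniteQG.Op H))) ≃⋆ₐ[ℂ]
        FiniteQG.vnGen (Set.range δ ∪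
          (fun x => δ (b 1) * FiniteQG.tens 1 x) '' Set.centralizer (Set.range V.β))) := by
  obtain ⟨D, Di, Dh, Dhi, h⟩ := FiniteQG.Mpi.exists_canonical V hreg hirr
  exact h.exists_dual_coaction hδ
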